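/- Let $X$ be a paracompact Hausdorff compactly generated space and let $\mathbb H=(H_x)_{x\in X}$ be a locally trivial Hilbert bundle over $X$ whose fibers are isometric to a separable infinite dimensional complex Hilbert space $H$ (the transition maps $(V\cap V')\times H\to (V\cap V')\times H$ are continuous and fiberwise unitary). Let $\mathbb A=(A_x)_{x\in X}$ be a family of (possibly unbounded) self-adjoint Fredholm operators $A_x$ in $H_x$. *Fredholm families.* A pair $(A,\varepsilon)$ with $A$ self-adjoint and $\varepsilon>0$ is *enhanced* if $\pm\varepsilon\notin\sigma(A)$ and the spectral projection $P_{[-\varepsilon,\varepsilon]}(A)$ has finite rank. A pair $(U,\varepsilon)$, $U\subset X$, is *adapted to* $\mathbb A$ if $(A_x,\varepsilon)$ is enhanced for all $x\in U$, and the subspaces $V_x=\operatorname{Im}P_{[-\varepsilon,\varepsilon]}(A_x)$ and the operators $V_x\to V_x$ induced by $A_x$ depend continuously on $x\in U$. The family $\mathbb A$ is a *Fredholm family* if each point of $X$ has a neighborhood $U$ such that $(U,\varepsilon)$ is adapted to $\mathbb A$ for some $\varepsilon>0$; assume this. For a family $\mathbb B=(B_y)$ of closed, not necessarily self-adjoint,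 Fredholm operators, $(B,\varepsilon)$ is *enhanced* if $\varepsilon>0$, $\varepsilon\notin\sigma(|B|)$ and $P_{[0,\varepsilon]}(|B|)$ has finite rank; adapted pairs are defined in the same way by means of the subspaces $E_1(y)=\operatorname{Im}P_{[0,\varepsilon]}(|B_y|)$, $E_2(y)=\operatorname{Im}P_{[0,\varepsilon]}(|B_y^*|)$ and the operators $E_1(y)\to E_2(y)$ induced by $B_y$. *Categories.* For an open covering $U=(U_a)_{a\in\Sigma}$, let $X_U$ be the topological category with objects $(x,\sigma)$, where $\sigma\subset\Sigma$ is finite, non-empty, and $x\in\bigcap_{a\in\sigma}U_a$, and with one morphism $(x,\tau)\to(x,\sigma)$ whenever $\sigma\subset\tau$. Let $\mathrm{pr}:|X_U|\to X$ be the projection of its classifying space. Let $\hat{\mathcal S}(\mathbb H)$ be the topological category of finite dimensional subspaces of fibers of $\mathbb H$, where a morphism $V\to V'$ is an orthogonal decomposition $V'=U_-\oplus V\oplus U_+$ inside one fiber. Let $\mathcal S(\mathbb H)$ be the topological category of pairs $(E_1,E_2)$ of finite dimensional subspaces of the same fiber, where a morphism $(E_1,E_2)\to(E_1',E_2')$ is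 a pair of orthogonal decompositions $E_i'=E_i\oplus F_i$ together with an isometric isomorphism $F_1\to F_2$. *The analytic index.* Given an open covering $U$ and numbers $\varepsilon_a$ such that all $(U_a,\varepsilon_a)$ are adapted to $\mathbb A$, put $\varepsilon_\sigma=\min_{a\in\sigma}\varepsilon_a$. The index functor $X_U\to\hat{\mathcal S}(\mathbb H)$ takes $(x,\tau)$ to $\operatorname{Im}P_{[-\varepsilon_\tau,\varepsilon_\tau]}(A_x)$ and the morphism $(x,\tau)\to(x,\sigma)$ to the morphism with negative part $\operatorname{Im}P_{[-\varepsilon_\sigma,-\varepsilon_\tau]}(A_x)$ and positive part $\operatorname{Im}P_{[\varepsilon_\tau,\varepsilon_\sigma]}(A_x)$. An *index map* of $\mathbb A$ is the composition of a continuous map $s:X\to|X_U|$ such that $\mathrm{pr}\circ s=\mathrm{id}$ and $s\circ\mathrm{pr}$ is homotopic to $\mathrm{id}$ over $X$ with the induced map $|X_U|\to|\hat{\mathcal S}(\mathbb H)|$. The *analytic index* of $\mathbb A$ is the homotopy class $X\to|\hat{\mathcal S}(\mathbb H)|$ containing all index maps. For a family $\mathbb B$ of general Fredholm operators index maps to $|\mathcal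 S(\mathbb H)|$ are defined similarly: the index functor takes $(x,\tau)$ to $\bigl(\operatorname{Im}P_{[0,\varepsilon_\tau]}(|B_x|),\operatorname{Im}P_{[0,\varepsilon_\tau]}(|B_x^*|)\bigr)$, and takes the morphism $(x,\tau)\to(x,\sigma)$ to the morphism given by the isometry $\operatorname{Im}P_{[\varepsilon_\tau,\varepsilon_\sigma]}(|B_x|)\to\operatorname{Im}P_{[\varepsilon_\tau,\varepsilon_\sigma]}(|B_x^*|)$ induced by the partial isometry of the polar decomposition of $B_x$. *The classical analytic index.* The *classical analytic index* of $\mathbb A$ is the class, with respect to homotopies fixed on $X\times\{0,\pi\}$, of maps $X\times[0,\pi]\to|\mathcal S(\mathbb H\times[0,\pi])|$ containing all index maps of the family $B_{x,t}=\cos t\cdot\mathrm{id}+iA_x\sin t$, $(x,t)\in X\times[0,\pi]$. Here $\mathbb H\times[0,\pi]$ is the pull-back of $\mathbb H$ to $X\times[0,\pi]$. *Finite-polarized replacements.* Let $(U,\varepsilon_U)$ be a family of pairs adapted to $\mathbb A$ such that $\varepsilon_U<1$ and the sets $U$ form a locally finite open covering of $X$. Let $(r_U)$ be a partition of unity subordinated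 to this covering, and let $r(x)=\sum_U r_U(x)\varepsilon_U$. For $0<r<1$ let $\chi_r:\mathbf R\to\mathbf R$ be the odd function with $\chi_r(u)=u$ for $0\le u\le r/2$, $\chi_r(u)=(2/r-1)u+r-1$ for $r/2\le u\le r$, and $\chi_r(u)=1$ for $u\ge r$. The corresponding finite-polarized replacement of $\mathbb A$ is the family $\mathbb A'$ of the operators $A'_x=\chi_{r(x)}(A_x)$. **Theorem.** For every finite-polarized replacement $\mathbb A'$ of $\mathbb A$, the analytic indices of $\mathbb A$ and $\mathbb A'$ are defined (index maps exist, and all of them are homotopic) and are equal, and the classical analytic indices of $\mathbb A$ and $\mathbb A'$ are defined (index maps exist, and all of them are homotopic relative to $X\times\{0,\pi\}$) and are equal. -/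

import Mathlib

open Set Filter Topology CategoryTheory
open scoped InnerProductSpace LinearPMap CompactCoherentification

universe u v w

noncomputable section

namespace FredholmIndex

/-! ### Closed operators in a Hilbert space

Operators are possibly unbounded: they are partially defined linear maps `K →ₗ.[ℂ] K`.  A bounded
operator `T` is the partial map `T.toPMap ⊤`.  Functions of an unbounded operator are defined by
means of its bounded transform `A (1 + A* A)^(-1/2)`, to which the continuous functional calculus of
the C*-algebra of bounded operators applies. -/

section Operators

variable {K : Type*} [NormedAddCommGroup K] [InnerProductSpace ℂ K] [CompleteSpace K]

/-- The set of all pairs `(√(1 - T* T) v, T v)`; it is the graph of `T (1 - T* T)^(-1/2)` if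
`T` is a contraction and `1 - T* T` is injective. -/
def transformGraph (T : K →L[ℂ] K) : Submodule ℂ (K × K) :=
  LinearMap.range
    (((CFC.sqrt (1 - star T * T) : K →L[ℂ] K) : K →ₗ[ℂ] K).prod (T : K →ₗ[ℂ] K))

/-- `T` is the bounded transform `B (1 + B* B)^(-1/2)` of `B`, i.e. `T` is a contraction and
`B = T (1 - T* T)^(-1/2)`.  A densely defined closed operator has exactly one bounded transform. -/
def IsBoundedTransform (B : K →ₗ.[ℂ] K) (T : K →L[ℂ] K) : Prop :=
  ‖T‖ ≤ 1 ∧ B.graph = transformGraph T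

/-- The bounded transform `B (1 + B* B)^(-1/2)` of a densely defined closed operator `B`. -/
def boundedTransform (B : K →ₗ.[ℂ] K) : K →L[ℂ] K :=
  Classical.epsilon (IsBoundedTransform B)

/-- The function `s ↦ f (s / √(1 - s²))` on `(-1, 1)`, extended to `-1` and `1` by the limits of
`f` at `-∞` and `+∞`. -/
def compress (f : ℝ → ℝ) (s : ℝ) : ℝ :=
  if 1 ≤ s then limUnder atTop f
  else if s ≤ -1 then limUnder atBot f
  else f (s / √(1 - s ^ 2))

/-- The bounded operator `f(A)` for a self-adjoint operator `A` and a bounded function `f`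
continuous on the spectrum of `A` and having limits at `-∞` and `+∞`. -/
def funCalc (f : ℝ → ℝ) (A : K →ₗ.[ℂ] K) : K →L[ℂ] K :=
  cfc (compress f) (boundedTransform A)

/-- The spectral projection `P_[a, b](A)` of a self-adjoint operator `A`.  It is used only for
intervals `[a, b]` whose indicator function is continuous on the spectrum of `A`. -/
def specProj (A : K →ₗ.[ℂ] K) (a b : ℝ) : K →L[ℂ] K :=
  funCalc (Set.indicator (Set.Icc a b) 1) A

/-- The image of the spectral projection `P_[a, b](A)`. -/
def specIm (A : K →ₗ.[ℂ] K) (a b : ℝ) : Submodule ℂ K :=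
  LinearMap.range (specProj A a b : K →ₗ[ℂ] K)

/-- The spectrum of a closed operator: the set of `z` such that `A - z` is not a bijection of the
domain onto the whole space. -/
def opSpectrum (A : K →ₗ.[ℂ] K) : Set ℂ :=
  {z | ¬ Function.Bijective (fun v : A.domain => A v - z • (v : K))}

/-- A closed operator is Fredholm if its kernel and cokernel are finite dimensional and its image
is closed. -/
def IsFredholmOp (A : K →ₗ.[ℂ] K) : Prop :=
  FiniteDimensional ℂ (LinearMap.ker A.toFun) ∧
    IsClosed (LinearMap.range A.toFun : Set K) ∧
    FiniteDimensional ℂ (K ⧸ LinearMap.range A.toFun)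

/-- The absolute value `|B| = √(B* B)` of a densely defined closed operator: its bounded transform
is the absolute value of the bounded transform of `B`. -/
def absOp (B : K →ₗ.[ℂ] K) : K →ₗ.[ℂ] K :=
  (transformGraph (CFC.abs (boundedTransform B))).toLinearPMap

/-- `U` is the partial isometry from the polar decomposition `B = U |B|`, with `ker U = ker B`. -/
def IsPolarPart (B : K →ₗ.[ℂ] K) (U : K →L[ℂ] K) : Prop :=
  U * star U * U = U ∧ B = (U : K →ₗ[ℂ] K).compPMap (absOp B) ∧
    LinearMap.ker (U : K →ₗ[ℂ] K) = (LinearMap.ker B.toFun).map B.domain.subtype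

/-- The partial isometry `U` from the polar decomposition `B = U |B|`. -/
def polarPart (B : K →ₗ.[ℂ] K) : K →L[ℂ] K :=
  Classical.epsilon (IsPolarPart B)

/-- `(A, ε)` is an enhanced self-adjoint operator. -/
structure IsEnhancedSA (A : K →ₗ.[ℂ] K) (ε : ℝ) : Prop where
  pos : 0 < ε
  notMem : (ε : ℂ) ∉ opSpectrum A
  neg_notMem : ((-ε : ℝ) : ℂ) ∉ opSpectrum A
  finite : FiniteDimensional ℂ (specIm A (-ε) ε)

/-- `(B, ε)` is an enhanced (not necessarily self-adjoint) Fredholm operator. -/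
structure IsEnhanced (B : K →ₗ.[ℂ] K) (ε : ℝ) : Prop where
  pos : 0 < ε
  fredholm : IsFredholmOp B
  notMem : (ε : ℂ) ∉ opSpectrum (absOp B)
  finite : FiniteDimensional ℂ (specIm (absOp B) 0 ε)

/-- The operator `B_t = cos t + i A sin t`, defined on the domain of `A` if `sin t ≠ 0`, and the
multiplication by `cos t` on the whole space if `sin t = 0`. -/
def rotated (A : K →ₗ.[ℂ] K) (t : ℝ) : K →ₗ.[ℂ] K :=
  if Real.sin t = 0 then ((Real.cos t : ℂ) • (LinearMap.id : K →ₗ[ℂ] K)).toPMap ⊤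
  else ((Real.cos t : ℂ) • (LinearMap.id : K →ₗ[ℂ] K)).toPMap ⊤ +
    (Complex.I * (Real.sin t : ℂ)) • A

end Operators

/-- The odd function `χ_r` equal to `u` for `0 ≤ u ≤ r / 2`, to `(2 / r - 1) u + r - 1` for
`r / 2 ≤ u ≤ r`, and to `1` for `r ≤ u`. -/
def chi (r u : ℝ) : ℝ :=
  let g : ℝ → ℝ := fun v => if v ≤ r / 2 then v else if v ≤ r then (2 / r - 1) * v + r - 1 else 1
  if 0 ≤ u then g u else - g (-u)

/-! ### Classifying spaces of topological categories

A topological category is a category together with a topology on the set of all its morphisms;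
objects are identified with their identity morphisms. -/

section Realization

universe v₁ u₁ v₂ u₂

/-- The `n`-simplices of the nerve of `C`. -/
def NerveSimplex (C : Type u₁) [Category.{v₁} C] (n : ℕ) : Type _ := ComposableArrows C n

variable (C : Type u₁) [Category.{v₁} C] [TopologicalSpace (Arrow C)]

/-- The topology on the set of chains of `n` composable morphisms: the topology induced from the
product topology on tuples of morphisms, made compactly generated. -/
instance (n : ℕ) : TopologicalSpace (NerveSimplex C n) :=
  @CompactCoherentification.instTopologicalSpace (NerveSimplex C n)
    (TopologicalSpace.induced
      (fun (F : ComposableArrows C n) (ij : {ij : Fin (n + 1) × Fin (n + 1) // ij.1 ≤ ij.2}) =>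
        Arrow.mk (F.map (homOfLE ij.2)))
      inferInstance)

/-- The disjoint union of the products of the spaces of `n`-simplices of the nerve and the
standard `n`-simplices. -/
abbrev PreRealization : Type _ :=
  Σ n : ℕ, NerveSimplex C n × stdSimplex ℝ (Fin (n + 1))

/-- `(θ^* F, p)` is identified with `(F, θ_* p)` for every non-decreasing map `θ`. -/
inductive Glue : PreRealization C → PreRealization C → Prop
  | mk {m n : ℕ} (θ : Fin (m + 1) →o Fin (n + 1)) (F : ComposableArrows C n)
      (p : stdSimplex ℝ (Fin (m + 1))) :
      Glue ⟨m, (θ.monotone.functor ⋙ F : ComposableArrows C m), p⟩ ⟨n, F, stdSimplex.map θ p⟩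

/-- The geometric realization `|C|` (classifying space) of a topological category `C`. -/
def Realization : Type _ := Quot (Glue C)

instance : TopologicalSpace (Realization C) :=
  inferInstanceAs (TopologicalSpace (Quot (Glue C)))

variable {C}

/-- The map of classifying spaces defined by a functor. -/
def Realization.map {D : Type u₂} [Category.{v₂} D] [TopologicalSpace (Arrow D)] (G : C ⥤ D) :
    Realization C → Realization D :=
  Quot.map (fun q => ⟨q.1, (Functor.comp (show ComposableArrows C q.1 from q.2.1) G), q.2.2⟩) (by
    rintro _ _ ⟨θ, F, p⟩
    exact Glue.mk θ (F ⋙ G) p)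

/-- Morphisms of a disjoint union of categories preserve the component. -/
theorem fst_eq_of_hom {I : Type*} {D : I → Type u₂} [∀ i, Category.{v₂} (D i)] {a b : Σ i, D i}
    (f : a ⟶ b) : a.1 = b.1 := by
  obtain ⟨_⟩ := (f : Sigma.SigmaHom a b)
  rfl

/-- The map `|C| → I` induced by the projection of a disjoint union `C` of categories `D i`, `i : I`
(with a topology that in general is not that of a disjoint union) to the category `I` having only
identity morphisms. -/
def Realization.proj {I : Type*} {D : I → Type u₂} [∀ i, Category.{v₂} (D i)]
    [TopologicalSpace (Arrow (Σ i, D i))] : Realization (Σ i, D i) → I :=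
  Quot.lift (fun q => ((show ComposableArrows (Σ i, D i) q.1 from q.2.1).obj 0).1) (by
    rintro _ _ ⟨θ, F, p⟩
    exact (fst_eq_of_hom (F.map (homOfLE (Fin.zero_le (θ 0))))).symm)

/-- The functor between disjoint unions of categories defined by functors between the components. -/
def sigmaFunctor {I : Type*} {D : I → Type u₁} [∀ i, Category.{v₁} (D i)] {D' : I → Type u₂}
    [∀ i, Category.{v₂} (D' i)] (G : ∀ i, D i ⥤ D' i) : (Σ i, D i) ⥤ Σ i, D' i :=
  Sigma.desc fun i => G i ⋙ Sigma.incl i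

/-- A morphism of a disjoint union of categories as a morphism of one of these categories. -/
def arrowFiber {I : Type*} {D : I → Type u₂} [∀ i, Category.{v₂} (D i)] :
    Arrow (Σ i, D i) → Σ i, Arrow (D i)
  | ⟨_, _, Sigma.SigmaHom.mk f⟩ => ⟨_, Arrow.mk f⟩

end Realization

/-! ### The category `X_U` of a covering -/

section Covering

variable {X : Type u} {ι : Type w}

/-- The finite non-empty sets `σ` of indices such that `x ∈ U a` for every `a ∈ σ`. -/
structure CoverFiber (U : ι → Set X) (x : X) : Type w where
  carrier : Finset ι
  nonempty : carrier.Nonempty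
  mem : ∀ a ∈ carrier, x ∈ U a

/-- `σ ≤ τ` if `τ ⊆ σ`. -/
instance (U : ι → Set X) (x : X) : Preorder (CoverFiber U x) where
  le σ τ := τ.carrier ⊆ σ.carrier
  le_refl _ := Finset.Subset.refl _
  le_trans _ _ _ h₁ h₂ := Finset.Subset.trans h₂ h₁

/-- The category `X_U`: its objects are pairs `(x, σ)` with `x ∈ ⋂ a ∈ σ, U a`, and there is a
single morphism `(x, σ) ⟶ (y, τ)` if `x = y` and `τ ⊆ σ`. -/
abbrev CoverCat (U : ι → Set X) : Type (max u w) := Σ x, CoverFiber U x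

/-- The set of morphisms of `X_U` is the disjoint union over the pairs `τ ⊆ σ` of the subspaces
`⋂ a ∈ σ, U a` of `X`. -/
instance [TopologicalSpace X] (U : ι → Set X) : TopologicalSpace (Arrow (CoverCat U)) :=
  letI : TopologicalSpace (Finset ι) := ⊥
  TopologicalSpace.induced
    (fun f : Arrow (CoverCat U) => (f.left.1, f.left.2.carrier, f.right.2.carrier)) inferInstance

/-- `ε_σ = min_{a ∈ σ} ε_a`. -/
def CoverFiber.min {U : ι → Set X} {x : X} (ε : ι → ℝ) (σ : CoverFiber U x) : ℝ :=
  σ.carrier.inf' σ.nonempty ε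

/-- `s` is a homotopy inverse of `pr : |X_U| → X` such that `pr ∘ s` is the identity and `s ∘ pr`
is homotopic to the identity in the class of maps over `X`. -/
def IsHomotopySection [TopologicalSpace X] (U : ι → Set X)
    (s : C(X, Realization (CoverCat U))) : Prop :=
  (∀ x, Realization.proj (s x) = x) ∧
  ∃ h : C(unitInterval × Realization (CoverCat U), Realization (CoverCat U)),
    (∀ q, h (0, q) = s (Realization.proj q)) ∧ (∀ q, h (1, q) = q) ∧
    ∀ t q, Realization.proj (h (t, q)) = Realization.proj q

end Covering

/-! ### Categories of finite dimensional subspaces -/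

section Subspaces

variable (K : Type v) [NormedAddCommGroup K] [InnerProductSpace ℂ K]

/-- Finite dimensional subspaces of `K`. -/
structure SubspaceObj : Type v where
  space : Submodule ℂ K
  finite : FiniteDimensional ℂ space

attribute [instance] SubspaceObj.finite

/-- Pairs of finite dimensional subspaces of `K`. -/
structure PairObj : Type v where
  fst : Submodule ℂ K
  snd : Submodule ℂ K
  finite_fst : FiniteDimensional ℂ fst
  finite_snd : FiniteDimensional ℂ snd

attribute [instance] PairObj.finite_fst PairObj.finite_snd

variable {K}

/-- A morphism `V ⟶ V'` is an orthogonal decomposition `V' = neg ⊕ V ⊕ pos`. -/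
@[ext]
structure SubspaceHom (V V' : SubspaceObj K) : Type v where
  neg : Submodule ℂ K
  pos : Submodule ℂ K
  neg_orth : neg ⟂ V.space
  pos_orth : pos ⟂ V.space
  neg_pos : neg ⟂ pos
  sup_eq : neg ⊔ V.space ⊔ pos = V'.space

/-- The category of finite dimensional subspaces of a Hilbert space; the negative and positive
parts of a composition are the sums of the negative and positive parts. -/
instance : Category (SubspaceObj K) where
  Hom := SubspaceHom
  id V := ⟨⊥, ⊥, by simp, by simp, by simp, by simp⟩
  comp {V V' V''} f g :=
    have hV : V.space ≤ V'.space :=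
      f.sup_eq ▸ le_trans le_sup_right le_sup_left
    have hn : f.neg ≤ V'.space :=
      f.sup_eq ▸ le_trans le_sup_left le_sup_left
    have hp : f.pos ≤ V'.space :=
      f.sup_eq ▸ le_sup_right
    { neg := f.neg ⊔ g.neg
      pos := f.pos ⊔ g.pos
      neg_orth := Submodule.isOrtho_sup_left.2 ⟨f.neg_orth, g.neg_orth.mono_right hV⟩
      pos_orth := Submodule.isOrtho_sup_left.2 ⟨f.pos_orth, g.pos_orth.mono_right hV⟩
      neg_pos := Submodule.isOrtho_sup_left.2
        ⟨Submodule.isOrtho_sup_right.2 ⟨f.neg_pos, (g.pos_orth.mono_right hn).symm⟩,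
          Submodule.isOrtho_sup_right.2 ⟨g.neg_orth.mono_right hp, g.neg_pos⟩⟩
      sup_eq := by
        rw [← g.sup_eq, ← f.sup_eq]
        ac_rfl }
  id_comp f := by
    apply SubspaceHom.ext <;> simp
  comp_id f := by
    apply SubspaceHom.ext <;> simp
  assoc f g h := by
    apply SubspaceHom.ext <;> simp [sup_assoc]

/-- The three orthogonal projections that determine a morphism of `SubspaceObj K`: onto the negative
part, onto the source, onto the positive part. -/
def subspaceCoord (f : Arrow (SubspaceObj K)) : Fin 3 → (K →L[ℂ] K) :=
  have : FiniteDimensional ℂ (f.hom : SubspaceHom f.left f.right).neg :=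
    Submodule.finiteDimensional_of_le (S₂ := f.right.space)
      ((f.hom : SubspaceHom f.left f.right).sup_eq ▸ le_trans le_sup_left le_sup_left)
  have : FiniteDimensional ℂ (f.hom : SubspaceHom f.left f.right).pos :=
    Submodule.finiteDimensional_of_le (S₂ := f.right.space)
      ((f.hom : SubspaceHom f.left f.right).sup_eq ▸ le_sup_right)
  ![(f.hom : SubspaceHom f.left f.right).neg.starProjection, f.left.space.starProjection,
    (f.hom : SubspaceHom f.left f.right).pos.starProjection]

variable [CompleteSpace K]

/-- A morphism `(E₁, E₂) ⟶ (E₁', E₂')` consists of subspaces `F₁`, `F₂` giving orthogonal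
decompositions `E₁' = E₁ ⊕ F₁`, `E₂' = E₂ ⊕ F₂` and of an isometric isomorphism `F₁ → F₂`.  It is
recorded as the partial isometry of `K` equal to this isomorphism on `F₁` and to zero on the
orthogonal complement of `F₁`; then `star iso * iso` and `iso * star iso` are the orthogonal
projections onto `F₁` and `F₂`. -/
@[ext]
structure PairHom (E E' : PairObj K) : Type v where
  iso : K →L[ℂ] K
  initial_eq : star iso * iso = E'.fst.starProjection - E.fst.starProjection
  final_eq : iso * star iso = E'.snd.starProjection - E.snd.starProjection

/-- If `a a* = P' - P` and `b b* = P'' - P'` for projections `P`, `P'`, `P''`, then `a* b = 0`. -/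
theorem star_mul_eq_zero (P P' P'' : Submodule ℂ K) [P.HasOrthogonalProjection]
    [P'.HasOrthogonalProjection] [P''.HasOrthogonalProjection] (a b : K →L[ℂ] K)
    (ha : a * star a = P'.starProjection - P.starProjection)
    (hb : b * star b = P''.starProjection - P'.starProjection) : star a * b = 0 := by
  have normsq : ∀ (Q : Submodule ℂ K) [Q.HasOrthogonalProjection] (v : K),
      RCLike.re (inner ℂ (Q.starProjection v) v) = ‖Q.starProjection v‖ ^ 2 := by
    intro Q _ v
    have h := Submodule.inner_starProjection_left_eq_right Q (Q.starProjection v) v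
    rw [Submodule.starProjection_eq_self_iff.2 (Submodule.starProjection_apply_mem Q v)] at h
    rw [h, inner_self_eq_norm_sq_to_K]
    norm_cast
  have key : ∀ (c : K →L[ℂ] K) (v : K),
      RCLike.re (inner ℂ ((c * star c) v) v) = ‖star c v‖ ^ 2 := by
    intro c v
    rw [mul_apply_eq_comp, ContinuousLinearMap.star_eq_adjoint,
      ← ContinuousLinearMap.adjoint_inner_right, inner_self_eq_norm_sq_to_K]
    norm_cast
  -- `a*` vanishes on the orthogonal complement of `P'`
  have h₁ : ∀ v, P'.starProjection v = 0 → star a v = 0 := by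
    intro v hv
    have := key a v
    rw [ha, sub_apply, hv, zero_sub, inner_neg_left, map_neg, normsq] at this
    have h2 : ‖star a v‖ ^ 2 = 0 := by nlinarith [sq_nonneg ‖star a v‖, sq_nonneg ‖P.starProjection v‖]
    simpa using h2
  -- `b*` vanishes on `P'`
  have h₂ : ∀ v ∈ P', star b v = 0 := by
    intro v hv
    have := key b v
    rw [hb, sub_apply, inner_sub_left, map_sub, normsq, normsq,
      Submodule.starProjection_eq_self_iff.2 hv] at this
    have h3 := Submodule.norm_starProjection_apply_le P'' v
    have h2 : ‖star b v‖ ^ 2 = 0 := by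
      nlinarith [sq_nonneg ‖star b v‖, norm_nonneg (P''.starProjection v), norm_nonneg v]
    simpa using h2
  ext v
  rw [mul_apply_eq_comp, zero_apply]
  apply h₁
  rw [Submodule.starProjection_apply_eq_zero_iff, Submodule.mem_orthogonal]
  intro u hu
  rw [← ContinuousLinearMap.adjoint_inner_left, ← ContinuousLinearMap.star_eq_adjoint, h₂ u hu,
    inner_zero_left]

/-- The category of pairs of finite dimensional subspaces of a Hilbert space; composition is the
direct sum of the isometries. -/
instance : Category (PairObj K) where
  Hom := PairHom
  id E := ⟨0, by simp, by simp⟩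
  comp {E E' E''} f g :=
    have h₁ : star f.iso * g.iso = 0 :=
      star_mul_eq_zero _ _ _ _ _ f.final_eq g.final_eq
    have h₂ : f.iso * star g.iso = 0 := by
      have := star_mul_eq_zero E.fst E'.fst E''.fst (star f.iso) (star g.iso)
        (by rw [star_star, f.initial_eq]) (by rw [star_star, g.initial_eq])
      rwa [star_star] at this
    have h₃ : star g.iso * f.iso = 0 := by
      have := congrArg star h₁
      rwa [star_mul, star_star, star_zero] at this
    have h₄ : g.iso * star f.iso = 0 := by
      have := congrArg star h₂
      rwa [star_mul, star_star, star_zero] at this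
    { iso := f.iso + g.iso
      initial_eq := by
        rw [star_add, add_mul, mul_add, mul_add, h₁, h₃, f.initial_eq, g.initial_eq]
        abel
      final_eq := by
        rw [star_add, add_mul, mul_add, mul_add, h₂, h₄, f.final_eq, g.final_eq]
        abel }
  id_comp f := by
    apply PairHom.ext; simp
  comp_id f := by
    apply PairHom.ext; simp
  assoc f g h := by
    apply PairHom.ext; simp [add_assoc]

/-- The operators that determine a morphism of `PairObj K`: the orthogonal projections onto the two
subspaces of the source, and the partial isometry. -/
def pairCoord (f : Arrow (PairObj K)) : Fin 3 → (K →L[ℂ] K) :=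
  ![f.left.fst.starProjection, f.left.snd.starProjection,
    (f.hom : PairHom f.left f.right).iso]

end Subspaces

/-! ### Hilbert bundles -/

/-- A locally trivial Hilbert bundle over `X` with fibers isomorphic to `H`: a family of Hilbert
spaces with a system of fiberwise isometric local trivializations over open sets covering `X` such
that the transition maps `(V ∩ V') × H → (V ∩ V') × H` are continuous. -/
structure HilbertBundle (X : Type u) [TopologicalSpace X] (H : Type v) [NormedAddCommGroup H]
    [InnerProductSpace ℂ H] where
  Fiber : X → Type v
  [normed : ∀ x, NormedAddCommGroup (Fiber x)]
  [innerProduct : ∀ x, InnerProductSpace ℂ (Fiber x)]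
  Index : Type w
  dom : Index → Set X
  isOpen_dom : ∀ i, IsOpen (dom i)
  exists_mem_dom : ∀ x, ∃ i, x ∈ dom i
  triv : ∀ i, ∀ x : dom i, Fiber x ≃ₗᵢ[ℂ] H
  continuous_transition : ∀ i j, Continuous
    (fun p : {x // x ∈ dom i ∧ x ∈ dom j} × H =>
      triv i ⟨p.1, p.1.2.1⟩ ((triv j ⟨p.1, p.1.2.2⟩).symm p.2))

attribute [instance] HilbertBundle.normed HilbertBundle.innerProduct

section Bundle

variable {X : Type u} [TopologicalSpace X] {H : Type v} [NormedAddCommGroup H]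
  [InnerProductSpace ℂ H] [CompleteSpace H]

instance (E : HilbertBundle.{u, v, w} X H) (x : X) : CompleteSpace (E.Fiber x) := by
  obtain ⟨i, hi⟩ := E.exists_mem_dom x
  exact (completeSpace_congr (e := (E.triv i ⟨x, hi⟩).toHomeomorph.toEquiv)
    (E.triv i ⟨x, hi⟩).isometry.isUniformEmbedding).2 inferInstance

/-- The pull-back of a Hilbert bundle. -/
def HilbertBundle.pullback {Y : Type u} [TopologicalSpace Y] (E : HilbertBundle.{u, v, w} X H)
    (g : C(Y, X)) : HilbertBundle.{u, v, w} Y H where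
  Fiber y := E.Fiber (g y)
  Index := E.Index
  dom i := g ⁻¹' E.dom i
  isOpen_dom i := (E.isOpen_dom i).preimage g.continuous
  exists_mem_dom y := E.exists_mem_dom (g y)
  triv i y := E.triv i ⟨g y, y.2⟩
  continuous_transition i j :=
    (E.continuous_transition i j).comp
      (((g.continuous.comp (continuous_subtype_val.comp continuous_fst)).subtype_mk
        (fun p => p.1.2)).prodMk continuous_snd)

/-- The operator in `H` corresponding to an operator in a fiber under a local trivialization. -/
def HilbertBundle.conj (E : HilbertBundle.{u, v, w} X H) (i : E.Index) (x : E.dom i)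
    (T : E.Fiber x →L[ℂ] E.Fiber x) : H →L[ℂ] H :=
  ((E.triv i x).toContinuousLinearEquiv : E.Fiber x →L[ℂ] H) ∘L T ∘L
    ((E.triv i x).symm.toContinuousLinearEquiv : H →L[ℂ] E.Fiber x)

/-- A family of bounded operators in the fibers over `U` is norm continuous in the local
trivializations.  It is used only for operators of finite rank, when this property does not depend
on the choice of trivializations. -/
def HilbertBundle.ContinuousField (E : HilbertBundle.{u, v, w} X H) (U : Set X)
    (T : ∀ x, E.Fiber x →L[ℂ] E.Fiber x) : Prop :=
  ∀ i, Continuous (fun x : {x // x ∈ U ∧ x ∈ E.dom i} => E.conj i ⟨x, x.2.2⟩ (T x))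

/-- Let `c` describe elements of the sets `S x`, `x ∈ X`, by triples of operators in the fibers.
Over the domain of a local trivialization this identifies these elements with some elements of
`X × B(H)³`, which defines a topology.  The topology on the union of all `S x` is glued from these
topologies. -/
abbrev HilbertBundle.glueTopology (E : HilbertBundle.{u, v, w} X H) {S : X → Type*}
    (c : ∀ x, S x → Fin 3 → (E.Fiber x →L[ℂ] E.Fiber x)) : TopologicalSpace (Σ x, S x) :=
  ⨆ i : E.Index, TopologicalSpace.coinduced
    (Subtype.val : {a : Σ x, S x // a.1 ∈ E.dom i} → Σ x, S x)
    (TopologicalSpace.induced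
      (fun a => ((a.1.1, fun k => E.conj i ⟨a.1.1, a.2⟩ (c a.1.1 a.1.2 k)) :
        X × (Fin 3 → (H →L[ℂ] H)))) inferInstance)

/-- The category `Ŝ(E)` of finite dimensional subspaces of the fibers of `E`. -/
abbrev HilbertBundle.SubspaceCat (E : HilbertBundle.{u, v, w} X H) : Type (max u v) :=
  Σ x, SubspaceObj (E.Fiber x)

/-- The category `S(E)` of pairs of finite dimensional subspaces of the fibers of `E`. -/
abbrev HilbertBundle.PairCat (E : HilbertBundle.{u, v, w} X H) : Type (max u v) :=
  Σ x, PairObj (E.Fiber x)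

/-- The topology on the set of morphisms of `Ŝ(E)`. -/
instance (E : HilbertBundle.{u, v, w} X H) : TopologicalSpace (Arrow E.SubspaceCat) :=
  TopologicalSpace.induced arrowFiber (E.glueTopology fun _ => subspaceCoord)

/-- The topology on the set of morphisms of `S(E)`. -/
instance (E : HilbertBundle.{u, v, w} X H) : TopologicalSpace (Arrow E.PairCat) :=
  TopologicalSpace.induced arrowFiber (E.glueTopology fun _ => pairCoord)

/-! ### Fredholm families of self-adjoint operators and their analytic index -/

/-- The pair `(U, ε)` is adapted to the family `A` of self-adjoint operators: for `x ∈ U` the pairs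
`(A x, ε)` are enhanced operators, the images `V x` of the projections `P_[-ε, ε](A x)` depend
continuously on `x ∈ U`, and so do the operators `V x → V x` induced by `A x` (the latter are
represented by the operators `A x ∘ P_[-ε, ε](A x)`). -/
structure IsAdaptedSA (E : HilbertBundle.{u, v, w} X H) (A : ∀ x, E.Fiber x →ₗ.[ℂ] E.Fiber x)
    (U : Set X) (ε : ℝ) : Prop where
  enhanced : ∀ x ∈ U, IsEnhancedSA (A x) ε
  continuous_proj : E.ContinuousField U fun x => specProj (A x) (-ε) ε
  continuous_induced : ∃ T : ∀ x, E.Fiber x →L[ℂ] E.Fiber x,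
    (∀ x ∈ U, ∀ v, (specProj (A x) (-ε) ε v, T x v) ∈ (A x).graph) ∧ E.ContinuousField U T

/-- Fredholm families of self-adjoint operators. -/
structure IsFredholmFamilySA (E : HilbertBundle.{u, v, w} X H)
    (A : ∀ x, E.Fiber x →ₗ.[ℂ] E.Fiber x) : Prop where
  selfAdjoint : ∀ x, IsSelfAdjoint (A x)
  fredholm : ∀ x, IsFredholmOp (A x)
  adapted : ∀ x, ∃ ε : ℝ, ∃ U ∈ 𝓝 x, IsAdaptedSA E A U ε

/-- `F` is the index functor `X_U ⥤ Ŝ(E)` of the family `A`, for the covering `U` and the numbers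
`ε`.  It takes `(x, τ)` to `Im P_[-ε_τ, ε_τ](A x)`, and the morphism `(x, τ) ⟶ (x, σ)` to the
morphism having `Im P_[-ε_σ, -ε_τ](A x)` and `Im P_[ε_τ, ε_σ](A x)` as the negative and positive
parts. -/
structure IsIndexFunctorSA (E : HilbertBundle.{u, v, w} X H)
    (A : ∀ x, E.Fiber x →ₗ.[ℂ] E.Fiber x) {ι : Type u} (U : ι → Set X) (ε : ι → ℝ)
    (F : ∀ x, CoverFiber U x ⥤ SubspaceObj (E.Fiber x)) : Prop where
  obj_eq : ∀ x (τ : CoverFiber U x), ((F x).obj τ).space = specIm (A x) (-τ.min ε) (τ.min ε)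
  neg_eq : ∀ x (τ σ : CoverFiber U x) (f : τ ⟶ σ),
    SubspaceHom.neg ((F x).map f) = specIm (A x) (-σ.min ε) (-τ.min ε)
  pos_eq : ∀ x (τ σ : CoverFiber U x) (f : τ ⟶ σ),
    SubspaceHom.pos ((F x).map f) = specIm (A x) (τ.min ε) (σ.min ε)

/-- `f : X → |Ŝ(E)|` is an index map of the family `A`, i.e. the composition of a section
`s : X → |X_U|` and the map `|X_U| → |Ŝ(E)|` induced by an index functor. -/
def IsIndexMapSA (E : HilbertBundle.{u, v, w} X H) (A : ∀ x, E.Fiber x →ₗ.[ℂ] E.Fiber x)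
    (f : C(X, Realization E.SubspaceCat)) : Prop :=
  ∃ (ι : Type u) (U : ι → Set X) (ε : ι → ℝ) (s : C(X, Realization (CoverCat U)))
    (F : ∀ x, CoverFiber U x ⥤ SubspaceObj (E.Fiber x)),
    (∀ a, IsOpen (U a)) ∧ (⋃ a, U a) = univ ∧ (∀ a, IsAdaptedSA E A (U a) (ε a)) ∧
    IsHomotopySection U s ∧ IsIndexFunctorSA E A U ε F ∧
    ⇑f = Realization.map (sigmaFunctor F) ∘ s

/-- The analytic index of the family `A` is defined and is equal to the homotopy class `c`:
index maps of `A` exist, and all of them belong to `c`. -/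
def HasAnalyticIndex (E : HilbertBundle.{u, v, w} X H) (A : ∀ x, E.Fiber x →ₗ.[ℂ] E.Fiber x)
    (c : Quot (ContinuousMap.Homotopic (X := X) (Y := Realization E.SubspaceCat))) : Prop :=
  (∃ f, IsIndexMapSA E A f) ∧ ∀ f, IsIndexMapSA E A f → Quot.mk _ f = c

/-! ### Families of general Fredholm operators and the classical analytic index -/

/-- The pair `(U, ε)` is adapted to the family `B` of Fredholm operators: for `x ∈ U` the pairs
`(B x, ε)` are enhanced operators, the images `E₁ x` and `E₂ x` of the projections `P_[0, ε](|B x|)`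
and `P_[0, ε](|(B x)*|)` are finite dimensional and depend continuously on `x ∈ U`, and so do the
operators `E₁ x → E₂ x` induced by `B x` (they are represented by the operators
`B x ∘ P_[0, ε](|B x|)`). -/
structure IsAdapted (E : HilbertBundle.{u, v, w} X H) (B : ∀ x, E.Fiber x →ₗ.[ℂ] E.Fiber x)
    (U : Set X) (ε : ℝ) : Prop where
  enhanced : ∀ x ∈ U, IsEnhanced (B x) ε
  finite_snd : ∀ x ∈ U, FiniteDimensional ℂ (specIm (absOp (B x)†) 0 ε)
  continuous_fst : E.ContinuousField U fun x => specProj (absOp (B x)) 0 ε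
  continuous_snd : E.ContinuousField U fun x => specProj (absOp (B x)†) 0 ε
  continuous_induced : ∃ T : ∀ x, E.Fiber x →L[ℂ] E.Fiber x,
    (∀ x ∈ U, ∀ v, (specProj (absOp (B x)) 0 ε v, T x v) ∈ (B x).graph) ∧ E.ContinuousField U T

/-- `F` is the index functor `X_U ⥤ S(E)` of the family `B`, for the covering `U` and the numbers
`ε`.  It takes `(x, τ)` to `(Im P_[0, ε_τ](|B x|), Im P_[0, ε_τ](|(B x)*|))`, and the morphism
`(x, τ) ⟶ (x, σ)` to the morphism given by the isometry
`Im P_[ε_τ, ε_σ](|B x|) → Im P_[ε_τ, ε_σ](|(B x)*|)` induced by the partial isometry from the polar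
decomposition of `B x`. -/
structure IsIndexFunctor (E : HilbertBundle.{u, v, w} X H)
    (B : ∀ x, E.Fiber x →ₗ.[ℂ] E.Fiber x) {ι : Type u} (U : ι → Set X) (ε : ι → ℝ)
    (F : ∀ x, CoverFiber U x ⥤ PairObj (E.Fiber x)) : Prop where
  fst_eq : ∀ x (τ : CoverFiber U x), ((F x).obj τ).fst = specIm (absOp (B x)) 0 (τ.min ε)
  snd_eq : ∀ x (τ : CoverFiber U x), ((F x).obj τ).snd = specIm (absOp (B x)†) 0 (τ.min ε)
  iso_eq : ∀ x (τ σ : CoverFiber U x) (f : τ ⟶ σ),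
    PairHom.iso ((F x).map f) =
      polarPart (B x) ∘L specProj (absOp (B x)) (τ.min ε) (σ.min ε)

/-- `f : X → |S(E)|` is an index map of the family `B` of Fredholm operators. -/
def IsIndexMap (E : HilbertBundle.{u, v, w} X H) (B : ∀ x, E.Fiber x →ₗ.[ℂ] E.Fiber x)
    (f : C(X, Realization E.PairCat)) : Prop :=
  ∃ (ι : Type u) (U : ι → Set X) (ε : ι → ℝ) (s : C(X, Realization (CoverCat U)))
    (F : ∀ x, CoverFiber U x ⥤ PairObj (E.Fiber x)),
    (∀ a, IsOpen (U a)) ∧ (⋃ a, U a) = univ ∧ (∀ a, IsAdapted E B (U a) (ε a)) ∧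
    IsHomotopySection U s ∧ IsIndexFunctor E B U ε F ∧
    ⇑f = Realization.map (sigmaFunctor F) ∘ s

/-- The cylinder `X × [0, π]`. -/
abbrev Cylinder (X : Type u) : Type u := X × Set.Icc (0 : ℝ) Real.pi

/-- The subset `X × {0, π}` of the cylinder. -/
def Cylinder.ends (X : Type u) : Set (Cylinder X) :=
  {p | (p.2 : ℝ) = 0 ∨ (p.2 : ℝ) = Real.pi}

/-- The pull-back of the bundle `E` to `X × [0, π]`. -/
abbrev HilbertBundle.cylinder (E : HilbertBundle.{u, v, w} X H) :
    HilbertBundle.{u, v, w} (Cylinder X) H :=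
  E.pullback (⟨Prod.fst, continuous_fst⟩ : C(Cylinder X, X))

/-- The family `B_{x, t} = cos t + i A_x sin t`, parameterized by `X × [0, π]`. -/
def cylinderFamily (E : HilbertBundle.{u, v, w} X H) (A : ∀ x, E.Fiber x →ₗ.[ℂ] E.Fiber x) :
    ∀ p : Cylinder X, E.cylinder.Fiber p →ₗ.[ℂ] E.cylinder.Fiber p :=
  fun p => rotated (A p.1) (p.2 : ℝ)

/-- The classical analytic index of the family `A` of self-adjoint operators is defined and is equal
to `c`: index maps of the family `B_{x, t}` exist, and all of them belong to the class `c` of maps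
`X × [0, π] → |S(E × [0, π])|` with respect to homotopies fixed on `X × {0, π}`. -/
def HasClassicalIndex (E : HilbertBundle.{u, v, w} X H) (A : ∀ x, E.Fiber x →ₗ.[ℂ] E.Fiber x)
    (c : Quot (fun f g : C(Cylinder X, Realization E.cylinder.PairCat) =>
      f.HomotopicRel g (Cylinder.ends X))) : Prop :=
  (∃ f, IsIndexMap E.cylinder (cylinderFamily E A) f) ∧
    ∀ f, IsIndexMap E.cylinder (cylinderFamily E A) f → Quot.mk _ f = c

/-! ### Finite-polarized replacements -/

/-- The function `r(x) = ∑ r_U(x) ε_U`. -/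
def replacementRadius {ι : Type*} (ρ : PartitionOfUnity ι X) (ε : ι → ℝ) (x : X) : ℝ :=
  ∑ᶠ a, ρ a x * ε a

/-- The finite-polarized replacement `A'_x = χ_{r(x)}(A_x)`. -/
def replacement (E : HilbertBundle.{u, v, w} X H) (A : ∀ x, E.Fiber x →ₗ.[ℂ] E.Fiber x)
    (r : X → ℝ) : ∀ x, E.Fiber x →ₗ.[ℂ] E.Fiber x :=
  fun x => (funCalc (chi (r x)) (A x) : E.Fiber x →ₗ[ℂ] E.Fiber x).toPMap ⊤

end Bundle

end FredholmIndex

end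

/-! An index map depends on the operators only through their parts near zero, and `chi r` is the
identity on [-r/2, r/2] and maps no point from outside this interval into it. So for δ ≤ r(x)/2 the
operators A_x and χ_{r(x)}(A_x) have the same spectral projection on [-δ, δ] and the same
restriction to its image, once ±δ lie off the spectrum.

It remains to find such δ locally. The part of A_x in an adapted interval has finite rank, so some
band δ₁ ≤ |z| ≤ δ₂ with δ₂ as small as desired misses the spectrum at x; by upper semicontinuity of
spectra it misses the spectrum at nearby points too (`exists_isWindow`). Since r is continuous and
positive, these windows can be chosen with δ₂ < r/2. They form an open covering adapted to both
families, with one and the same index functor (`replacement_isWindow`, `IsIndexFunctorSA.congr`); a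
section of |X_U| → X then gives one map that is an index map of both families.

The indices are well defined for the following reason. Two choices of covering and numbers are
merged over the disjoint union of their index sets, and both index functors are restrictions of the
functor of the union. That functor is continuous, and any two sections of |X_W| → X are fiberwise
homotopic: if s₀ is a section with s₀ ∘ pr homotopic to the identity over X, then s₀ = s₀ ∘ pr ∘ s
is homotopic to s for every section s (`homotopicRel_of_sections`). Such s₀ exists by
`exists_isHomotopySection`: points of |X_U| are encoded by finitely supported weights with maximum
1, so a bump covering is a section and an interpolation of weights is the homotopy.

For the classical index, B_{x,t} = cos t + i A_x sin t is normal and |B_{x,t}|² = cos² t + A_x² sin²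
t. Where cos t ≠ 0 the operator is bounded below by |cos t|, and small numbers give zero subspaces.
Where cos t is small, a window of A gives P_[0,δ₂](|B|) = P_[-δ₂,δ₂](A), and B acts on the image as
cos t + i sin t A. Hence A and its replacement again share adapted pairs and index functors
(`rotated_specProj_eq`, `IsIndexFunctor.congr`). At t = 0, π the operator is ±1; as H is infinite
dimensional, every enhanced ε is below 1 there, all objects over the ends are zero, the induced map
collapses the fibers, and the homotopies are stationary (`specIm_rotated_eq_bot`,
`realization_map_eq_of_bot`).

The analysis is done with bounded transforms, which turn unbounded functional calculus into `cfc` of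
a contraction. Continuity of the index functors rests on writing every spectral projection or polar
isometry inside a window as a function of the bounded operator A P_[-ε,ε](A), or B P_[0,ε](|B|),
that is continuous by adaptedness. -/

noncomputable section

namespace FredholmIndex

/-! ### Compactly generated spaces -/

/-- Open subspaces of a regular compactly coherent space are compactly coherent. -/
theorem compactlyCoherentSpace_of_isOpen {X : Type*} [TopologicalSpace X] [RegularSpace X]
    [CompactlyCoherentSpace X] {V : Set X} (hV : IsOpen V) : CompactlyCoherentSpace V := by
  refine .of_isOpen_forall_compactSpace fun A hA => ?_
  rw [isOpen_iff_mem_nhds]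
  intro a ha
  -- Compact sets of X may leave V. Cutting with a closed neighborhood C ⊆ V keeps K ∩ C compact and
  -- inside V, so interior C ∩ A can be tested in X.
  obtain ⟨C, hC, hCc, hCV⟩ := exists_mem_nhds_isClosed_subset (hV.mem_nhds a.2)
  have hO : IsOpen (interior C ∩ Subtype.val '' A) := by
    rw [CompactlyCoherentSpace.isOpen_iff]
    intro K hK
    have hKC : IsCompact (K ∩ C) := hK.inter_right hCc
    have : CompactSpace (K ∩ C : Set X) := isCompact_iff_compactSpace.1 hKC
    have h1 := hA (K ∩ C : Set X) (fun z => ⟨z.1, hCV z.2.2⟩)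
      (continuous_subtype_val.subtype_mk _)
    obtain ⟨O, hO, hOeq⟩ := isOpen_induced_iff.1 h1
    have : (Subtype.val ⁻¹' (interior C ∩ Subtype.val '' A) : Set K) =
        Subtype.val ⁻¹' (interior C ∩ O) := by
      ext z
      simp only [mem_preimage, mem_inter_iff, mem_image, Subtype.exists, exists_and_right,
        exists_eq_right]
      refine and_congr_right fun hz => ?_
      have h2 := Set.ext_iff.1 hOeq ⟨z.1, z.2, interior_subset hz⟩
      simp only [mem_preimage] at h2
      exact ⟨fun ⟨h, h'⟩ => h2.2 h', fun h => ⟨hCV (interior_subset hz), h2.1 h⟩⟩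
    rw [this]
    exact (isOpen_interior.inter hO).preimage continuous_subtype_val
  have h2 := (hO.preimage (continuous_subtype_val (p := (· ∈ V)))).mem_nhds
    (x := a) ⟨mem_interior_iff_mem_nhds.2 hC, a, ha, rfl⟩
  filter_upwards [h2] with z hz
  obtain ⟨w, hw, hwz⟩ := hz.2
  rwa [← Subtype.ext hwz]

/-- The product of a compactly coherent space and a locally compact space. -/
theorem compactlyCoherentSpace_prod {X Y : Type*} [TopologicalSpace X] [TopologicalSpace Y]
    [CompactlyCoherentSpace X] [LocallyCompactSpace Y] : CompactlyCoherentSpace (X × Y) := by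
  refine .of_isOpen fun A hA => ?_
  have hcont : ∀ (K : Set X), IsCompact K → IsOpen {p : K × Y | ((p.1 : X), p.2) ∈ A} := by
    intro K hK
    rw [isOpen_iff_mem_nhds]
    rintro ⟨k, y⟩ hky
    obtain ⟨L, hL, hyL⟩ := exists_compact_mem_nhds y
    have h1 := hA (K ×ˢ L) (hK.prod hL)
    obtain ⟨O, hO, hOeq⟩ := isOpen_induced_iff.1 h1
    have hOk : (((k : X), y) : X × Y) ∈ O :=
      (Set.ext_iff.1 hOeq ⟨((k : X), y), k.2, mem_of_mem_nhds hyL⟩).2 hky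
    have h3 : (univ ×ˢ L : Set (K × Y)) ∈ 𝓝 (k, y) :=
      prod_mem_nhds univ_mem hyL
    have h4 : {p : K × Y | ((p.1 : X), p.2) ∈ O} ∈ 𝓝 (k, y) :=
      (hO.preimage (f := fun p : K × Y => ((p.1 : X), p.2)) (by fun_prop)).mem_nhds hOk
    filter_upwards [h3, h4] with p hp hp'
    exact (Set.ext_iff.1 hOeq ⟨((p.1 : X), p.2), p.1.2, hp.2⟩).1 hp'
  -- An open set is a continuous map to the Sierpiński space `Prop`. Its curried form X → C(Y, Prop)
  -- can be tested on compact sets of X, and local compactness of Y allows uncurrying.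
  rw [isOpen_iff_continuous_mem]
  have hslice : ∀ x : X, Continuous fun y : Y => (x, y) ∈ A := by
    intro x
    have h := hcont {x} isCompact_singleton
    rw [isOpen_iff_continuous_mem] at h
    exact h.comp (f := fun y : Y => ((⟨x, rfl⟩ : ({x} : Set X)), y)) (by fun_prop)
  let g : X → C(Y, Prop) := fun x => ⟨fun y => (x, y) ∈ A, hslice x⟩
  have hg : Continuous g := by
    rw [CompactlyCoherentSpace.isCoherentWith.continuous_iff]
    intro K hK
    rw [continuousOn_iff_continuous_domRestrict]
    have h := hcont K hK
    rw [isOpen_iff_continuous_mem] at h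
    exact (ContinuousMap.curry ⟨_, h⟩).continuous
  exact ContinuousMap.continuous_uncurry_of_continuous ⟨g, hg⟩

/-! ### Continuous maps of classifying spaces -/

section Realization

universe v₁ u₁ v₂ u₂

variable {C : Type u₁} [Category.{v₁} C]

/-- The point of `|C|` defined by a simplex of the nerve and a point of the standard simplex. -/
def Realization.mk {n : ℕ} (F : ComposableArrows C n) (p : stdSimplex ℝ (Fin (n + 1))) :
    Realization C :=
  Quot.mk _ ⟨n, F, p⟩

theorem Realization.mk_comp {m n : ℕ} (θ : Fin (m + 1) →o Fin (n + 1)) (F : ComposableArrows C n)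
    (p : stdSimplex ℝ (Fin (m + 1))) :
    Realization.mk (θ.monotone.functor ⋙ F : ComposableArrows C m) p =
      Realization.mk F (stdSimplex.map θ p) :=
  Quot.sound (Glue.mk θ F p)

theorem Realization.exists_mk (q : Realization C) :
    ∃ (n : ℕ) (F : ComposableArrows C n) (p : stdSimplex ℝ (Fin (n + 1))),
      q = Realization.mk F p := by
  obtain ⟨⟨n, F, p⟩, rfl⟩ := Quot.exists_rep q
  exact ⟨n, F, p, rfl⟩

variable [TopologicalSpace (Arrow C)]

theorem continuous_nerveSimplex_arrow {n : ℕ} {i j : Fin (n + 1)} (h : i ≤ j) :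
    Continuous fun F : NerveSimplex C n =>
      Arrow.mk ((show ComposableArrows C n from F).map (homOfLE h)) := by
  let t : TopologicalSpace (ComposableArrows C n) := TopologicalSpace.induced
      (fun (F : ComposableArrows C n) (ij : {ij : Fin (n + 1) × Fin (n + 1) // ij.1 ≤ ij.2}) =>
        Arrow.mk (F.map (homOfLE ij.2))) inferInstance
  have h0 : Continuous (fun (F : ComposableArrows C n)
      (ij : {ij : Fin (n + 1) × Fin (n + 1) // ij.1 ≤ ij.2}) => Arrow.mk (F.map (homOfLE ij.2))) :=
    continuous_induced_dom
  have h1 : Continuous fun F : ComposableArrows C n => Arrow.mk (F.map (homOfLE h)) :=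
    continuous_pi_iff.1 h0 ⟨(i, j), h⟩
  exact h1.comp (CompactCoherentification.continuous_mk_symm (X := ComposableArrows C n))

/-- Making a topology compactly generated does not change continuity of maps from a compactly
coherent space, since such continuity is tested on compact subsets. This is where compact generation
of the parameter space enters. -/
theorem continuous_nerveSimplex_iff {Y : Type*} [TopologicalSpace Y] [CompactlyCoherentSpace Y]
    {n : ℕ} {f : Y → NerveSimplex C n} :
    Continuous f ↔ ∀ (i j : Fin (n + 1)) (h : i ≤ j), Continuous fun y =>
      Arrow.mk ((show ComposableArrows C n from f y).map (homOfLE h)) := by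
  refine ⟨fun hf i j h => (continuous_nerveSimplex_arrow h).comp hf, fun hf => ?_⟩
  let t : TopologicalSpace (ComposableArrows C n) := TopologicalSpace.induced
      (fun (F : ComposableArrows C n) (ij : {ij : Fin (n + 1) × Fin (n + 1) // ij.1 ≤ ij.2}) =>
        Arrow.mk (F.map (homOfLE ij.2))) inferInstance
  have h1 : Continuous (X := Y) (Y := ComposableArrows C n) f :=
    continuous_induced_rng.2 (continuous_pi fun ij => hf _ _ ij.2)
  rw [CompactlyCoherentSpace.isCoherentWith.continuous_iff]
  intro K hK
  exact (CompactCoherentification.continuousOn_rng_of_isCompact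
    (Y := ComposableArrows C n) hK).2 h1.continuousOn

instance (n : ℕ) : CompactlyCoherentSpace (NerveSimplex C n) := by
  let t : TopologicalSpace (ComposableArrows C n) := TopologicalSpace.induced
      (fun (F : ComposableArrows C n) (ij : {ij : Fin (n + 1) × Fin (n + 1) // ij.1 ≤ ij.2}) =>
        Arrow.mk (F.map (homOfLE ij.2))) inferInstance
  exact CompactCoherentification.instCompactlyCoherentSpace (X := ComposableArrows C n)

theorem Realization.continuous_mk (n : ℕ) :
    Continuous fun q : NerveSimplex C n × stdSimplex ℝ (Fin (n + 1)) =>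
      Realization.mk (C := C) q.1 q.2 :=
  continuous_quot_mk.comp (continuous_sigmaMk
    (σ := fun n : ℕ => NerveSimplex C n × stdSimplex ℝ (Fin (n + 1))) (i := n))

/-- The spaces of simplices are themselves compactly coherent, so the map on simplices can be
checked one arrow at a time. -/
theorem Realization.continuous_map {D : Type u₂} [Category.{v₂} D] [TopologicalSpace (Arrow D)]
    (G : C ⥤ D) (hG : Continuous G.mapArrow.obj) : Continuous (Realization.map G) := by
  refine continuous_quot_lift _ (continuous_quot_mk.comp (continuous_sigma fun n => ?_))
  refine (continuous_sigmaMk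
    (σ := fun n : ℕ => NerveSimplex D n × stdSimplex ℝ (Fin (n + 1))) (i := n)).comp
      (Continuous.prodMk (f := fun q : NerveSimplex C n × stdSimplex ℝ (Fin (n + 1)) =>
        (show NerveSimplex D n from
          Functor.comp (show ComposableArrows C n from q.1) G)) (g := Prod.snd) ?_ continuous_snd)
  refine Continuous.comp (g := fun F : NerveSimplex C n => (show NerveSimplex D n from
          Functor.comp (show ComposableArrows C n from F) G)) ?_ continuous_fst
  rw [continuous_nerveSimplex_iff]
  intro i j h
  exact hG.comp (continuous_nerveSimplex_arrow h)

/-- A homotopy of maps from `|C|` is continuous if it is continuous on simplices. -/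
theorem Realization.continuous_homotopy {Y : Type*} [TopologicalSpace Y]
    (h : unitInterval × Realization C → Y)
    (hh : ∀ n, Continuous fun z : (NerveSimplex C n × stdSimplex ℝ (Fin (n + 1))) × unitInterval =>
      h (z.2, Realization.mk (C := C) z.1.1 z.1.2)) : Continuous h := by
  have hc : ∀ q, Continuous fun t => h (t, q) := by
    intro q
    obtain ⟨n, F, p, rfl⟩ := q.exists_mk
    let z : NerveSimplex C n × stdSimplex ℝ (Fin (n + 1)) := (F, p)
    exact (hh n).comp (f := fun t : unitInterval => (z, t)) (by fun_prop)
  -- A product with a quotient need not be a quotient. Currying moves the interval, which is locally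
  -- compact, into the target, where the quotient property of |C| applies.
  let g : Realization C → C(unitInterval, Y) := fun q => ⟨fun t => h (t, q), hc q⟩
  have hg : Continuous g := by
    refine continuous_coinduced_dom.2 (continuous_sigma fun n => ?_)
    exact (ContinuousMap.curry ⟨_, hh n⟩).continuous
  exact (ContinuousMap.continuous_uncurry_of_continuous ⟨g, hg⟩).comp continuous_swap

end Realization

/-! ### Points of the classifying space of a covering -/

section Covering

set_option linter.unusedSectionVars false

variable {X : Type u} {ι : Type w} {U : ι → Set X}

theorem CoverFiber.ext' {x : X} {σ τ : CoverFiber U x} (h : σ.carrier = τ.carrier) : σ = τ := by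
  cases σ; cases τ; cases h; rfl

theorem CoverCat.ext' {a b : CoverCat U} (h : a.1 = b.1) (h' : a.2.carrier = b.2.carrier) :
    a = b := by
  obtain ⟨x, σ⟩ := a
  obtain ⟨y, τ⟩ := b
  obtain rfl : x = y := h
  exact congrArg _ (CoverFiber.ext' h')

theorem CoverCat.carrier_subset {a b : CoverCat U} (f : a ⟶ b) :
    b.2.carrier ⊆ a.2.carrier := by
  obtain ⟨g⟩ := (f : Sigma.SigmaHom a b)
  exact leOfHom g

instance (a b : CoverCat U) : Subsingleton (a ⟶ b) where
  allEq f g := by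
    obtain ⟨f⟩ := (f : Sigma.SigmaHom a b)
    obtain ⟨g⟩ := (g : Sigma.SigmaHom _ _)
    exact congrArg _ (Subsingleton.elim f g)

theorem CoverCat.functor_ext {n : ℕ} {F G : ComposableArrows (CoverCat U) n}
    (h : ∀ i, (F.obj i).1 = (G.obj i).1) (h' : ∀ i, (F.obj i).2.carrier = (G.obj i).2.carrier) :
    F = G :=
  CategoryTheory.Functor.ext (fun i => CoverCat.ext' (h i) (h' i))
    (fun _ _ _ => Subsingleton.elim _ _)

theorem CoverCat.fst_obj {n : ℕ} (F : ComposableArrows (CoverCat U) n) (i : Fin (n + 1)) :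
    (F.obj i).1 = (F.obj 0).1 :=
  (fst_eq_of_hom (F.map (homOfLE (Fin.zero_le i)))).symm

open Classical in
/-- The weights of the indices of the covering at a point of `|X_U|`: the weight of `a` is the sum of
the barycentric coordinates corresponding to the sets containing `a`. -/
def coverWeight : Realization (CoverCat U) → ι → ℝ :=
  Quot.lift (fun q a => ∑ i,
    if a ∈ ((show ComposableArrows (CoverCat U) q.1 from q.2.1).obj i).2.carrier
      then q.2.2 i else 0) (by
    rintro _ _ ⟨θ, F, p⟩
    funext a
    simp only [stdSimplex.map_coe, FunOnFinite.linearMap_apply_apply]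
    -- All vertices in one fiber of θ carry the same finite set in θ^* F, so membership of a is
    -- constant on the fiber and the weight is unchanged by gluing.
    rw [← Finset.sum_fiberwise Finset.univ θ]
    refine Finset.sum_congr rfl fun j _ => ?_
    split_ifs with h
    · refine Finset.sum_congr rfl fun i hi => ?_
      rw [if_pos]
      rw [Finset.mem_filter] at hi
      rw [← hi.2] at h
      exact h
    · refine Finset.sum_eq_zero fun i hi => ?_
      rw [if_neg]
      rw [Finset.mem_filter] at hi
      rw [← hi.2] at h
      exact h)

open Classical in
theorem coverWeight_mk {n : ℕ} (F : ComposableArrows (CoverCat U) n)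
    (p : stdSimplex ℝ (Fin (n + 1))) (a : ι) :
    coverWeight (Realization.mk F p) a = ∑ i, if a ∈ (F.obj i).2.carrier then p i else 0 :=
  rfl

variable [TopologicalSpace X]

/-- Every point of `|X_U|` can be represented with positive barycentric coordinates. -/
theorem Realization.exists_pos {C : Type*} [Category* C] (q : Realization C) :
    ∃ (n : ℕ) (F : ComposableArrows C n) (p : stdSimplex ℝ (Fin (n + 1))),
      q = Realization.mk F p ∧ ∀ i, 0 < p i := by
  obtain ⟨n, F, p, rfl⟩ := q.exists_mk
  set I : Finset (Fin (n + 1)) := Finset.univ.filter fun i => p i ≠ 0 with hI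
  have hne : I.Nonempty := by
    by_contra h
    rw [Finset.not_nonempty_iff_eq_empty, Finset.filter_eq_empty_iff] at h
    have := stdSimplex.sum_eq_one p
    rw [Finset.sum_eq_zero fun i _ => not_not.1 (h (Finset.mem_univ i))] at this
    exact zero_ne_one this
  obtain ⟨m, hm⟩ : ∃ m, I.card = m + 1 := Nat.exists_eq_succ_of_ne_zero hne.card_ne_zero
  -- The increasing enumeration of the support of p: the point lies on the corresponding face, where
  -- all coordinates are positive.
  let e := I.orderEmbOfFin hm
  have he : ∀ i, e i ∈ I := fun i => Finset.orderEmbOfFin_mem I hm i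
  have hsum : ∀ f : Fin (n + 1) → ℝ, (∀ i ∉ I, f i = 0) → ∑ i, f (e i) = ∑ i, f i := by
    intro f hf
    rw [← Finset.sum_subset (Finset.subset_univ I) fun i _ hi => hf i hi,
      ← Finset.map_orderEmbOfFin_univ I hm, Finset.sum_map]
    rfl
  have hp0 : ∀ i ∉ I, p i = 0 := fun i hi => by simpa [hI] using hi
  let p' : stdSimplex ℝ (Fin (m + 1)) := ⟨fun i => p (e i), fun i => p.2.1 _,
    (hsum (fun i => p i) hp0).trans (stdSimplex.sum_eq_one p)⟩
  refine ⟨m, e.toOrderHom.monotone.functor ⋙ F, p', ?_, fun i => ?_⟩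
  · rw [Realization.mk_comp e.toOrderHom F p']
    congr 1
    ext j
    rw [stdSimplex.map_coe, FunOnFinite.linearMap_apply_apply, Finset.sum_filter]
    refine ((hsum (fun i => if i = j then p i else 0) fun i hi => ?_).trans ?_).symm
    · split_ifs
      · exact hp0 i hi
      · rfl
    · simp
  · exact lt_of_le_of_ne (p.2.1 _) (Ne.symm (Finset.mem_filter.1 (he i)).2)

/-- The chain of sets `{e i, …, e k}`, `i = 0, …, k`, of indices of sets containing `x`. -/
def flag {k : ℕ} (e : Fin (k + 1) ↪ ι) (x : X) (hx : ∀ j, x ∈ U (e j)) :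
    ComposableArrows (CoverCat U) k :=
  Monotone.functor (f := fun i : Fin (k + 1) => (⟨(Finset.Ici i).map e,
    ⟨e i, Finset.mem_map_of_mem e (Finset.mem_Ici.2 le_rfl)⟩, fun a ha => by
      obtain ⟨j, _, rfl⟩ := Finset.mem_map.1 ha
      exact hx j⟩ : CoverFiber U x))
    (fun _ _ h => Finset.map_subset_map.2 (Finset.Ici_subset_Ici.2 h)) ⋙ Sigma.incl x

theorem flag_carrier {k : ℕ} (e : Fin (k + 1) ↪ ι) (x : X) (hx : ∀ j, x ∈ U (e j))
    (i : Fin (k + 1)) : ((flag e x hx).obj i).2.carrier = (Finset.Ici i).map e :=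
  rfl

/-- The element e j belongs to the i-th set exactly when i ≤ j, so weights along the enumeration are
the partial sums of the barycentric coordinates. -/
theorem coverWeight_flag {k : ℕ} (e : Fin (k + 1) ↪ ι) (x : X) (hx : ∀ j, x ∈ U (e j))
    (p : stdSimplex ℝ (Fin (k + 1))) (j : Fin (k + 1)) :
    coverWeight (Realization.mk (flag e x hx) p) (e j) = ∑ i ∈ Finset.Iic j, p i := by
  classical
  rw [coverWeight_mk, ← Finset.sum_filter]
  refine Finset.sum_congr ?_ fun _ _ => rfl
  ext i
  simp [flag_carrier]

theorem coverWeight_flag_of_notMem {k : ℕ} (e : Fin (k + 1) ↪ ι) (x : X) (hx : ∀ j, x ∈ U (e j))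
    (p : stdSimplex ℝ (Fin (k + 1))) {a : ι} (ha : a ∉ Set.range e) :
    coverWeight (Realization.mk (flag e x hx) p) a = 0 := by
  classical
  rw [coverWeight_mk]
  refine Finset.sum_eq_zero fun i _ => if_neg fun h => ha ?_
  rw [flag_carrier, Finset.mem_map] at h
  exact ⟨h.choose, h.choose_spec.2⟩

/-- A vector is determined by its partial sums. -/
theorem eq_of_sum_Iic_eq {k : ℕ} {p q : Fin (k + 1) → ℝ}
    (h : ∀ j, ∑ i ∈ Finset.Iic j, p i = ∑ i ∈ Finset.Iic j, q i) : p = q := by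
  funext j
  induction j using Fin.inductionOn with
  | zero =>
    have h0 : Finset.Iic (0 : Fin (k + 1)) = {0} := by
      ext i
      simp
    simpa [h0] using h 0
  | succ j _ =>
    have h1 : Finset.Iic j.succ = insert j.succ (Finset.Iic j.castSucc) := by
      ext i
      simp only [Finset.mem_Iic, Finset.mem_insert, Fin.le_def, Fin.ext_iff, Fin.val_succ,
        Fin.val_castSucc]
      omega
    have h2 : j.succ ∉ Finset.Iic j.castSucc := by
      simp [Fin.le_def]
    have := h j.succ
    rw [h1, Finset.sum_insert h2, Finset.sum_insert h2, h j.castSucc] at this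
    linarith

/-- A point of `|X_U|` can be represented by a flag of any finite set containing the indices of
positive weight, ordered by their weights. -/
theorem exists_eq_mk_flag {k : ℕ} (e : Fin (k + 1) ↪ ι) (q : Realization (CoverCat U))
    (hx : ∀ j, Realization.proj q ∈ U (e j)) (hmono : Monotone fun j => coverWeight q (e j))
    (hsupp : ∀ a, coverWeight q a ≠ 0 → a ∈ Set.range e) :
    ∃ p, q = Realization.mk (flag e (Realization.proj q) hx) p := by
  classical
  obtain ⟨n, F, p, rfl, hp⟩ := q.exists_pos
  have hanti : ∀ {i j : Fin (n + 1)}, i ≤ j → (F.obj j).2.carrier ⊆ (F.obj i).2.carrier :=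
    fun h => CoverCat.carrier_subset (F.map (homOfLE h))
  -- Each set of the chain is closed upwards for the weight. If a is in the i-th set and b is not,
  -- every set containing b comes earlier and so contains a, while the i-th coordinate is positive
  -- and counts only for a; thus a has strictly larger weight.
  have hup : ∀ {i : Fin (n + 1)} {a b : ι}, a ∈ (F.obj i).2.carrier →
      coverWeight (Realization.mk F p) a ≤ coverWeight (Realization.mk F p) b →
      b ∈ (F.obj i).2.carrier := by
    intro i a b ha hab
    by_contra hb
    refine absurd hab (not_le.2 ?_)
    rw [coverWeight_mk, coverWeight_mk]
    refine Finset.sum_lt_sum (fun j _ => ?_) ⟨i, Finset.mem_univ i, ?_⟩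
    · rcases le_total j i with h | h
      · rw [if_pos (hanti h ha)]
        split_ifs
        exacts [le_rfl, (hp j).le]
      · rw [if_neg fun h' => hb (hanti h h')]
        split_ifs
        exacts [(hp j).le, le_rfl]
    · rw [if_pos ha, if_neg hb]
      exact hp i
  have hrange : ∀ {i a}, a ∈ (F.obj i).2.carrier → a ∈ Set.range e := by
    intro i a ha
    refine hsupp a (ne_of_gt ?_)
    rw [coverWeight_mk]
    refine Finset.sum_pos' (fun j _ => ?_) ⟨i, Finset.mem_univ i, ?_⟩
    · split_ifs
      exacts [(hp j).le, le_rfl]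
    · rw [if_pos ha]; exact hp i
  have hne : ∀ i, (Finset.univ.filter fun j => e j ∈ (F.obj i).2.carrier).Nonempty := by
    intro i
    obtain ⟨a, ha⟩ := (F.obj i).2.nonempty
    obtain ⟨j, rfl⟩ := hrange ha
    exact ⟨j, by simpa using ha⟩
  -- In an enumeration with increasing weights a set closed upwards is a tail, so it is determined
  -- by its least index; the chain is then the pull-back of the flag by θ.
  let θ : Fin (n + 1) →o Fin (k + 1) := ⟨fun i => Finset.min' _ (hne i), fun i i' h =>
    Finset.min'_subset _ fun j hj => by
      rw [Finset.mem_filter] at hj ⊢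
      exact ⟨hj.1, hanti h hj.2⟩⟩
  have hθ : ∀ i, e (θ i) ∈ (F.obj i).2.carrier := fun i =>
    (Finset.mem_filter.1 (Finset.min'_mem _ (hne i))).2
  refine ⟨stdSimplex.map θ p, ?_⟩
  rw [← Realization.mk_comp]
  congr 1
  refine CoverCat.functor_ext (fun i => CoverCat.fst_obj F i) fun i => ?_
  change _ = (Finset.Ici (θ i)).map e
  ext a
  rw [Finset.mem_map]
  constructor
  · intro ha
    obtain ⟨j, rfl⟩ := hrange ha
    exact ⟨j, Finset.mem_Ici.2 (Finset.min'_le _ _ (by simpa using ha)), rfl⟩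
  · rintro ⟨j, hj, rfl⟩
    exact hup (hθ i) (hmono (Finset.mem_Ici.1 hj))

/-- Any finite non-empty set can be enumerated so that a given function increases. -/
theorem exists_embedding_monotone (S : Finset ι) (hS : S.Nonempty) (f : ι → ℝ) :
    ∃ (k : ℕ) (e : Fin (k + 1) ↪ ι), Set.range e = S ∧ Monotone fun j => f (e j) := by
  obtain ⟨k, hk⟩ : ∃ k, S.card = k + 1 := Nat.exists_eq_succ_of_ne_zero hS.card_ne_zero
  let e₀ : Fin (k + 1) ≃ S := (S.equivFinOfCardEq hk).symm
  refine ⟨k, ((Tuple.sort fun j => f (e₀ j)).trans e₀).toEmbedding.trans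
    (Function.Embedding.subtype _), ?_, Tuple.monotone_sort fun j => f (e₀ j)⟩
  ext a
  simp only [Function.Embedding.trans_apply, Equiv.coe_toEmbedding, Equiv.trans_apply,
    Function.Embedding.subtype_apply, Set.mem_range, Finset.mem_coe]
  exact ⟨fun ⟨j, hj⟩ => hj ▸ Subtype.prop _, fun ha =>
    ⟨(Tuple.sort fun j => f (e₀ j)).symm (e₀.symm ⟨a, ha⟩), by simp⟩⟩

theorem support_coverWeight (q : Realization (CoverCat U)) :
    ∃ S : Finset ι, S.Nonempty ∧ (∀ a ∈ S, Realization.proj q ∈ U a) ∧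
      ∀ a ∉ S, coverWeight q a = 0 := by
  classical
  obtain ⟨n, F, p, rfl⟩ := q.exists_mk
  have hsub : ∀ i, (F.obj i).2.carrier ⊆ (F.obj 0).2.carrier := fun i =>
    CoverCat.carrier_subset (F.map (homOfLE (Fin.zero_le i)))
  refine ⟨(F.obj 0).2.carrier, (F.obj 0).2.nonempty, (F.obj 0).2.mem, fun a ha => ?_⟩
  rw [coverWeight_mk]
  exact Finset.sum_eq_zero fun i _ => if_neg fun h => ha (hsub i h)

/-- A point of `|X_U|` is determined by its projection and its weights. -/
theorem eq_of_coverWeight_eq {q q' : Realization (CoverCat U)}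
    (h : Realization.proj q = Realization.proj q') (h' : coverWeight q = coverWeight q') :
    q = q' := by
  obtain ⟨S, hS, hSU, hS0⟩ := support_coverWeight q
  obtain ⟨k, e, he, hmono⟩ := exists_embedding_monotone S hS (coverWeight q)
  have heS : ∀ j, e j ∈ S := fun j => by
    have : e j ∈ Set.range e := ⟨j, rfl⟩
    rwa [he] at this
  have hsupp : ∀ a, coverWeight q a ≠ 0 → a ∈ Set.range e := fun a ha => by
    rw [he]
    by_contra hn
    exact ha (hS0 a hn)
  obtain ⟨p, hp⟩ := exists_eq_mk_flag e q (fun j => hSU _ (heS j)) hmono hsupp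
  obtain ⟨p', hp'⟩ := exists_eq_mk_flag e q' (fun j => h ▸ hSU _ (heS j)) (by rwa [← h'])
    (by rwa [← h'])
  have hpp : p = p' := by
    refine stdSimplex.ext (eq_of_sum_Iic_eq fun j => ?_)
    have h1 := coverWeight_flag e _ (fun j => hSU _ (heS j)) p j
    have h2 := coverWeight_flag e _ (fun j => h ▸ hSU _ (heS j)) p' j
    rw [← hp] at h1
    rw [← hp', ← h'] at h2
    exact h1.symm.trans h2
  rw [hp, hp', hpp]
  exact congrArg (Realization.mk · p') (CoverCat.functor_ext (fun i => h) fun i => rfl)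

end Covering

/-! ### Sections of the classifying space of a covering -/

section Covering

set_option linter.unusedSectionVars false

variable {X : Type u} {ι : Type w} {U : ι → Set X} [TopologicalSpace X]

/-- The successive differences of a vector. -/
def differences {k : ℕ} (v : Fin (k + 1) → ℝ) (i : Fin (k + 1)) : ℝ :=
  v i - Fin.cases (motive := fun _ => ℝ) 0 (fun j : Fin k => v j.castSucc) i

theorem sum_differences {k : ℕ} (v : Fin (k + 1) → ℝ) (j : Fin (k + 1)) :
    ∑ i ∈ Finset.Iic j, differences v i = v j := by
  induction j using Fin.inductionOn with
  | zero =>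
    have h0 : Finset.Iic (0 : Fin (k + 1)) = {0} := by
      ext i
      simp
    simp [h0, differences]
  | succ j ih =>
    have h1 : Finset.Iic j.succ = insert j.succ (Finset.Iic j.castSucc) := by
      ext i
      simp only [Finset.mem_Iic, Finset.mem_insert, Fin.le_def, Fin.ext_iff, Fin.val_succ,
        Fin.val_castSucc]
      omega
    have h2 : j.succ ∉ Finset.Iic j.castSucc := by
      simp [Fin.le_def]
    rw [h1, Finset.sum_insert h2, ih]
    simp [differences]

/-- The point of the standard simplex with increasing partial sums `v`. -/
def differencePoint {k : ℕ} (v : Fin (k + 1) → ℝ) (hv : Monotone v) (h0 : 0 ≤ v 0)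
    (h1 : v (Fin.last k) = 1) : stdSimplex ℝ (Fin (k + 1)) :=
  ⟨differences v, fun i => by
    induction i using Fin.cases with
    | zero => simpa [differences] using h0
    | succ j => simpa [differences] using hv (Fin.castSucc_le_succ j), by
    have h2 : (Finset.univ : Finset (Fin (k + 1))) = Finset.Iic (Fin.last k) := by
      ext i
      simp [Fin.le_last]
    rw [h2, sum_differences, h1]⟩

theorem continuous_differences {k : ℕ} :
    Continuous (differences : (Fin (k + 1) → ℝ) → Fin (k + 1) → ℝ) := by
  refine continuous_pi fun i => ?_
  induction i using Fin.cases with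
  | zero => simpa [differences] using continuous_apply 0
  | succ j =>
    have : Continuous fun v : Fin (k + 1) → ℝ => v j.succ - v j.castSucc := by fun_prop
    simpa [differences] using this

theorem continuous_flag [RegularSpace X] [CompactlyCoherentSpace X] (hU : ∀ a, IsOpen (U a))
    {k : ℕ} (e : Fin (k + 1) ↪ ι) :
    Continuous fun x : {x // ∀ j, x ∈ U (e j)} =>
      (show NerveSimplex (CoverCat U) k from flag e x.1 x.2) := by
  have hV : IsOpen {x | ∀ j, x ∈ U (e j)} := by
    rw [Set.ofPred_forall]
    exact isOpen_iInter_of_finite fun j => hU _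
  have : CompactlyCoherentSpace {x // ∀ j, x ∈ U (e j)} := compactlyCoherentSpace_of_isOpen hV
  rw [continuous_nerveSimplex_iff]
  intro i j h
  let _ : TopologicalSpace (Finset ι) := ⊥
  have hc : Continuous fun x : {x // ∀ j, x ∈ U (e j)} =>
      (x.1, (Finset.Ici i).map e, (Finset.Ici j).map e) :=
    continuous_subtype_val.prodMk continuous_const
  exact continuous_induced_rng.2 hc

/-- Functions `u a`, forming locally a finite family, with values in `[0, 1]` and with maximum `1`
define a map to `|X_U|`. -/
theorem exists_continuous_coverWeight [RegularSpace X] [CompactlyCoherentSpace X]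
    (hU : ∀ a, IsOpen (U a)) {Y : Type*} [TopologicalSpace Y] {f : Y → X} (hf : Continuous f)
    {c : ι → Y → ℝ} (h0 : ∀ a y, 0 ≤ c a y) (h1 : ∀ a y, c a y ≤ 1) (hmax : ∀ y, ∃ a, c a y = 1)
    (hloc : ∀ y₀, ∃ N ∈ 𝓝 y₀, ∃ S : Finset ι, (∀ y ∈ N, ∀ a ∈ S, f y ∈ U a) ∧
      (∀ y ∈ N, ∀ a ∉ S, c a y = 0) ∧ ∀ a ∈ S, ContinuousOn (c a) N) :
    ∃ g : C(Y, Realization (CoverCat U)), ∀ y, Realization.proj (g y) = f y ∧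
      ∀ a, coverWeight (g y) a = c a y := by
  -- the point corresponding to an enumeration of a finite set of indices
  have key : ∀ (y : Y) (S : Finset ι) (k : ℕ) (e : Fin (k + 1) ↪ ι) (he : Set.range e = S)
      (hS : ∀ a ∈ S, f y ∈ U a) (_ : ∀ a ∉ S, c a y = 0) (_ : Monotone fun j => c (e j) y),
      ∃ (hx : ∀ j, f y ∈ U (e j)) (p : stdSimplex ℝ (Fin (k + 1))),
        p.1 = differences (fun j => c (e j) y) ∧
        ∀ a, coverWeight (Realization.mk (flag e (f y) hx) p) a = c a y := by
    intro y S k e he hS hS0 hmono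
    have heS : ∀ a, a ∈ Set.range e ↔ a ∈ S := fun a => by rw [he]; rfl
    have hlast : c (e (Fin.last k)) y = 1 := by
      obtain ⟨a, ha⟩ := hmax y
      have haS : a ∈ S := by
        by_contra h
        rw [hS0 a h] at ha
        exact zero_ne_one ha
      obtain ⟨j, rfl⟩ := (heS a).2 haS
      exact le_antisymm (h1 _ _) (ha ▸ hmono (Fin.le_last j))
    refine ⟨fun j => hS _ ((heS _).1 ⟨j, rfl⟩), differencePoint (fun j => c (e j) y) hmono
      (h0 _ _) hlast, rfl, fun a => ?_⟩
    by_cases ha : a ∈ Set.range e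
    · obtain ⟨j, rfl⟩ := ha
      rw [coverWeight_flag]
      exact sum_differences _ j
    · rw [coverWeight_flag_of_notMem _ _ _ _ ha, hS0 a fun h => ha ((heS a).2 h)]
  -- The point is first defined for each y separately, with an arbitrary enumeration;
  -- `eq_of_coverWeight_eq` makes it independent of the choice, so continuity may be checked with
  -- any local formula.
  have hex : ∀ y, ∃ q : Realization (CoverCat U), Realization.proj q = f y ∧
      ∀ a, coverWeight q a = c a y := by
    intro y
    obtain ⟨N, hN, S, hS, hS0, -⟩ := hloc y
    have hy := mem_of_mem_nhds hN
    have hSne : S.Nonempty := by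
      obtain ⟨a, ha⟩ := hmax y
      refine ⟨a, ?_⟩
      by_contra h
      rw [hS0 y hy a h] at ha
      exact zero_ne_one ha
    obtain ⟨k, e, he, hmono⟩ := exists_embedding_monotone S hSne (c · y)
    obtain ⟨hx, p, -, hp⟩ := key y S k e he (hS y hy) (hS0 y hy) hmono
    exact ⟨_, rfl, hp⟩
  choose g hg hgc using hex
  refine ⟨⟨g, continuous_iff_continuousAt.2 fun y₀ => ?_⟩, fun y => ⟨hg y, hgc y⟩⟩
  obtain ⟨N, hN, S, hS, hS0, hcont⟩ := hloc y₀
  refine ContinuousOn.continuousAt ?_ hN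
  rw [continuousOn_iff_continuous_domRestrict]
  have hSne : S.Nonempty := by
    obtain ⟨a, ha⟩ := hmax y₀
    refine ⟨a, ?_⟩
    by_contra h
    rw [hS0 y₀ (mem_of_mem_nhds hN) a h] at ha
    exact zero_ne_one ha
  obtain ⟨k, e, he, -⟩ := exists_embedding_monotone S hSne (c · y₀)
  have heS : ∀ a, a ∈ Set.range e ↔ a ∈ S := fun a => by rw [he]; rfl
  have hce : ∀ j, Continuous fun y : N => c (e j) y := fun j =>
    continuousOn_iff_continuous_domRestrict.1 (hcont _ ((heS _).1 ⟨j, rfl⟩))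
  -- the closed sets of points where the functions are ordered in a given way
  let Z : Equiv.Perm (Fin (k + 1)) → Set N := fun σ => {y | Monotone fun j => c (e (σ j)) y}
  -- The order of the weights may change inside N. On each of the finitely many closed pieces one
  -- order is valid, hence one flag with barycentric coordinates the successive differences of the
  -- weights.
  refine (locallyFinite_of_finite Z).continuous ?_ ?_ ?_
  · exact eq_univ_of_forall fun y => mem_iUnion.2
      ⟨Tuple.sort fun j => c (e j) y, Tuple.monotone_sort fun j => c (e j) y⟩
  · intro σ
    have : Z σ = ⋂ i, ⋂ j, ⋂ (_ : i ≤ j), {y : N | c (e (σ i)) y ≤ c (e (σ j)) y} := by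
      ext y
      simp [Z, Monotone]
    rw [this]
    exact isClosed_iInter fun i => isClosed_iInter fun j => isClosed_iInter fun _ =>
      isClosed_le (hce _) (hce _)
  · intro σ
    rw [continuousOn_iff_continuous_domRestrict]
    let e' : Fin (k + 1) ↪ ι := σ.toEmbedding.trans e
    have he' : Set.range e' = S := by
      rw [← he]
      exact σ.surjective.range_comp e
    have hp : ∀ y : Z σ, ∃ (hx : ∀ j, f y.1 ∈ U (e' j)) (p : stdSimplex ℝ (Fin (k + 1))),
        p.1 = differences (fun j => c (e' j) y.1) ∧
        ∀ a, coverWeight (Realization.mk (flag e' (f y.1) hx) p) a = c a y.1 :=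
      fun y => key y.1 S k e' he' (hS _ y.1.2) (hS0 _ y.1.2) y.2
    choose hx p hpd hpw using hp
    have hpc : Continuous p := by
      refine continuous_induced_rng.2 ?_
      have : Subtype.val ∘ p = fun y : Z σ => differences (fun j => c (e' j) y.1) := funext hpd
      rw [this]
      exact continuous_differences.comp
        (continuous_pi fun j => (hce (σ j)).comp continuous_subtype_val)
    have hfc : Continuous fun y : Z σ => (⟨f y.1, hx y⟩ : {x // ∀ j, x ∈ U (e' j)}) :=
      (hf.comp (continuous_subtype_val.comp continuous_subtype_val)).subtype_mk _
    have hcomp := (Realization.continuous_mk (C := CoverCat U) k).comp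
      (((continuous_flag hU e').comp hfc).prodMk hpc)
    refine hcomp.congr fun y => ?_
    refine eq_of_coverWeight_eq ?_ ?_
    · exact (hg y.1).symm
    · funext a
      exact (hpw y a).trans (hgc y.1 a).symm

theorem continuous_nerveSimplex_fst {n : ℕ} :
    Continuous fun F : NerveSimplex (CoverCat U) n =>
      ((show ComposableArrows (CoverCat U) n from F).obj 0).1 := by
  let _ : TopologicalSpace (Finset ι) := ⊥
  have h : Continuous fun f : Arrow (CoverCat U) =>
      (f.left.1, f.left.2.carrier, f.right.2.carrier) := continuous_induced_dom
  exact (continuous_fst.comp h).comp (continuous_nerveSimplex_arrow (le_refl (0 : Fin (n + 1))))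

/-- Finite sets of indices carry the discrete topology in the space of morphisms, so they are
locally constant along simplices. -/
theorem eventually_carrier_eq {n : ℕ} (F : NerveSimplex (CoverCat U) n) :
    ∀ᶠ G : NerveSimplex (CoverCat U) n in 𝓝 F, ∀ i, ((show ComposableArrows (CoverCat U) n from G).obj i).2.carrier =
      ((show ComposableArrows (CoverCat U) n from F).obj i).2.carrier := by
  rw [eventually_all]
  intro i
  let _ : TopologicalSpace (Finset ι) := ⊥
  have : DiscreteTopology (Finset ι) := ⟨rfl⟩
  have h : Continuous fun f : Arrow (CoverCat U) =>
      (f.left.1, f.left.2.carrier, f.right.2.carrier) := continuous_induced_dom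
  have h2 := ((continuous_fst.comp continuous_snd).comp h).comp
    (continuous_nerveSimplex_arrow (C := CoverCat U) (le_refl (i : Fin (n + 1))))
  exact h2.continuousAt.eventually ((isOpen_discrete _).mem_nhds (mem_singleton _))

theorem coverWeight_nonneg (q : Realization (CoverCat U)) (a : ι) : 0 ≤ coverWeight q a := by
  classical
  obtain ⟨n, F, p, rfl⟩ := q.exists_mk
  rw [coverWeight_mk]
  refine Finset.sum_nonneg fun i _ => ?_
  split_ifs
  exacts [p.2.1 i, le_rfl]

theorem coverWeight_le_one (q : Realization (CoverCat U)) (a : ι) : coverWeight q a ≤ 1 := by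
  classical
  obtain ⟨n, F, p, rfl⟩ := q.exists_mk
  rw [coverWeight_mk, ← stdSimplex.sum_eq_one p]
  refine Finset.sum_le_sum fun i _ => ?_
  split_ifs
  exacts [le_rfl, p.2.1 i]

/-- The sets of a chain decrease, so an element of the last one lies in all of them and collects all
barycentric coordinates. -/
theorem exists_coverWeight_eq_one (q : Realization (CoverCat U)) : ∃ a, coverWeight q a = 1 := by
  classical
  obtain ⟨n, F, p, rfl⟩ := q.exists_mk
  obtain ⟨a, ha⟩ := (F.obj (Fin.last n)).2.nonempty
  refine ⟨a, ?_⟩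
  rw [coverWeight_mk, ← stdSimplex.sum_eq_one p]
  exact Finset.sum_congr rfl fun i _ =>
    if_pos (CoverCat.carrier_subset (F.map (homOfLE (Fin.le_last i))) ha)

/-- The weights of the homotopy between `s ∘ pr` and the identity. -/
def homotopyWeight (t b c : ℝ) : ℝ := max (min 1 (2 * t) * b) (min 1 (2 - 2 * t) * c)

theorem homotopyWeight_nonneg {t b c : ℝ} (h0 : 0 ≤ t) (hb : 0 ≤ b) : 0 ≤ homotopyWeight t b c :=
  le_max_of_le_left (mul_nonneg (le_min zero_le_one (by linarith)) hb)

theorem homotopyWeight_le_one {t b c : ℝ} (hb : 0 ≤ b) (hc : 0 ≤ c)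
    (hb' : b ≤ 1) (hc' : c ≤ 1) : homotopyWeight t b c ≤ 1 :=
  max_le ((mul_le_of_le_one_left hb (min_le_left _ _)).trans hb')
    ((mul_le_of_le_one_left hc (min_le_left _ _)).trans hc')

theorem homotopyWeight_eq_one_right {t b c : ℝ} (ht : t ≤ 1 / 2) (hb : 0 ≤ b) (hb' : b ≤ 1)
    (hc : c = 1) : homotopyWeight t b c = 1 := by
  refine le_antisymm (homotopyWeight_le_one hb (hc.symm ▸ zero_le_one) hb' hc.le)
    (le_max_of_le_right ?_)
  rw [hc, min_eq_left (by linarith), one_mul]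

theorem homotopyWeight_eq_one_left {t b c : ℝ} (ht : 1 / 2 ≤ t) (hc : 0 ≤ c) (hc' : c ≤ 1)
    (hb : b = 1) : homotopyWeight t b c = 1 := by
  refine le_antisymm (homotopyWeight_le_one (hb.symm ▸ zero_le_one) hc hb.le hc')
    (le_max_of_le_left ?_)
  rw [hb, min_eq_left (by linarith), one_mul]

/-- For every open covering `U` of a paracompact Hausdorff compactly generated space `X` the
projection `|X_U| → X` has a section that is a homotopy inverse over `X`. -/
theorem exists_isHomotopySection [T2Space X] [ParacompactSpace X] [CompactlyCoherentSpace X]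
    (hU : ∀ a, IsOpen (U a)) (hcover : ⋃ a, U a = univ) :
    ∃ s : C(X, Realization (CoverCat U)), IsHomotopySection U s := by
  classical
  -- A bump covering replaces a partition of unity because weights are normalized by maximum 1, not
  -- by sum 1; some bump equals 1 at every point.
  obtain ⟨b, hb⟩ := BumpCovering.exists_isSubordinate isClosed_univ U hU hcover.ge
  have hbloc : ∀ x, ∃ T : Finset ι, (∀ a ∈ T, x ∈ U a) ∧ ∀ᶠ y in 𝓝 x, ∀ a ∉ T, b a y = 0 := by
    intro x
    have hfin := b.locallyFinite_tsupport.point_finite x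
    refine ⟨hfin.toFinset, fun a ha => hb a (hfin.mem_toFinset.1 ha), ?_⟩
    filter_upwards [b.locallyFinite_tsupport.eventually_subset (fun _ => isClosed_closure) x]
      with y hy a ha
    by_contra hne
    exact ha (hfin.mem_toFinset.2 (hy (subset_closure hne)))
  obtain ⟨s, hs⟩ := exists_continuous_coverWeight hU (f := id) continuous_id
    (c := fun a x => b a x) (fun a x => b.nonneg a x) (fun a x => b.le_one a x)
    (fun x => ⟨b.ind x trivial, b.ind_apply x trivial⟩) (fun x => by
      obtain ⟨T, hT, hT0⟩ := hbloc x
      have hTU : ∀ᶠ y in 𝓝 x, ∀ a ∈ T, y ∈ U a :=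
        (Finset.eventually_all T).2 fun a ha => (hU a).mem_nhds (hT a ha)
      exact ⟨_, hTU.and hT0, T, fun y hy => hy.1, fun y hy => hy.2,
        fun a _ => (b a).continuous.continuousOn⟩)
  have hn : ∀ n : ℕ, ∃ g : C((NerveSimplex (CoverCat U) n × stdSimplex ℝ (Fin (n + 1))) ×
      unitInterval, Realization (CoverCat U)), ∀ z,
      Realization.proj (g z) = Realization.proj (Realization.mk (C := CoverCat U) z.1.1 z.1.2) ∧
      ∀ a, coverWeight (g z) a =
        homotopyWeight z.2 (coverWeight (Realization.mk (C := CoverCat U) z.1.1 z.1.2) a)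
          (b a (Realization.proj (Realization.mk (C := CoverCat U) z.1.1 z.1.2))) := by
    intro n
    have hf : Continuous fun z : (NerveSimplex (CoverCat U) n × stdSimplex ℝ (Fin (n + 1))) ×
        unitInterval => Realization.proj (Realization.mk (C := CoverCat U) z.1.1 z.1.2) :=
      continuous_nerveSimplex_fst.comp (continuous_fst.comp continuous_fst)
    refine exists_continuous_coverWeight hU hf
      (fun a z => homotopyWeight_nonneg z.2.2.1 (coverWeight_nonneg _ _))
      (fun a z => homotopyWeight_le_one (coverWeight_nonneg _ _) (b.nonneg _ _)
        (coverWeight_le_one _ _) (b.le_one _ _)) (fun z => ?_) (fun z₀ => ?_)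
    · rcases le_total (z.2 : ℝ) (1 / 2) with ht | ht
      · refine ⟨b.ind (Realization.proj (Realization.mk (C := CoverCat U) z.1.1 z.1.2)) trivial, ?_⟩
        exact homotopyWeight_eq_one_right ht (coverWeight_nonneg _ _) (coverWeight_le_one _ _)
          (b.ind_apply _ _)
      · obtain ⟨a, ha⟩ := exists_coverWeight_eq_one (Realization.mk (C := CoverCat U) z.1.1 z.1.2)
        exact ⟨a, homotopyWeight_eq_one_left ht (b.nonneg _ _) (b.le_one _ _) ha⟩
    · obtain ⟨T, hT, hT0⟩ := hbloc (Realization.proj (Realization.mk (C := CoverCat U)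
        z₀.1.1 z₀.1.2))
      have hcar := ((continuous_fst.comp continuous_fst).continuousAt (x := z₀)).eventually
        (eventually_carrier_eq z₀.1.1)
      let F₀ : ComposableArrows (CoverCat U) n := z₀.1.1
      have hsub : ∀ i, (F₀.obj i).2.carrier ⊆ (F₀.obj 0).2.carrier := fun i =>
        CoverCat.carrier_subset (F₀.map (homOfLE (Fin.zero_le i)))
      have hTU := (hf.continuousAt (x := z₀)).eventually
        ((Finset.eventually_all T).2 fun a ha => (hU a).mem_nhds (hT a ha))
      have hT0' := (hf.continuousAt (x := z₀)).eventually hT0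
      -- Near the given simplex the chain of index sets is constant and only the bumps of T are
      -- nonzero, so the largest set of the chain together with T supports all weights.
      refine ⟨_, hcar.and (hTU.and hT0'), (F₀.obj 0).2.carrier ∪ T, ?_, ?_, fun a _ => ?_⟩
      · rintro ⟨⟨F, p⟩, t⟩ ⟨h1, h2, -⟩ a ha
        rcases Finset.mem_union.1 ha with ha | ha
        · exact ((show ComposableArrows (CoverCat U) n from F).obj 0).2.mem a ((h1 0).symm ▸ ha)
        · exact h2 a ha
      · rintro ⟨⟨F, p⟩, t⟩ ⟨h1, -, h3⟩ a ha
        rw [Finset.mem_union, not_or] at ha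
        have hw : coverWeight (Realization.mk (C := CoverCat U) F p) a = 0 := by
          refine (coverWeight_mk F p a).trans ?_
          refine Finset.sum_eq_zero fun i _ => if_neg fun h => ha.1 (hsub i ?_)
          exact (h1 i) ▸ h
        change homotopyWeight _ (coverWeight (Realization.mk (C := CoverCat U) F p) a) _ = 0
        rw [hw, h3 a ha.2, homotopyWeight, mul_zero, mul_zero, max_self]
      · have hbc : Continuous fun z : (NerveSimplex (CoverCat U) n ×
            stdSimplex ℝ (Fin (n + 1))) × unitInterval =>
            homotopyWeight z.2 (∑ i, if a ∈ (F₀.obj i).2.carrier then z.1.2.1 i else 0)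
              (b a (Realization.proj (Realization.mk (C := CoverCat U) z.1.1 z.1.2))) := by
          have h1 : Continuous fun z : (NerveSimplex (CoverCat U) n ×
            stdSimplex ℝ (Fin (n + 1))) × unitInterval =>
            (∑ i, if a ∈ (F₀.obj i).2.carrier then z.1.2.1 i else 0) := by
            refine continuous_finsetSum _ fun i _ => ?_
            split_ifs
            · exact (continuous_apply i).comp
                (continuous_subtype_val.comp (continuous_snd.comp continuous_fst))
            · exact continuous_const
          have h2 := (b a).continuous.comp hf
          unfold homotopyWeight
          have h3 : Continuous fun z : (NerveSimplex (CoverCat U) n ×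
            stdSimplex ℝ (Fin (n + 1))) × unitInterval => (z.2 : ℝ) :=
            continuous_subtype_val.comp continuous_snd
          exact ((continuous_const.min (continuous_const.mul h3)).mul h1).max
            ((continuous_const.min (continuous_const.sub (continuous_const.mul h3))).mul h2)
        refine hbc.continuousOn.congr ?_
        rintro ⟨⟨F, p⟩, t⟩ ⟨h1, -⟩
        change homotopyWeight _ (coverWeight (Realization.mk (C := CoverCat U) F p) a) _ = _
        congr 1
        refine (coverWeight_mk F p a).trans (Finset.sum_congr rfl fun i _ => ?_)
        have := h1 i
        exact if_congr (this ▸ Iff.rfl) rfl rfl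
  choose g hg using hn
  have hex : ∀ z : unitInterval × Realization (CoverCat U), ∃ q : Realization (CoverCat U),
      Realization.proj q = Realization.proj z.2 ∧ ∀ a, coverWeight q a =
        homotopyWeight z.1 (coverWeight z.2 a) (b a (Realization.proj z.2)) := by
    rintro ⟨t, q⟩
    obtain ⟨n, F, p, rfl⟩ := q.exists_mk
    let z : NerveSimplex (CoverCat U) n × stdSimplex ℝ (Fin (n + 1)) := (F, p)
    exact ⟨g n (z, t), hg n (z, t)⟩
  choose h hh using hex
  have hcont : Continuous h := by
    -- The pointwise choice h agrees with the continuous maps g n on simplices because both have the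
    -- same projection and weights.
    refine Realization.continuous_homotopy h fun n => (g n).continuous.congr fun z => ?_
    have h' := hh (z.2, Realization.mk (C := CoverCat U) z.1.1 z.1.2)
    exact eq_of_coverWeight_eq ((hg n z).1.trans h'.1.symm)
      (funext fun a => ((hg n z).2 a).trans (h'.2 a).symm)
  refine ⟨s, fun x => (hs x).1, ⟨h, hcont⟩, fun q => ?_, fun q => ?_, fun t q => (hh (t, q)).1⟩
  · refine eq_of_coverWeight_eq ((hh _).1.trans (hs _).1.symm) (funext fun a => ?_)
    change coverWeight (h (0, q)) a = _
    rw [(hh _).2, (hs _).2]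
    simp [homotopyWeight, b.nonneg]
  · refine eq_of_coverWeight_eq (hh _).1 (funext fun a => ?_)
    change coverWeight (h (1, q)) a = _
    rw [(hh _).2]
    simp [homotopyWeight, coverWeight_nonneg]

end Covering

/-! ### Refinement of coverings and homotopies of sections -/

section Covering

variable {X : Type u} {ι κ : Type w}

/-- The inclusion of the fiber of `X_U` for a part `U` of a covering `W`. -/
def coverIncl (j : ι ↪ κ) (W : κ → Set X) (x : X) :
    CoverFiber (fun a => W (j a)) x ⥤ CoverFiber W x :=
  Monotone.functor (f := fun σ => (⟨σ.carrier.map j, σ.nonempty.map, fun b hb => by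
      obtain ⟨a, ha, rfl⟩ := Finset.mem_map.1 hb
      exact σ.mem a ha⟩ : CoverFiber W x))
    (fun _ _ h => Finset.map_subset_map.2 h)

theorem coverIncl_min (j : ι ↪ κ) (W : κ → Set X) (x : X) (ε : κ → ℝ)
    (σ : CoverFiber (fun a => W (j a)) x) :
    ((coverIncl j W x).obj σ).min ε = σ.min (fun a => ε (j a)) := by
  exact Finset.inf'_map ε (σ.nonempty.map (f := j))

theorem continuous_mapArrow_coverIncl [TopologicalSpace X] (j : ι ↪ κ) (W : κ → Set X) :
    Continuous (sigmaFunctor (coverIncl j W)).mapArrow.obj := by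
  let _ : TopologicalSpace (Finset ι) := ⊥
  let _ : TopologicalSpace (Finset κ) := ⊥
  have : DiscreteTopology (Finset ι) := ⟨rfl⟩
  have h : Continuous fun f : Arrow (CoverCat fun a => W (j a)) =>
      (f.left.1, f.left.2.carrier, f.right.2.carrier) := continuous_induced_dom
  have h2 : Continuous fun p : X × Finset ι × Finset ι => (p.1, p.2.1.map j, p.2.2.map j) :=
    continuous_fst.prodMk (((continuous_of_discreteTopology (f := Finset.map j)).comp
      (continuous_fst.comp continuous_snd)).prodMk
        ((continuous_of_discreteTopology (f := Finset.map j)).comp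
          (continuous_snd.comp continuous_snd)))
  exact continuous_induced_rng.2 (h2.comp h)

universe v₁ u₁ v₂ u₂ v₃ u₃

theorem sigmaFunctor_comp {I : Type*} {C : I → Type u₁} [∀ i, Category.{v₁} (C i)]
    {D : I → Type u₂} [∀ i, Category.{v₂} (D i)] {D' : I → Type u₃} [∀ i, Category.{v₃} (D' i)]
    (F : ∀ i, C i ⥤ D i) (G : ∀ i, D i ⥤ D' i) :
    sigmaFunctor F ⋙ sigmaFunctor G = sigmaFunctor fun i => F i ⋙ G i := by
  refine CategoryTheory.Functor.ext (fun _ => rfl) ?_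
  rintro _ _ ⟨f⟩
  exact ((Category.id_comp _).trans (Category.comp_id _)).symm

theorem Realization.map_map {C : Type u₁} [Category.{v₁} C] [TopologicalSpace (Arrow C)]
    {D : Type u₂} [Category.{v₂} D] [TopologicalSpace (Arrow D)]
    {D' : Type u₃} [Category.{v₃} D'] [TopologicalSpace (Arrow D')] (F : C ⥤ D) (G : D ⥤ D')
    (q : Realization C) :
    Realization.map G (Realization.map F q) = Realization.map (F ⋙ G) q := by
  obtain ⟨n, S, p, rfl⟩ := q.exists_mk
  rfl

theorem Realization.proj_map_sigmaFunctor {I : Type*} {C : I → Type u₁} [∀ i, Category.{v₁} (C i)]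
    {D : I → Type u₂} [∀ i, Category.{v₂} (D i)] [TopologicalSpace (Arrow (Σ i, C i))]
    [TopologicalSpace (Arrow (Σ i, D i))] (F : ∀ i, C i ⥤ D i) (q : Realization (Σ i, C i)) :
    Realization.proj (Realization.map (sigmaFunctor F) q) = Realization.proj q := by
  obtain ⟨n, S, p, rfl⟩ := q.exists_mk
  rfl

/-- The images of two sections under a map that collapses the fibers over `Z` are homotopic
relative to `Z`. -/
theorem homotopicRel_of_sections [TopologicalSpace X] [T2Space X] [ParacompactSpace X]
    [CompactlyCoherentSpace X] {W : κ → Set X} (hW : ∀ a, IsOpen (W a))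
    (hcover : ⋃ a, W a = univ) {Y : Type*} [TopologicalSpace Y]
    (Φ : C(Realization (CoverCat W), Y)) (Z : Set X)
    (hZ : ∀ q q', Realization.proj q ∈ Z → Realization.proj q = Realization.proj q' → Φ q = Φ q')
    (s₁ s₂ : C(X, Realization (CoverCat W))) (h₁ : ∀ x, Realization.proj (s₁ x) = x)
    (h₂ : ∀ x, Realization.proj (s₂ x) = x) :
    (Φ.comp s₁).HomotopicRel (Φ.comp s₂) Z := by
  obtain ⟨s₀, hs₀, h, hh0, hh1, hp⟩ := exists_isHomotopySection hW hcover
  have key : ∀ s : C(X, Realization (CoverCat W)), (∀ x, Realization.proj (s x) = x) →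
      (Φ.comp s₀).HomotopicRel (Φ.comp s) Z := by
    intro s hs
    -- The homotopy h(t, s(x)) runs from s₀(pr s(x)) = s₀(x) to s(x).
    refine ⟨⟨⟨Φ.comp (h.comp ((ContinuousMap.id _).prodMap s)), fun x => ?_, fun x => ?_⟩, ?_⟩⟩
    · change Φ (h (0, s x)) = Φ (s₀ x)
      rw [hh0, hs]
    · change Φ (h (1, s x)) = Φ (s x)
      rw [hh1]
    · intro t x hx
      change Φ (h (t, s x)) = Φ (s₀ x)
      -- Since h is a homotopy over X, the path stays over x, and Φ is constant on that fiber for x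
      -- in Z.
      refine hZ _ _ ?_ ?_
      · rw [hp, hs]; exact hx
      · rw [hp, hs, hs₀]
  exact (key s₁ h₁).symm.trans (key s₂ h₂)

/-- Two maps induced by restrictions of the same functor are homotopic. -/
theorem homotopicRel_of_coverIncl [TopologicalSpace X] [T2Space X] [ParacompactSpace X]
    [CompactlyCoherentSpace X] {ι' : Type w} {W : κ → Set X} (j : ι ↪ κ) (j' : ι' ↪ κ)
    (hW : ∀ a, IsOpen (W a)) (hcover : ⋃ a, W a = univ)
    {D : X → Type u₂} [∀ x, Category.{v₂} (D x)] [TopologicalSpace (Arrow (Σ x, D x))]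
    (G : ∀ x, CoverFiber W x ⥤ D x)
    (hG : Continuous (sigmaFunctor G).mapArrow.obj) (Z : Set X)
    (hZ : ∀ q q', Realization.proj q ∈ Z → Realization.proj q = Realization.proj q' →
      Realization.map (sigmaFunctor G) q = Realization.map (sigmaFunctor G) q')
    (s : C(X, Realization (CoverCat fun a => W (j a))))
    (s' : C(X, Realization (CoverCat fun a => W (j' a))))
    (hs : ∀ x, Realization.proj (s x) = x) (hs' : ∀ x, Realization.proj (s' x) = x)
    (f f' : C(X, Realization (Σ x, D x)))
    (hf : ⇑f = Realization.map (sigmaFunctor fun x => coverIncl j W x ⋙ G x) ∘ s)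
    (hf' : ⇑f' = Realization.map (sigmaFunctor fun x => coverIncl j' W x ⋙ G x) ∘ s') :
    f.HomotopicRel f' Z := by
  let Φ : C(Realization (CoverCat W), Realization (Σ x, D x)) :=
    ⟨_, Realization.continuous_map _ hG⟩
  let s₁ : C(X, Realization (CoverCat W)) :=
    ⟨_, (Realization.continuous_map _ (continuous_mapArrow_coverIncl j W)).comp s.continuous⟩
  let s₂ : C(X, Realization (CoverCat W)) :=
    ⟨_, (Realization.continuous_map _ (continuous_mapArrow_coverIncl j' W)).comp s'.continuous⟩
  have e₁ : f = Φ.comp s₁ := by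
    ext x
    rw [hf, ← sigmaFunctor_comp, Function.comp_apply, ← Realization.map_map]
    rfl
  have e₂ : f' = Φ.comp s₂ := by
    ext x
    rw [hf', ← sigmaFunctor_comp, Function.comp_apply, ← Realization.map_map]
    rfl
  rw [e₁, e₂]
  exact homotopicRel_of_sections hW hcover Φ Z hZ s₁ s₂
    (fun x => (Realization.proj_map_sigmaFunctor _ _).trans (hs x))
    (fun x => (Realization.proj_map_sigmaFunctor _ _).trans (hs' x))

end Covering

/-! ### Equality of functors to the categories of subspaces -/

section Subspaces

variable {K : Type v} [NormedAddCommGroup K] [InnerProductSpace ℂ K]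

theorem SubspaceObj.ext' {V V' : SubspaceObj K} (h : V.space = V'.space) : V = V' := by
  cases V; cases V'; cases h; rfl

theorem PairObj.ext' {V V' : PairObj K} (h₁ : V.fst = V'.fst) (h₂ : V.snd = V'.snd) : V = V' := by
  cases V; cases V'; cases h₁; cases h₂; rfl

/-- The transport morphisms `eqToHom` have zero negative and positive parts, so conjugation by them
leaves both parts unchanged. It makes index functors unique. -/
theorem subspaceFunctor_ext {J : Type*} [Category* J] {F G : J ⥤ SubspaceObj K}
    (h : ∀ i, (F.obj i).space = (G.obj i).space)
    (hn : ∀ {i j} (f : i ⟶ j), SubspaceHom.neg (F.map f) = SubspaceHom.neg (G.map f))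
    (hp : ∀ {i j} (f : i ⟶ j), SubspaceHom.pos (F.map f) = SubspaceHom.pos (G.map f)) : F = G := by
  have aux : ∀ {V V' W W' : SubspaceObj K} (e : V = V') (e' : W' = W) (f : V' ⟶ W'),
      SubspaceHom.neg (eqToHom e ≫ f ≫ eqToHom e') = SubspaceHom.neg f ∧
        SubspaceHom.pos (eqToHom e ≫ f ≫ eqToHom e') = SubspaceHom.pos f := by
    rintro _ _ _ _ rfl rfl f
    simp
  refine CategoryTheory.Functor.ext (fun i => SubspaceObj.ext' (h i)) fun i j f => ?_
  exact SubspaceHom.ext ((hn f).trans (aux _ _ _).1.symm) ((hp f).trans (aux _ _ _).2.symm)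

variable [CompleteSpace K]

theorem pairFunctor_ext {J : Type*} [Category* J] {F G : J ⥤ PairObj K}
    (h₁ : ∀ i, (F.obj i).fst = (G.obj i).fst) (h₂ : ∀ i, (F.obj i).snd = (G.obj i).snd)
    (h : ∀ {i j} (f : i ⟶ j), PairHom.iso (F.map f) = PairHom.iso (G.map f)) : F = G := by
  have aux : ∀ {V V' W W' : PairObj K} (e : V = V') (e' : W' = W) (f : V' ⟶ W'),
      PairHom.iso (eqToHom e ≫ f ≫ eqToHom e') = PairHom.iso f := by
    rintro _ _ _ _ rfl rfl f
    simp
  refine CategoryTheory.Functor.ext (fun i => PairObj.ext' (h₁ i) (h₂ i)) fun i j f => ?_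
  exact PairHom.ext ((h f).trans (aux _ _ _).symm)

/-- Here `star iso * iso` is a difference of two zero projections. So the zero pair has no
endomorphisms but the identity. -/
theorem pairHom_iso_eq_zero {V V' : PairObj K} (f : V ⟶ V') (h : V.fst = ⊥) (h' : V'.fst = ⊥) :
    PairHom.iso f = 0 := by
  have h1 := PairHom.initial_eq f
  simp only [h, h'] at h1
  rw [sub_self] at h1
  exact CStarRing.star_mul_self_eq_zero_iff _ |>.1 h1

end Subspaces

/-- If all objects over `x` are taken to the zero pair, then the map of classifying spaces
collapses the fiber over `x`. -/
theorem realization_map_eq_of_bot {X : Type u} [TopologicalSpace X] {κ : Type w} {W : κ → Set X}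
    {K : X → Type v} [∀ x, NormedAddCommGroup (K x)] [∀ x, InnerProductSpace ℂ (K x)]
    [∀ x, CompleteSpace (K x)] [TopologicalSpace (Arrow (Σ x, PairObj (K x)))]
    (G : ∀ x, CoverFiber W x ⥤ PairObj (K x)) {x : X}
    (h₁ : ∀ σ, ((G x).obj σ).fst = ⊥) (h₂ : ∀ σ, ((G x).obj σ).snd = ⊥)
    {q q' : Realization (CoverCat W)} (hq : Realization.proj q = x)
    (hq' : Realization.proj q' = x) :
    Realization.map (sigmaFunctor G) q = Realization.map (sigmaFunctor G) q' := by
  -- both points are equal to the vertex defined by the zero object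
  let V : PairObj (K x) := ⟨⊥, ⊥, inferInstance, inferInstance⟩
  let V₀ : ComposableArrows (Σ x, PairObj (K x)) 0 := ComposableArrows.mk₀ ⟨x, V⟩
  have key : ∀ q : Realization (CoverCat W), Realization.proj q = x →
      Realization.map (sigmaFunctor G) q = Realization.mk V₀ default := by
    intro q hq
    obtain ⟨n, F, p, rfl⟩ := q.exists_mk
    have hobj : ∀ a : CoverCat W, a.1 = x → (sigmaFunctor G).obj a = ⟨x, V⟩ := by
      rintro ⟨y, σ⟩ hy
      obtain rfl : y = x := hy
      exact congrArg (Sigma.mk y) (PairObj.ext' (h₁ σ) (h₂ σ))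
    have hsub : ∀ a b : (Σ x, PairObj (K x)), a = ⟨x, V⟩ → b = ⟨x, V⟩ → Subsingleton (a ⟶ b) := by
      rintro _ _ rfl rfl
      refine ⟨fun f g => ?_⟩
      obtain ⟨f⟩ := (f : Sigma.SigmaHom _ _)
      obtain ⟨g⟩ := (g : Sigma.SigmaHom _ _)
      refine congrArg _ (PairHom.ext ?_)
      rw [pairHom_iso_eq_zero f rfl rfl, pairHom_iso_eq_zero g rfl rfl]
    have hF : ∀ i, (F.obj i).1 = x := fun i => (CoverCat.fst_obj F i).trans hq
    let θ : Fin (n + 1) →o Fin (0 + 1) := ⟨fun _ => 0, fun _ _ _ => le_rfl⟩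
    have hfun : F ⋙ sigmaFunctor G = θ.monotone.functor ⋙ V₀ := by
      refine CategoryTheory.Functor.ext (fun i => hobj _ (hF i)) fun i j f => ?_
      exact (hsub _ _ (hobj _ (hF i)) (hobj _ (hF j))).elim _ _
    have h3 : Realization.map (sigmaFunctor G) (Realization.mk F p) =
        Realization.mk (F ⋙ sigmaFunctor G : ComposableArrows _ n) p := rfl
    rw [h3, hfun, Realization.mk_comp θ V₀ p]
    congr 1
    exact Subsingleton.elim _ _
  rw [key q hq, key q' hq']

/-! ### The bounded transform -/

section Operators

set_option linter.unusedSectionVars false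

variable {K : Type*} [NormedAddCommGroup K] [InnerProductSpace ℂ K] [CompleteSpace K]

/-! Shortcuts for the search of instances. -/

instance : Algebra ℝ (K →L[ℂ] K) := inferInstance

instance : IsScalarTower ℝ (K →L[ℂ] K) (K →L[ℂ] K) := inferInstance

instance : SMulCommClass ℝ (K →L[ℂ] K) (K →L[ℂ] K) := inferInstance

instance : NonnegSpectrumClass ℝ (K →L[ℂ] K) := inferInstance

local notation "⟪" x ", " y "⟫" => inner ℂ x y

/-- The defect operator `√(1 - T* T)` of a contraction. -/
def defect (T : K →L[ℂ] K) : K →L[ℂ] K := CFC.sqrt (1 - star T * T)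

theorem mem_transformGraph {T : K →L[ℂ] K} {p : K × K} :
    p ∈ transformGraph T ↔ ∃ v, defect T v = p.1 ∧ T v = p.2 := by
  simp only [transformGraph, LinearMap.mem_range, Prod.ext_iff]
  rfl

theorem isSelfAdjoint_defect (T : K →L[ℂ] K) : IsSelfAdjoint (defect T) :=
  (CFC.sqrt_nonneg _).isSelfAdjoint

theorem inner_defect_left (T : K →L[ℂ] K) (v w : K) : ⟪defect T v, w⟫ = ⟪v, defect T w⟫ :=
  (isSelfAdjoint_defect T).isSymmetric v w

theorem one_sub_star_mul_self_nonneg {T : K →L[ℂ] K} (hT : ‖T‖ ≤ 1) : 0 ≤ 1 - star T * T := by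
  rw [sub_nonneg, ← CStarAlgebra.norm_le_one_iff_of_nonneg _ (star_mul_self_nonneg T),
    CStarRing.norm_star_mul_self]
  nlinarith [norm_nonneg T]

theorem defect_mul_self {T : K →L[ℂ] K} (hT : ‖T‖ ≤ 1) :
    defect T * defect T = 1 - star T * T :=
  CFC.sqrt_mul_sqrt_self _ (one_sub_star_mul_self_nonneg hT)

theorem defect_defect {T : K →L[ℂ] K} (hT : ‖T‖ ≤ 1) (v : K) :
    defect T (defect T v) = v - star T (T v) :=
  DFunLike.congr_fun (defect_mul_self hT) v

/-- By D² = 1 - T*T the map v ↦ (Dv, Tv) is an isometry of K onto the transform graph; its parameter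
v is therefore determined by the point of the graph. -/
theorem inner_defect_add_inner {T : K →L[ℂ] K} (hT : ‖T‖ ≤ 1) (v w : K) :
    ⟪defect T v, defect T w⟫ + ⟪T v, T w⟫ = ⟪v, w⟫ := by
  rw [inner_defect_left, defect_defect hT, inner_sub_right, ContinuousLinearMap.star_eq_adjoint,
    ContinuousLinearMap.adjoint_inner_right]
  abel

theorem eq_zero_of_defect_eq_zero {T : K →L[ℂ] K} (hT : ‖T‖ ≤ 1) {v : K} (h : defect T v = 0)
    (h' : T v = 0) : v = 0 := by
  have := inner_defect_add_inner hT v v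
  rw [h, h', inner_zero_left, add_zero] at this
  exact inner_self_eq_zero.1 this.symm

/-- The graph of an operator has one value over 0, so Dv = 0 forces Tv = 0, and then v = 0 by
isometry. -/
theorem IsBoundedTransform.injective {B : K →ₗ.[ℂ] K} {T : K →L[ℂ] K}
    (h : IsBoundedTransform B T) {v : K} (hv : defect T v = 0) : v = 0 := by
  refine eq_zero_of_defect_eq_zero h.1 hv (B.graph_fst_eq_zero_snd (x := defect T v) ?_ hv)
  rw [h.2]
  exact mem_transformGraph.2 ⟨v, rfl, rfl⟩

theorem denseRange_of_injective {S : K →L[ℂ] K} (hS : IsSelfAdjoint S)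
    (h : ∀ v, S v = 0 → v = 0) : DenseRange S := by
  have h1 : S.range.topologicalClosure = ⊤ := by
    rw [Submodule.topologicalClosure_eq_top_iff, ContinuousLinearMap.orthogonal_range,
      ← ContinuousLinearMap.star_eq_adjoint, hS.star_eq]
    exact (Submodule.eq_bot_iff _).2 h
  have h2 := Submodule.dense_iff_topologicalClosure_eq_top.2 h1
  exact h2

theorem mul_right_cancel_of_injective {S a b : K →L[ℂ] K} (hS : IsSelfAdjoint S)
    (h : ∀ v, S v = 0 → v = 0) (hab : a * S = b * S) : a = b := by
  have := (denseRange_of_injective hS h).equalizer a.continuous b.continuous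
    (funext fun v => DFunLike.congr_fun hab v)
  exact DFunLike.coe_injective this

theorem mul_left_cancel_of_injective {S a b : K →L[ℂ] K}
    (h : ∀ v, S v = 0 → v = 0) (hab : S * a = S * b) : a = b := by
  ext v
  have : S (a v - b v) = 0 := by
    rw [map_sub, sub_eq_zero]
    exact DFunLike.congr_fun hab v
  exact sub_eq_zero.1 (h _ this)

/-- A closed operator has only one bounded transform. -/
theorem IsBoundedTransform.unique {B : K →ₗ.[ℂ] K} {T T' : K →L[ℂ] K}
    (h : IsBoundedTransform B T) (h' : IsBoundedTransform B T') : T = T' := by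
  have hg : transformGraph T = transformGraph T' := h.2.symm.trans h'.2
  -- The point (D²u, TDu) is the orthogonal projection of (u, 0) to the graph, so it depends on the
  -- graph only. Once D² is known, its positive root D is too, and T is found from TD because D has
  -- dense range.
  have key : ∀ u, defect T (defect T u) = defect T' (defect T' u) ∧
      T (defect T u) = T' (defect T' u) := by
    intro u
    have h1 : ((defect T (defect T u), T (defect T u)) : K × K) ∈ transformGraph T' := by
      rw [← hg]
      exact mem_transformGraph.2 ⟨_, rfl, rfl⟩
    obtain ⟨w, hw, hw'⟩ := mem_transformGraph.1 h1
    simp only at hw hw'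
    have : w = defect T' u := by
      refine ext_inner_right ℂ fun z => ?_
      have h2 : ((defect T' z, T' z) : K × K) ∈ transformGraph T := by
        rw [hg]
        exact mem_transformGraph.2 ⟨_, rfl, rfl⟩
      obtain ⟨z', hz, hz'⟩ := mem_transformGraph.1 h2
      simp only at hz hz'
      rw [← inner_defect_add_inner h'.1, hw, hw', ← hz, ← hz', inner_defect_add_inner h.1,
        inner_defect_left, hz, inner_defect_left]
    rw [← this, hw, hw']
    exact ⟨rfl, rfl⟩
  have hS : defect T = defect T' := by
    refine (CFC.mul_self_eq_mul_self_iff _ _ (CFC.sqrt_nonneg _) (CFC.sqrt_nonneg _)).1 ?_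
    ext u
    exact (key u).1
  refine mul_right_cancel_of_injective (isSelfAdjoint_defect T) (fun v => h.injective) ?_
  ext u
  have := (key u).2
  rw [← hS] at this
  exact this

theorem IsBoundedTransform.boundedTransform_eq {B : K →ₗ.[ℂ] K} {T : K →L[ℂ] K}
    (h : IsBoundedTransform B T) : boundedTransform B = T :=
  IsBoundedTransform.unique (Classical.epsilon_spec ⟨T, h⟩) h

theorem IsBoundedTransform.dense_domain {B : K →ₗ.[ℂ] K} {T : K →L[ℂ] K}
    (h : IsBoundedTransform B T) : Dense (B.domain : Set K) := by
  refine (denseRange_of_injective (isSelfAdjoint_defect T) fun _ => h.injective).mono ?_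
  rintro _ ⟨v, rfl⟩
  refine LinearPMap.mem_domain_of_mem_graph (y := T v) ?_
  rw [h.2]
  exact mem_transformGraph.2 ⟨v, rfl, rfl⟩

theorem defect_eq_of_star_mul_self_eq {T T' : K →L[ℂ] K} (h : star T * T = star T' * T') :
    defect T = defect T' := by
  rw [defect, defect, h]

/-- The bounded transform of the adjoint. -/
theorem IsBoundedTransform.adjoint {B : K →ₗ.[ℂ] K} {b : K →L[ℂ] K}
    (h : IsBoundedTransform B b) (hb : IsStarNormal b) : IsBoundedTransform B† (star b) := by
  have hd : defect (star b) = defect b :=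
    defect_eq_of_star_mul_self_eq (by rw [star_star, hb.star_comm_self.eq])
  have hbs : Commute b (defect b) := by
    rw [defect, CFC.sqrt]
    refine ((Commute.one_left b).sub_left ?_).cfcₙ_nnreal _ |>.symm
    exact hb.star_comm_self.mul_left (Commute.refl b)
  have hbs' : Commute (star b) (defect b) := by
    have := hbs.star_star
    rwa [(isSelfAdjoint_defect b).star_eq] at this
  refine ⟨(norm_star b).trans_le h.1, ?_⟩
  rw [LinearPMap.adjoint_graph_eq_graph_adjoint h.dense_domain, h.2]
  ext ⟨x, y⟩
  rw [Submodule.mem_adjoint_iff, mem_transformGraph, hd]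
  have hiff : (∀ a c, (a, c) ∈ transformGraph b → ⟪c, x⟫ - ⟪a, y⟫ = 0) ↔
      star b x = defect b y := by
    constructor
    · intro hxy
      refine ext_inner_left ℂ fun v => ?_
      have := hxy _ _ (mem_transformGraph.2 ⟨v, rfl, rfl⟩)
      rw [ContinuousLinearMap.star_eq_adjoint, ContinuousLinearMap.adjoint_inner_right,
        ← inner_defect_left]
      exact sub_eq_zero.1 this
    · intro hxy a c hac
      obtain ⟨v, rfl, rfl⟩ := mem_transformGraph.1 hac
      rw [sub_eq_zero, inner_defect_left, ← hxy, ContinuousLinearMap.star_eq_adjoint,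
        ContinuousLinearMap.adjoint_inner_right]
  -- The witness Dx + by is the adjoint of the isometry v ↦ (Dv, b*v) applied to (x, y); on the
  -- range of the isometry the adjoint is its inverse.
  refine hiff.trans ⟨fun hxy => ⟨defect b x + b y, ?_, ?_⟩, ?_⟩
  · have h1 := DFunLike.congr_fun hbs.eq y
    have h2 := DFunLike.congr_fun hb.star_comm_self.eq x
    simp only [mul_apply_eq_comp] at h1 h2
    rw [map_add, defect_defect h.1, ← h1, ← hxy, h2]
    simp
  · have h1 := DFunLike.congr_fun hbs'.eq x
    simp only [mul_apply_eq_comp] at h1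
    rw [map_add, h1, hxy, defect_defect h.1]
    simp
  · rintro ⟨v, rfl, rfl⟩
    exact DFunLike.congr_fun hbs'.eq v

/-- The bounded transform of the absolute value. -/
theorem IsBoundedTransform.absOp {B : K →ₗ.[ℂ] K} {b : K →L[ℂ] K}
    (h : IsBoundedTransform B b) : IsBoundedTransform (absOp B) (CFC.abs b) := by
  have hd : defect (CFC.abs b) = defect b :=
    defect_eq_of_star_mul_self_eq (by
      rw [(CFC.abs_nonneg b).isSelfAdjoint.star_eq, CFC.abs_mul_abs])
  have hn : ‖CFC.abs b‖ ≤ 1 := CFC.norm_abs.trans_le h.1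
  refine ⟨hn, ?_⟩
  rw [FredholmIndex.absOp, h.boundedTransform_eq]
  refine Submodule.toLinearPMap_graph_eq _ ?_
  rintro ⟨x, y⟩ hxy hx
  obtain ⟨v, hv, rfl⟩ := mem_transformGraph.1 hxy
  simp only at hx
  rw [hd, hx] at hv
  rw [h.injective hv, map_zero]

end Operators

/-! ### The bounded transform of a self-adjoint operator -/

section SelfAdjoint

variable {K : Type*} [NormedAddCommGroup K] [InnerProductSpace ℂ K] [CompleteSpace K]

local notation "⟪" x ", " y "⟫" => inner ℂ x y

theorem inner_eq_of_mem_graph {A : K →ₗ.[ℂ] K} (hA : IsSelfAdjoint A) {x y x' y' : K}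
    (h : (x, y) ∈ A.graph) (h' : (x', y') ∈ A.graph) : ⟪y, x'⟫ = ⟪x, y'⟫ := by
  have h1 : (x', y') ∈ A†.graph := by
    rwa [LinearPMap.isSelfAdjoint_def.1 hA]
  rw [LinearPMap.adjoint_graph_eq_graph_adjoint hA.dense_domain, Submodule.mem_adjoint_iff] at h1
  exact sub_eq_zero.1 (h1 x y h)

/-- `1 + A²` is surjective, and its inverse `C` and `D = A C` are bounded. -/
theorem exists_resolvent {A : K →ₗ.[ℂ] K} (hA : IsSelfAdjoint A) :
    ∃ C D : K →L[ℂ] K, ∀ w, (C w, D w) ∈ A.graph ∧ (D w, w - C w) ∈ A.graph := by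
  let e : WithLp 2 (K × K) ≃L[ℂ] K × K := WithLp.prodContinuousLinearEquiv 2 ℂ K K
  let G : Submodule ℂ (WithLp 2 (K × K)) := A.graph.comap (e : WithLp 2 (K × K) →ₗ[ℂ] K × K)
  have hG : IsClosed (G : Set (WithLp 2 (K × K))) := hA.isClosed.preimage e.continuous
  have : CompleteSpace G := hG.completeSpace_coe
  let P : K → K × K := fun w => e (G.starProjection (e.symm (w, 0)))
  -- The pair (Cw, Dw) is the orthogonal projection of (w, 0) to the graph of A in the Hilbert sum K
  -- ⊕ K.
  let PL : K →L[ℂ] K × K :=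
    (e : WithLp 2 (K × K) →L[ℂ] K × K) ∘L G.starProjection ∘L
      (e.symm : K × K →L[ℂ] WithLp 2 (K × K)) ∘L (ContinuousLinearMap.inl ℂ K K)
  refine ⟨ContinuousLinearMap.fst ℂ K K ∘L PL, ContinuousLinearMap.snd ℂ K K ∘L PL, fun w => ?_⟩
  have h1 : PL w ∈ A.graph := Submodule.starProjection_apply_mem G _
  refine ⟨h1, ?_⟩
  have h2 : e.symm (w, 0) - G.starProjection (e.symm (w, 0)) ∈ Gᗮ :=
    Submodule.sub_starProjection_mem_orthogonal _
  -- The remainder (w - Cw, -Dw) is orthogonal to the graph; after exchanging coordinates with a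
  -- sign this is membership in the graph of the adjoint, which is A.
  have h3 : ((PL w).2, w - (PL w).1) ∈ A†.graph := by
    rw [LinearPMap.adjoint_graph_eq_graph_adjoint hA.dense_domain, Submodule.mem_adjoint_iff]
    intro a b hab
    have h4 : e.symm (a, b) ∈ G := by
      change e (e.symm (a, b)) ∈ A.graph
      rwa [e.apply_symm_apply]
    have h5 := Submodule.inner_right_of_mem_orthogonal h4 h2
    rw [WithLp.prod_inner_apply] at h5
    have h6 : ⟪a, w - (PL w).1⟫ + ⟪b, 0 - (PL w).2⟫ = 0 := h5
    rw [zero_sub, inner_neg_right] at h6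
    rw [← neg_eq_zero, ← h6]
    abel
  rwa [LinearPMap.isSelfAdjoint_def.1 hA] at h3

/-- Every self-adjoint operator has a self-adjoint bounded transform. -/
theorem exists_isBoundedTransform {A : K →ₗ.[ℂ] K} (hA : IsSelfAdjoint A) :
    ∃ T : K →L[ℂ] K, IsSelfAdjoint T ∧ IsBoundedTransform A T := by
  obtain ⟨C, D, hCD⟩ := exists_resolvent hA
  have hfun : ∀ {x y y' : K}, (x, y) ∈ A.graph → (x, y') ∈ A.graph → y = y' := fun h h' =>
    A.mem_graph_snd_inj h h' rfl
  have hsym := @inner_eq_of_mem_graph K _ _ _ A hA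
  -- This is injectivity of 1 + A²: if A²x = -x, then ‖Ax‖² = -‖x‖² by symmetry. It yields the
  -- algebraic relations CD = DC and D² = C - C².
  have huniq : ∀ {x y w : K}, (x, y) ∈ A.graph → (y, w - x) ∈ A.graph → C w = x ∧ D w = y := by
    intro x y w hx hy
    have h1 : (C w - x, D w - y) ∈ A.graph := A.graph.sub_mem (hCD w).1 hx
    have h2 : (D w - y, x - C w) ∈ A.graph := by
      have := A.graph.sub_mem (hCD w).2 hy
      simpa using this
    have h3 := hsym h1 h2
    have h4 : (0 : ℝ) = ‖D w - y‖ ^ 2 + ‖C w - x‖ ^ 2 := by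
      have h5 : ⟪D w - y, D w - y⟫ + ⟪C w - x, C w - x⟫ = 0 := by
        rw [h3, ← inner_add_right]
        simp
      rw [inner_self_eq_norm_sq_to_K, inner_self_eq_norm_sq_to_K] at h5
      have := congrArg Complex.re h5
      norm_cast at this
      exact this.symm
    have h6 : ‖C w - x‖ = 0 := by nlinarith [sq_nonneg ‖D w - y‖, sq_nonneg ‖C w - x‖]
    have h7 : ‖D w - y‖ = 0 := by nlinarith [sq_nonneg ‖D w - y‖, sq_nonneg ‖C w - x‖]
    exact ⟨sub_eq_zero.1 (norm_eq_zero.1 h6), sub_eq_zero.1 (norm_eq_zero.1 h7)⟩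
  -- elementary properties of `C` and `D`
  have hC : ∀ w z, ⟪C w, z⟫ = ⟪C w, C z⟫ + ⟪D w, D z⟫ := by
    intro w z
    rw [hsym (hCD w).1 (hCD z).2, inner_sub_right]
    abel
  have hCpos : 0 ≤ C := by
    rw [ContinuousLinearMap.nonneg_iff_isPositive, ContinuousLinearMap.isPositive_def]
    refine ⟨fun w z => ?_, fun w => ?_⟩
    · change ⟪C w, z⟫ = ⟪w, C z⟫
      rw [hC w z, ← inner_conj_symm w, hC z w, map_add, inner_conj_symm, inner_conj_symm]
    · rw [ContinuousLinearMap.reApplyInnerSelf_apply, hC, map_add]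
      exact add_nonneg inner_self_nonneg inner_self_nonneg
  have hDsa : IsSelfAdjoint D := by
    rw [ContinuousLinearMap.isSelfAdjoint_iff_isSymmetric]
    intro w z
    change ⟪D w, z⟫ = ⟪w, D z⟫
    have h1 := hsym (hCD w).2 (hCD z).1
    have h2 := hsym (hCD w).1 (hCD z).1
    have h3 := hsym (hCD w).2 (hCD z).2
    have h4 := hsym (hCD w).1 (hCD z).2
    rw [inner_sub_left] at h1 h3
    rw [inner_sub_right] at h3 h4
    have h5 : ⟪D w, z⟫ - ⟪D w, C z⟫ = ⟪w, D z⟫ - ⟪C w, D z⟫ := h3.symm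
    rw [h2] at h5
    exact sub_left_injective h5
  have hCinj : ∀ w, C w = 0 → w = 0 := by
    intro w hw
    have h1 := (hCD w).1
    rw [hw] at h1
    have h2 := A.graph_fst_eq_zero_snd h1 rfl
    have h3 := (hCD w).2
    rw [h2, hw, sub_zero] at h3
    exact A.graph_fst_eq_zero_snd h3 rfl
  have hCD2 : ∀ w, C (D w) = D (C w) ∧ D (D w) = C w - C (C w) := by
    intro w
    have h1 := (hCD (C w))
    refine huniq h1.2 ?_
    exact A.graph.sub_mem (hCD w).1 h1.1
  -- Here C = (1 + A²)⁻¹ and S = (1 + A²)^(-1/2); the bounded transform T = AS is obtained from D =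
  -- AC = TS by extension from the dense range of S.
  let S := CFC.sqrt C
  have hSsa : IsSelfAdjoint S := (CFC.sqrt_nonneg _).isSelfAdjoint
  have hSS : S * S = C := CFC.sqrt_mul_sqrt_self C hCpos
  have hSSv : ∀ v, S (S v) = C v := fun v => DFunLike.congr_fun hSS v
  have hSinj : ∀ v, S v = 0 → v = 0 := fun v hv => hCinj v (by rw [← hSSv, hv, map_zero])
  have hSsym : ∀ v w, ⟪S v, w⟫ = ⟪v, S w⟫ := hSsa.isSymmetric
  have hdense := denseRange_of_injective hSsa hSinj
  have hcomm : Commute D S := by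
    have : Commute C D := by
      ext w
      exact (hCD2 w).1
    have h := this.cfcₙ_nnreal NNReal.sqrt
    exact h.symm
  -- the extension `T` of `S u ↦ D u`
  have hnorm : ∀ u, ‖D u‖ ≤ 1 * ‖S u‖ := by
    intro u
    rw [one_mul, ← sq_le_sq₀ (norm_nonneg _) (norm_nonneg _)]
    have h1 : ⟪S u, S u⟫ = ⟪C u, C u⟫ + ⟪D u, D u⟫ := by
      rw [← hC, ← hSSv, hSsym (S u) u]
    have h2 := congrArg RCLike.re h1
    rw [map_add, inner_self_eq_norm_sq, inner_self_eq_norm_sq, inner_self_eq_norm_sq] at h2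
    nlinarith [sq_nonneg ‖C u‖]
  let T : K →L[ℂ] K := (D : K →ₗ[ℂ] K).extendOfNorm (S : K →ₗ[ℂ] K)
  have hTS : T * S = D := by
    ext u
    exact LinearMap.extendOfNorm_eq (f := (D : K →ₗ[ℂ] K)) (e := (S : K →ₗ[ℂ] K)) hdense
      ⟨1, hnorm⟩ u
  have hST : S * T = T * S := by
    refine mul_right_cancel_of_injective hSsa hSinj ?_
    rw [mul_assoc, hTS, ← hcomm.eq]
  have hTsa : IsSelfAdjoint T := by
    refine (mul_left_cancel_of_injective hSinj ?_ : star T = T)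
    have h1 := congrArg star hTS
    rw [star_mul, hSsa.star_eq, hDsa.star_eq] at h1
    rw [h1, hST, hTS]
  have hDD : D * D = C - C * C := by
    ext w
    exact (hCD2 w).2
  have hTT : T * T = 1 - S * S := by
    refine mul_right_cancel_of_injective hSsa hSinj (mul_right_cancel_of_injective hSsa hSinj ?_)
    have h1 : T * T * S * S = (T * S) * (T * S) := by
      simp only [mul_assoc]
      rw [← mul_assoc S T S, hST, mul_assoc]
    rw [h1, hTS, hDD, ← hSS]
    noncomm_ring
  have hTn : ‖T‖ ≤ 1 :=
    LinearMap.opNorm_extendOfNorm_le (f := (D : K →ₗ[ℂ] K)) (e := (S : K →ₗ[ℂ] K)) hdense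
      zero_le_one hnorm
  have hdef : defect T = S := by
    rw [defect, hTsa.star_eq, hTT, sub_sub_cancel]
    exact CFC.sqrt_mul_self S (CFC.sqrt_nonneg _)
  have hmem : ∀ v, (S v, T v) ∈ A.graph := by
    intro v
    have hcl : IsClosed {v | (S v, T v) ∈ A.graph} :=
      hA.isClosed.preimage (S.continuous.prodMk T.continuous)
    have : (univ : Set K) ⊆ {v | (S v, T v) ∈ A.graph} := by
      rw [← hdense.closure_range]
      refine closure_minimal ?_ hcl
      rintro _ ⟨u, rfl⟩
      have h1 := (hCD u).1
      rw [← hSSv, ← hTS] at h1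
      exact h1
    exact this (mem_univ v)
  refine ⟨T, hTsa, hTn, le_antisymm ?_ ?_⟩
  · rintro ⟨x, y⟩ hxy
    have hDy : D y = x - C x := by
      refine ext_inner_right ℂ fun w => ?_
      have h1 : ⟪D y, w⟫ = ⟪y, D w⟫ := hDsa.isSymmetric y w
      have h2 : ⟪C x, w⟫ = ⟪x, C w⟫ :=
        ((ContinuousLinearMap.nonneg_iff_isPositive C).1 hCpos).isSelfAdjoint.isSymmetric x w
      rw [h1, hsym hxy (hCD w).2, inner_sub_right, inner_sub_left, h2]
    -- With S² + T² = 1, the parameter of the point (x, y) = (Sv, Tv) can only be v = Sx + Ty.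
    have hx : S (S x + T y) = x := by
      have h1 : S (T y) = D y := by
        rw [← hTS, ← hST]; rfl
      rw [map_add, hSSv, h1, hDy]
      abel
    refine mem_transformGraph.2 ⟨S x + T y, ?_, ?_⟩
    · rw [hdef]; exact hx
    · have h1 := hmem (S x + T y)
      rw [hx] at h1
      exact hfun h1 hxy
  · rintro ⟨x, y⟩ hxy
    obtain ⟨v, hv, hv'⟩ := mem_transformGraph.1 hxy
    rw [hdef] at hv
    simp only at hv hv'
    rw [← hv, ← hv']
    exact hmem v

end SelfAdjoint

/-! ### Functional calculus in terms of the bounded transform -/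

/-- The homeomorphism `a ↦ a / √(1 + a²)` of the real line onto the interval `(-1, 1)`. -/
def toDisc (a : ℝ) : ℝ := a / √(1 + a ^ 2)

/-- The inverse `s ↦ s / √(1 - s²)` of `toDisc`. -/
def ofDisc (s : ℝ) : ℝ := s / √(1 - s ^ 2)

theorem toDisc_eq (a : ℝ) : toDisc a = Real.sin (Real.arctan a) := (Real.sin_arctan a).symm

theorem toDisc_lt_one (a : ℝ) : toDisc a < 1 := by
  rw [toDisc, div_lt_one (by positivity)]
  exact Real.lt_sqrt_of_sq_lt (by linarith)

theorem toDisc_neg (a : ℝ) : toDisc (-a) = -toDisc a := by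
  simp [toDisc, neg_div]

theorem neg_one_lt_toDisc (a : ℝ) : -1 < toDisc a := by
  have := toDisc_lt_one (-a)
  rw [toDisc_neg] at this
  linarith

/-- On the relevant ranges `toDisc` is sin ∘ arctan and `ofDisc` is tan ∘ arcsin, so the two are
mutually inverse increasing functions. -/
theorem toDisc_le_iff {a s : ℝ} (hs : s ∈ Ioo (-1) 1) : toDisc a ≤ s ↔ a ≤ ofDisc s := by
  rw [ofDisc, ← Real.tan_arcsin, toDisc_eq, ← Real.le_arcsin_iff_sin_le'
    ⟨Real.neg_pi_div_two_lt_arctan a, (Real.arctan_lt_pi_div_two a).le⟩]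
  have h : Real.arcsin s ∈ Ioo (-(Real.pi / 2)) (Real.pi / 2) :=
    ⟨Real.neg_pi_div_two_lt_arcsin.2 hs.1, Real.arcsin_lt_pi_div_two.2 hs.2⟩
  conv_lhs => rw [← Real.arctan_tan h.1 h.2]
  exact Real.arctan_strictMono.le_iff_le

theorem ofDisc_neg (s : ℝ) : ofDisc (-s) = -ofDisc s := by
  simp [ofDisc, neg_div]

theorem le_toDisc_iff {a s : ℝ} (hs : s ∈ Ioo (-1) 1) : s ≤ toDisc a ↔ ofDisc s ≤ a := by
  have := toDisc_le_iff (a := -a) (s := -s) ⟨by linarith [hs.2], by linarith [hs.1]⟩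
  rwa [toDisc_neg, ofDisc_neg, neg_le_neg_iff, neg_le_neg_iff] at this

theorem ofDisc_toDisc (a : ℝ) : ofDisc (toDisc a) = a :=
  le_antisymm ((le_toDisc_iff ⟨neg_one_lt_toDisc a, toDisc_lt_one a⟩).1 le_rfl)
    ((toDisc_le_iff ⟨neg_one_lt_toDisc a, toDisc_lt_one a⟩).1 le_rfl)

theorem toDisc_ofDisc {s : ℝ} (hs : s ∈ Ioo (-1) 1) : toDisc (ofDisc s) = s :=
  le_antisymm ((toDisc_le_iff hs).2 le_rfl) ((le_toDisc_iff hs).2 le_rfl)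

theorem toDisc_strictMono : StrictMono toDisc := by
  intro a b hab
  rw [toDisc_eq, toDisc_eq]
  exact Real.strictMonoOn_sin ⟨(Real.neg_pi_div_two_lt_arctan a).le,
    (Real.arctan_lt_pi_div_two a).le⟩ ⟨(Real.neg_pi_div_two_lt_arctan b).le,
    (Real.arctan_lt_pi_div_two b).le⟩ (Real.arctan_strictMono hab)

@[simp] theorem toDisc_zero : toDisc 0 = 0 := by simp [toDisc]

theorem toDisc_pos {a : ℝ} (ha : 0 < a) : 0 < toDisc a := by
  simpa using toDisc_strictMono ha

theorem continuous_toDisc : Continuous toDisc := by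
  unfold toDisc
  exact continuous_id.div (by fun_prop) fun x => by positivity

theorem one_sub_sq_pos {s : ℝ} (hs : s ∈ Ioo (-1) 1) : 0 < 1 - s ^ 2 := by
  nlinarith [hs.1, hs.2]

theorem continuousOn_ofDisc : ContinuousOn ofDisc (Ioo (-1) 1) := by
  unfold ofDisc
  exact continuousOn_id.div (by fun_prop) fun x hx => (Real.sqrt_pos.2 (one_sub_sq_pos hx)).ne'

/-- The function `s - z √(1 - s²)` vanishes only at `toDisc z`. -/
theorem sub_mul_sqrt_eq_zero_iff {z s : ℝ} (hs : s ∈ Icc (-1) 1) :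
    s - z * √(1 - s ^ 2) = 0 ↔ s = toDisc z := by
  by_cases hs' : s ∈ Ioo (-1 : ℝ) 1
  · have h := Real.sqrt_pos.2 (one_sub_sq_pos hs')
    rw [sub_eq_zero, ← div_eq_iff h.ne']
    exact ⟨fun h => by rw [← h]; exact (toDisc_ofDisc hs').symm,
      fun h => by rw [h]; exact ofDisc_toDisc z⟩
  · have h1 : s = -1 ∨ s = 1 := by
      by_contra hne
      rw [not_or] at hne
      exact hs' ⟨lt_of_le_of_ne hs.1 (Ne.symm hne.1), lt_of_le_of_ne hs.2 hne.2⟩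
    have h2 := toDisc_lt_one z
    have h3 := neg_one_lt_toDisc z
    rcases h1 with rfl | rfl
    · norm_num
      exact h3.ne
    · norm_num
      exact h2.ne'

/-- The indicator of a bounded interval vanishes near ±∞, so its compression vanishes at ±1 and
beyond. -/
theorem compress_indicator (a b : ℝ) :
    compress (indicator (Icc a b) 1) = indicator (Icc (toDisc a) (toDisc b)) 1 := by
  funext s
  have h1 : Tendsto (indicator (Icc a b) (1 : ℝ → ℝ)) atTop (𝓝 0) :=
    tendsto_const_nhds.congr' (by
      filter_upwards [eventually_gt_atTop b] with x hx
      rw [indicator_of_notMem fun h => absurd h.2 (not_le.2 hx)])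
  have h2 : Tendsto (indicator (Icc a b) (1 : ℝ → ℝ)) atBot (𝓝 0) :=
    tendsto_const_nhds.congr' (by
      filter_upwards [eventually_lt_atBot a] with x hx
      rw [indicator_of_notMem fun h => absurd h.1 (not_le.2 hx)])
  unfold compress
  split_ifs with h h'
  · rw [h1.limUnder_eq, indicator_of_notMem]
    intro hs
    linarith [hs.2, toDisc_lt_one b]
  · rw [h2.limUnder_eq, indicator_of_notMem]
    intro hs
    linarith [hs.1, neg_one_lt_toDisc a]
  · have hs : s ∈ Ioo (-1 : ℝ) 1 := ⟨not_le.1 h', not_le.1 h⟩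
    simp only [indicator_apply, mem_Icc, toDisc_le_iff hs, le_toDisc_iff hs]
    rfl

/-- A set missing both end points lies in the union of two disjoint open sets, the open interval and
the complement of the closed one. Because of this, continuous functional calculus suffices for all
spectral projections at end points off the spectrum. -/
theorem continuousOn_indicator_Icc {f : ℝ → ℝ} {Z : Set ℝ} {a b : ℝ}
    (hf : ContinuousOn f (Icc a b)) (ha : a ∉ Z) (hb : b ∉ Z) :
    ContinuousOn (indicator (Icc a b) f) Z := by
  have h : Z ⊆ Ioo a b ∪ (Icc a b)ᶜ := by
    intro x hx
    by_cases h : x ∈ Icc a b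
    · refine Or.inl ⟨lt_of_le_of_ne h.1 ?_, lt_of_le_of_ne h.2 ?_⟩
      · rintro rfl
        exact ha hx
      · rintro rfl
        exact hb hx
    · exact Or.inr h
  refine ContinuousOn.mono ?_ h
  refine ContinuousOn.union_of_isOpen ?_ ?_ isOpen_Ioo isClosed_Icc.isOpen_compl
  · exact (hf.mono Ioo_subset_Icc_self).congr fun x hx =>
      indicator_of_mem (Ioo_subset_Icc_self hx) f
  · exact (continuousOn_const (c := (0 : ℝ))).congr fun x hx => indicator_of_notMem hx f

section Operators

set_option linter.unusedSectionVars false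

variable {K : Type*} [NormedAddCommGroup K] [InnerProductSpace ℂ K] [CompleteSpace K]

/-- A bounded self-adjoint operator annihilated, after multiplication by it, by a polynomial. -/
theorem finite_spectrum_of_finiteDimensional_range (N : K →L[ℂ] K)
    [FiniteDimensional ℂ (LinearMap.range (N : K →ₗ[ℂ] K))] : (spectrum ℝ N).Finite := by
  let R := LinearMap.range (N : K →ₗ[ℂ] K)
  let n : R →ₗ[ℂ] R := (N : K →ₗ[ℂ] K).restrict (fun v _ => ⟨v, rfl⟩)
  -- N maps K to its range, where the characteristic polynomial of the restriction vanishes on N by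
  -- Cayley–Hamilton; the additional factor X performs that first map. The spectrum then lies among
  -- the roots.
  let p := n.charpoly * Polynomial.X
  have h0 : Polynomial.aeval N p = 0 := by
    rw [map_mul, Polynomial.aeval_X]
    have h1 : ∀ (q : Polynomial ℂ) (v : R), (Polynomial.aeval n q v : K) =
        Polynomial.aeval N q (v : K) := by
      intro q v
      induction q using Polynomial.induction_on generalizing v with
      | C a => simp [Polynomial.aeval_C, Algebra.algebraMap_eq_smul_one]
      | add p q hp hq => simp [hp, hq]
      | monomial k a h =>
        rw [pow_succ, ← mul_assoc]
        have e1 : ∀ q : Polynomial ℂ, Polynomial.aeval n (q * Polynomial.X) =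
          Polynomial.aeval n q * n := fun q => by rw [map_mul, Polynomial.aeval_X]
        have e2 : ∀ q : Polynomial ℂ, Polynomial.aeval N (q * Polynomial.X) =
          Polynomial.aeval N q * N := fun q => by rw [map_mul, Polynomial.aeval_X]
        rw [e1, e2]
        exact h (n v)
    ext v
    have h2 := h1 n.charpoly ⟨N v, v, rfl⟩
    rw [LinearMap.aeval_self_charpoly] at h2
    exact h2.symm
  have hp : p ≠ 0 := mul_ne_zero n.charpoly_monic.ne_zero Polynomial.X_ne_zero
  have h1 : (spectrum ℂ N).Finite := by
    refine (p.roots.toFinset.finite_toSet).subset fun z hz => ?_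
    have := spectrum.subset_polynomial_aeval N p ⟨z, hz, rfl⟩
    rw [h0] at this
    rcases subsingleton_or_nontrivial (K →L[ℂ] K) with h | h
    · rw [spectrum.of_subsingleton] at this
      exact absurd this (notMem_empty _)
    · rw [spectrum.zero_eq, mem_singleton_iff] at this
      simpa [hp] using this
  rw [← spectrum.preimage_algebraMap ℂ]
  exact h1.preimage (algebraMap ℝ ℂ).injective.injOn

theorem spectrum_subset_Icc {T : K →L[ℂ] K} (hT : ‖T‖ ≤ 1) : spectrum ℝ T ⊆ Icc (-1) 1 := by
  intro s hs
  rcases subsingleton_or_nontrivial K with h | h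
  · have : Subsingleton (K →L[ℂ] K) := inferInstance
    rw [spectrum.of_subsingleton] at hs
    exact absurd hs (notMem_empty _)
  · have := (spectrum.norm_le_norm_of_mem hs).trans hT
    rwa [Real.norm_eq_abs, abs_le] at this

theorem defect_eq_cfc {T : K →L[ℂ] K} (hT : ‖T‖ ≤ 1) (hsa : IsSelfAdjoint T) :
    defect T = cfc (fun s => √(1 - s ^ 2)) T := by
  refine CFC.sqrt_unique ?_ (cfc_nonneg fun _ _ => Real.sqrt_nonneg _)
  rw [← cfc_mul .., cfc_congr (g := fun s => 1 - s ^ 2) fun s hs => ?_, cfc_sub .., cfc_const .., map_one,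
    cfc_pow_id .., hsa.star_eq, sq]
  have := spectrum_subset_Icc hT hs
  exact Real.mul_self_sqrt (by nlinarith [this.1, this.2])

variable {A : K →ₗ.[ℂ] K} {T : K →L[ℂ] K}

theorem IsBoundedTransform.specProj_eq (h : IsBoundedTransform A T) (a b : ℝ) :
    specProj A a b = cfc (indicator (Icc (toDisc a) (toDisc b)) 1) T := by
  rw [specProj, funCalc, h.boundedTransform_eq, compress_indicator]

theorem IsBoundedTransform.mem_graph (h : IsBoundedTransform A T) (v : K) :
    (defect T v, T v) ∈ A.graph := by
  rw [h.2]
  exact mem_transformGraph.2 ⟨v, rfl, rfl⟩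

/-- `z` is in the spectrum of `A` if and only if `z / √(1 + z²)` is in the spectrum of the bounded
transform of `A`. -/
theorem IsBoundedTransform.mem_opSpectrum_iff (h : IsBoundedTransform A T)
    (hsa : IsSelfAdjoint T) (z : ℝ) : (z : ℂ) ∈ opSpectrum A ↔ toDisc z ∈ spectrum ℝ T := by
  have hmem : ∀ w, defect T w ∈ A.domain := fun w =>
    LinearPMap.mem_domain_of_mem_graph (h.mem_graph w)
  have hbij : Function.Bijective (fun w => (⟨defect T w, hmem w⟩ : A.domain)) := by
    constructor
    · intro w w' hw
      have : defect T (w - w') = 0 := by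
        rw [map_sub, sub_eq_zero]
        exact congrArg Subtype.val hw
      exact sub_eq_zero.1 (h.injective this)
    · rintro ⟨v, hv⟩
      have h1 : (v, A ⟨v, hv⟩) ∈ transformGraph T := by
        rw [← h.2]
        exact A.mem_graph ⟨v, hv⟩
      obtain ⟨w, hw, -⟩ := mem_transformGraph.1 h1
      exact ⟨w, Subtype.ext hw⟩
  have happ : ∀ w, A ⟨defect T w, hmem w⟩ = T w := fun w =>
    ((A.image_iff (hmem w)).2 (h.mem_graph w)).symm
  -- The defect operator is a bijection of K onto the domain of A, and carries A - z to the bounded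
  -- operator T - zD = f(T). Invertibility of the latter means that f has no zero on the spectrum of
  -- T.
  have h1 : (fun v : A.domain => A v - (z : ℂ) • (v : K)) ∘
      (fun w => (⟨defect T w, hmem w⟩ : A.domain)) =
      ⇑(cfc (fun s => s - z * √(1 - s ^ 2)) T) := by
    funext w
    have : cfc (fun s => s - z * √(1 - s ^ 2)) T = T - z • defect T := by
      rw [cfc_sub .., cfc_id' .., cfc_const_mul .., defect_eq_cfc h.1 hsa]
    rw [this]
    simp [happ]
  rw [opSpectrum, mem_ofPred_eq, ← hbij.of_comp_iff, h1, ← ContinuousLinearMap.isUnit_iff_bijective,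
    isUnit_cfc_iff ..]
  push Not
  constructor
  · rintro ⟨s, hs, hs'⟩
    rw [← (sub_mul_sqrt_eq_zero_iff (spectrum_subset_Icc h.1 hs)).1 hs']
    exact hs
  · intro hz
    exact ⟨_, hz, (sub_mul_sqrt_eq_zero_iff (spectrum_subset_Icc h.1 hz)).2 rfl⟩

end Operators

/-! ### Spectral projections -/

section Operators

set_option linter.unusedSectionVars false

variable {K : Type*} [NormedAddCommGroup K] [InnerProductSpace ℂ K] [CompleteSpace K]

theorem starProjection_range_eq {P : K →L[ℂ] K} (hP : IsStarProjection P) (V : Submodule ℂ K)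
    [V.HasOrthogonalProjection] (hV : V = LinearMap.range (P : K →ₗ[ℂ] K)) :
    V.starProjection = P := by
  subst hV
  obtain ⟨h, h'⟩ := isStarProjection_iff_eq_starProjection_range.1 hP
  exact h'.symm

theorem isOrtho_range {P Q : K →L[ℂ] K} (hP : IsSelfAdjoint P) (h : P * Q = 0) :
    LinearMap.range (P : K →ₗ[ℂ] K) ⟂ LinearMap.range (Q : K →ₗ[ℂ] K) := by
  rw [Submodule.isOrtho_iff_inner_eq]
  rintro _ ⟨v, rfl⟩ _ ⟨w, rfl⟩
  have h1 : inner ℂ (P v) (Q w) = inner ℂ v (P (Q w)) := hP.isSymmetric v (Q w)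
  have h2 : P (Q w) = 0 := DFunLike.congr_fun h w
  rw [h2, inner_zero_right] at h1
  exact h1

theorem range_mul_le (P Q : K →L[ℂ] K) :
    LinearMap.range ((P * Q : K →L[ℂ] K) : K →ₗ[ℂ] K) ≤ LinearMap.range (P : K →ₗ[ℂ] K) := by
  rintro _ ⟨v, rfl⟩
  exact ⟨Q v, rfl⟩

/-- The operator `A P_[-ε, ε](A)`. -/
def lowPart (A : K →ₗ.[ℂ] K) (ε : ℝ) : K →L[ℂ] K :=
  cfc (indicator (Icc (toDisc (-ε)) (toDisc ε)) ofDisc) (boundedTransform A)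

variable {A : K →ₗ.[ℂ] K} {T : K →L[ℂ] K}

theorem Icc_toDisc_subset (a b : ℝ) : Icc (toDisc a) (toDisc b) ⊆ Ioo (-1) 1 :=
  Icc_subset_Ioo (neg_one_lt_toDisc a) (toDisc_lt_one b)

section

variable (hT : IsBoundedTransform A T) (hsa : IsSelfAdjoint T)
include hT hsa

theorem continuousOn_window {a b : ℝ} (ha : (a : ℂ) ∉ opSpectrum A) (hb : (b : ℂ) ∉ opSpectrum A)
    {f : ℝ → ℝ} (hf : ContinuousOn f (Ioo (-1) 1)) :
    ContinuousOn (indicator (Icc (toDisc a) (toDisc b)) f) (spectrum ℝ T) := by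
  rw [hT.mem_opSpectrum_iff hsa] at ha hb
  exact continuousOn_indicator_Icc (hf.mono (Icc_toDisc_subset a b)) ha hb

theorem isStarProjection_specProj {a b : ℝ} (ha : (a : ℂ) ∉ opSpectrum A)
    (hb : (b : ℂ) ∉ opSpectrum A) : IsStarProjection (specProj A a b) := by
  have hc := continuousOn_window hT hsa ha hb (f := 1) continuousOn_const
  rw [hT.specProj_eq]
  refine ⟨?_, cfc_predicate _ _⟩
  rw [IsIdempotentElem, ← cfc_mul ..]
  congr 1
  funext s
  by_cases hs : s ∈ Icc (toDisc a) (toDisc b) <;> simp [hs]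

/-- Both intervals contain the common end point b, but it is off the spectrum, so nothing is counted
twice. -/
theorem specProj_add {a b c : ℝ} (hab : a ≤ b) (hbc : b ≤ c) (ha : (a : ℂ) ∉ opSpectrum A)
    (hb : (b : ℂ) ∉ opSpectrum A) (hc : (c : ℂ) ∉ opSpectrum A) :
    specProj A a b + specProj A b c = specProj A a c := by
  have h1 := continuousOn_window hT hsa ha hb (f := 1) continuousOn_const
  have h2 := continuousOn_window hT hsa hb hc (f := 1) continuousOn_const
  rw [hT.mem_opSpectrum_iff hsa] at hb
  rw [hT.specProj_eq, hT.specProj_eq, hT.specProj_eq, ← cfc_add ..]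
  refine cfc_congr fun s hs => ?_
  have hsb : s ≠ toDisc b := fun h => hb (h ▸ hs)
  have h3 := toDisc_strictMono.monotone hab
  have h4 := toDisc_strictMono.monotone hbc
  simp only [indicator_apply, mem_Icc, Pi.one_apply]
  rcases lt_or_gt_of_ne hsb with h | h
  · rw [if_neg (not_and_of_not_left (b := s ≤ toDisc c) (not_le.2 h)), add_zero]
    simp only [h.le, h.le.trans h4, and_true]
  · rw [if_neg (not_and_of_not_right (a := toDisc a ≤ s) (not_le.2 h)), zero_add]
    simp only [h.le, h3.trans h.le, true_and]

theorem specProj_mul_eq_zero {a b c d : ℝ} (hbc : b ≤ c) (ha : (a : ℂ) ∉ opSpectrum A)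
    (hb : (b : ℂ) ∉ opSpectrum A) (hc : (c : ℂ) ∉ opSpectrum A) (hd : (d : ℂ) ∉ opSpectrum A) :
    specProj A a b * specProj A c d = 0 := by
  have h1 := continuousOn_window hT hsa ha hb (f := 1) continuousOn_const
  have h2 := continuousOn_window hT hsa hc hd (f := 1) continuousOn_const
  rw [hT.mem_opSpectrum_iff hsa] at hb
  rw [hT.specProj_eq, hT.specProj_eq, ← cfc_mul .., ← cfc_zero ℝ T]
  refine cfc_congr fun s hs => ?_
  have hsb : s ≠ toDisc b := fun h => hb (h ▸ hs)
  have h4 := toDisc_strictMono.monotone hbc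
  simp only [indicator_apply, mem_Icc, Pi.one_apply, Pi.zero_apply]
  rcases lt_or_gt_of_ne hsb with h | h
  · rw [if_neg (not_and_of_not_left (b := s ≤ toDisc d) (not_le.2 (h.trans_le h4))), mul_zero]
  · rw [if_neg (not_and_of_not_right (a := toDisc a ≤ s) (not_le.2 h)), zero_mul]

theorem specProj_self {a : ℝ} (ha : (a : ℂ) ∉ opSpectrum A) : specProj A a a = 0 := by
  rw [hT.mem_opSpectrum_iff hsa] at ha
  rw [hT.specProj_eq, ← cfc_zero ℝ T]
  refine cfc_congr fun s hs => ?_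
  have hsb : s ≠ toDisc a := fun h => ha (h ▸ hs)
  simp [hsb]

/-- The operators `A P_[-ε, ε](A)` and `P_[-ε, ε](A)` determine the functions of `A` supported
in `[-ε, ε]`. -/
theorem cfc_window {ε a b : ℝ} (hε : (ε : ℂ) ∉ opSpectrum A)
    (hε' : ((-ε : ℝ) : ℂ) ∉ opSpectrum A) (ha : (a : ℂ) ∉ opSpectrum A)
    (hb : (b : ℂ) ∉ opSpectrum A) (ha0 : a ≠ 0) (hb0 : b ≠ 0) (hεa : -ε ≤ a) (hbε : b ≤ ε)
    {g : ℝ → ℝ} (hg : ContinuousOn g (Icc a b)) :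
    cfc (indicator (Icc (toDisc a) (toDisc b)) (g ∘ ofDisc)) T =
      specProj A (-ε) ε * cfc (indicator (Icc a b) g) (lowPart A ε) := by
  have h1 := continuousOn_window hT hsa hε' hε continuousOn_ofDisc
  have h2 := continuousOn_window hT hsa hε' hε (f := 1) continuousOn_const
  rw [hT.mem_opSpectrum_iff hsa] at ha hb
  have hsub : ∀ s, s ∈ Icc (toDisc a) (toDisc b) → s ∈ Icc (toDisc (-ε)) (toDisc ε) := fun s hs =>
    ⟨(toDisc_strictMono.monotone hεa).trans hs.1, hs.2.trans (toDisc_strictMono.monotone hbε)⟩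
  -- `lowPart` sends all spectrum outside the window to 0. So 0 may be spurious spectrum, and the
  -- end points a, b must be nonzero.
  have hspec : ∀ z, z ≠ 0 → toDisc z ∉ spectrum ℝ T →
      z ∉ indicator (Icc (toDisc (-ε)) (toDisc ε)) ofDisc '' spectrum ℝ T := by
    rintro z hz hz' ⟨s, hs, rfl⟩
    by_cases hs' : s ∈ Icc (toDisc (-ε)) (toDisc ε)
    · rw [indicator_of_mem hs', toDisc_ofDisc (Icc_toDisc_subset _ _ hs')] at hz'
      exact hz' hs
    · exact hz (indicator_of_notMem hs' _)
  -- The factor `specProj A (-ε) ε` in the formula removes the contribution of this spurious 0 when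
  -- 0 lies in [a, b].
  have h3 := continuousOn_indicator_Icc hg (hspec a ha0 ha) (hspec b hb0 hb)
  rw [hT.specProj_eq, lowPart, hT.boundedTransform_eq, ← cfc_comp .., ← cfc_mul (hf := h2)
    (hg := h3.comp h1 (mapsTo_image _ _))]
  congr 1
  funext s
  by_cases hs : s ∈ Icc (toDisc (-ε)) (toDisc ε)
  · have h4 : s ∈ Icc (toDisc a) (toDisc b) ↔ ofDisc s ∈ Icc a b := by
      rw [mem_Icc, mem_Icc, toDisc_le_iff (Icc_toDisc_subset _ _ hs),
        le_toDisc_iff (Icc_toDisc_subset _ _ hs)]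
    simp only [Function.comp_apply, indicator_of_mem hs, Pi.one_apply, one_mul]
    by_cases h5 : s ∈ Icc (toDisc a) (toDisc b)
    · rw [indicator_of_mem h5, indicator_of_mem (h4.1 h5)]
      rfl
    · rw [indicator_of_notMem h5, indicator_of_notMem fun h => h5 (h4.2 h)]
  · rw [indicator_of_notMem fun h => hs (hsub s h), indicator_of_notMem hs, zero_mul]

/-- Inside the window the truncated function is the identity on the spectrum of A, and outside it is
0; so the nonzero spectrum of the bounded operator `lowPart` records that of A in the window. -/
theorem mem_spectrum_lowPart_iff {ε z : ℝ} (hε : (ε : ℂ) ∉ opSpectrum A)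
    (hε' : ((-ε : ℝ) : ℂ) ∉ opSpectrum A) (hz0 : z ≠ 0) (hz : -ε ≤ z) (hz' : z ≤ ε) :
    z ∈ spectrum ℝ (lowPart A ε) ↔ (z : ℂ) ∈ opSpectrum A := by
  have h1 := continuousOn_window hT hsa hε' hε continuousOn_ofDisc
  rw [lowPart, hT.boundedTransform_eq, cfc_map_spectrum .., hT.mem_opSpectrum_iff hsa]
  constructor
  · rintro ⟨s, hs, rfl⟩
    by_cases hs' : s ∈ Icc (toDisc (-ε)) (toDisc ε)
    · rw [indicator_of_mem hs', toDisc_ofDisc (Icc_toDisc_subset _ _ hs')]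
      exact hs
    · exact absurd (indicator_of_notMem hs' _) hz0
  · intro h
    refine ⟨_, h, ?_⟩
    rw [indicator_of_mem, ofDisc_toDisc]
    exact ⟨toDisc_strictMono.monotone hz, toDisc_strictMono.monotone hz'⟩

theorem specProj_eq_lowPart {ε a b : ℝ} (hε : (ε : ℂ) ∉ opSpectrum A)
    (hε' : ((-ε : ℝ) : ℂ) ∉ opSpectrum A) (ha : (a : ℂ) ∉ opSpectrum A)
    (hb : (b : ℂ) ∉ opSpectrum A) (ha0 : a ≠ 0) (hb0 : b ≠ 0) (hεa : -ε ≤ a) (hbε : b ≤ ε) :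
    specProj A a b =
      specProj A (-ε) ε * cfc (indicator (Icc a b) 1) (lowPart A ε) := by
  rw [← cfc_window hT hsa hε hε' ha hb ha0 hb0 hεa hbε (g := 1) continuousOn_const,
    hT.specProj_eq]
  rfl

theorem lowPart_eq_lowPart {ε δ : ℝ} (hε : (ε : ℂ) ∉ opSpectrum A)
    (hε' : ((-ε : ℝ) : ℂ) ∉ opSpectrum A) (hδ : (δ : ℂ) ∉ opSpectrum A)
    (hδ' : ((-δ : ℝ) : ℂ) ∉ opSpectrum A) (h0 : 0 < δ) (hle : δ ≤ ε) :
    lowPart A δ =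
      specProj A (-ε) ε * cfc (indicator (Icc (-δ) δ) id) (lowPart A ε) := by
  rw [← cfc_window hT hsa hε hε' hδ' hδ (neg_ne_zero.2 h0.ne') h0.ne' (neg_le_neg hle) hle
    (g := id) continuousOn_id, lowPart, hT.boundedTransform_eq]
  rfl

theorem specProj_mul_lowPart {ε : ℝ} (hε : (ε : ℂ) ∉ opSpectrum A)
    (hε' : ((-ε : ℝ) : ℂ) ∉ opSpectrum A) :
    specProj A (-ε) ε * lowPart A ε = lowPart A ε := by
  have h1 := continuousOn_window hT hsa hε' hε continuousOn_ofDisc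
  have h2 := continuousOn_window hT hsa hε' hε (f := 1) continuousOn_const
  rw [hT.specProj_eq, lowPart, hT.boundedTransform_eq, ← cfc_mul ..]
  congr 1
  funext s
  by_cases hs : s ∈ Icc (toDisc (-ε)) (toDisc ε) <;> simp [hs]

/-- The operator `R` with `P_[-ε, ε](A) = √(1 - T²) R`. -/
theorem exists_defect_mul_eq {ε : ℝ} (hε : (ε : ℂ) ∉ opSpectrum A)
    (hε' : ((-ε : ℝ) : ℂ) ∉ opSpectrum A) :
    ∃ g : ℝ → ℝ, ContinuousOn g (spectrum ℝ T) ∧ defect T * cfc g T = specProj A (-ε) ε ∧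
      T * cfc g T = lowPart A ε := by
  have hc : ContinuousOn (fun s : ℝ => (√(1 - s ^ 2))⁻¹) (Ioo (-1) 1) :=
    ContinuousOn.inv₀ (by fun_prop) fun x hx => (Real.sqrt_pos.2 (one_sub_sq_pos hx)).ne'
  have h1 := continuousOn_window hT hsa hε' hε hc
  refine ⟨_, h1, ?_, ?_⟩
  · rw [hT.specProj_eq, defect_eq_cfc hT.1 hsa, ← cfc_mul ..]
    congr 1
    funext s
    by_cases hs : s ∈ Icc (toDisc (-ε)) (toDisc ε)
    · rw [indicator_of_mem hs, indicator_of_mem hs, mul_inv_cancel₀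
        (Real.sqrt_pos.2 (one_sub_sq_pos (Icc_toDisc_subset _ _ hs))).ne', Pi.one_apply]
    · rw [indicator_of_notMem hs, indicator_of_notMem hs, mul_zero]
  · rw [lowPart, hT.boundedTransform_eq]
    conv_lhs => rw [← cfc_id' ℝ T, cfc_id' ℝ T]
    nth_rw 1 [← cfc_id' ℝ T]
    rw [← cfc_mul ..]
    congr 1
    funext s
    by_cases hs : s ∈ Icc (toDisc (-ε)) (toDisc ε)
    · rw [indicator_of_mem hs, indicator_of_mem hs, ofDisc, div_eq_mul_inv]
    · rw [indicator_of_notMem hs, indicator_of_notMem hs, mul_zero]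

theorem lowPart_mem_graph {ε : ℝ} (hε : (ε : ℂ) ∉ opSpectrum A)
    (hε' : ((-ε : ℝ) : ℂ) ∉ opSpectrum A) (v : K) :
    (specProj A (-ε) ε v, lowPart A ε v) ∈ A.graph := by
  obtain ⟨g, -, h1, h2⟩ := exists_defect_mul_eq hT hsa hε hε'
  rw [← h1, ← h2]
  exact hT.mem_graph (cfc g T v)

end

/-- An operator is single valued. The lemma identifies the continuous field supplied by the
definition of an adapted pair with the explicit field `lowPart` or `lowPolar`. -/
theorem eq_of_mem_graph {B : K →ₗ.[ℂ] K} {P N N' : K →L[ℂ] K} (h : ∀ v, (P v, N v) ∈ B.graph)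
    (h' : ∀ v, (P v, N' v) ∈ B.graph) : N = N' := by
  ext v
  have := B.graph.sub_mem (h v) (h' v)
  exact sub_eq_zero.1 (B.graph_fst_eq_zero_snd this (sub_self _))

end Operators

/-! ### Operators with normal bounded transform -/

/-- The absolute values of the nonzero elements form a finite, hence closed, set not containing 0.
Halving the radius makes the inequalities strict. -/
theorem exists_gap {F : Set ℝ} (hF : F.Finite) {η : ℝ} (hη : 0 < η) :
    ∃ δ, 0 < δ ∧ δ < η ∧ ∀ u ∈ F, u ≠ 0 → δ < |u| := by
  have h1 : (((fun u : ℝ => |u|) '' F) \ {0})ᶜ ∈ 𝓝 (0 : ℝ) :=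
    ((hF.image _).subset sdiff_subset).isClosed.isOpen_compl.mem_nhds (by simp)
  obtain ⟨r, hr, h2⟩ := Metric.mem_nhds_iff.1 h1
  refine ⟨min (r / 2) (η / 2), by positivity, (min_le_right _ _).trans_lt (by linarith), ?_⟩
  intro u hu hu0
  by_contra! h
  have h3 : |u| ∈ Metric.ball (0 : ℝ) r := by
    rw [mem_ball_zero_iff, Real.norm_eq_abs, abs_abs]
    exact (h.trans (min_le_left _ _)).trans_lt (by linarith)
  exact h2 h3 ⟨⟨u, hu, rfl⟩, by simpa using hu0⟩

section Operators

set_option linter.unusedSectionVars false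

variable {K : Type*} [NormedAddCommGroup K] [InnerProductSpace ℂ K] [CompleteSpace K]

variable {B : K →ₗ.[ℂ] K} {b : K →L[ℂ] K}

theorem isSelfAdjoint_abs (b : K →L[ℂ] K) : IsSelfAdjoint (CFC.abs b) :=
  (CFC.abs_nonneg b).isSelfAdjoint

theorem defect_abs (b : K →L[ℂ] K) : defect (CFC.abs b) = defect b :=
  defect_eq_of_star_mul_self_eq (by
    rw [(isSelfAdjoint_abs b).star_eq, CFC.abs_mul_abs])

theorem spectrum_abs_nonneg {s : ℝ} (hs : s ∈ spectrum ℝ (CFC.abs b)) : 0 ≤ s :=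
  spectrum_nonneg_of_nonneg (CFC.abs_nonneg b) hs

theorem abs_apply_eq_zero {v : K} (h : b v = 0) : CFC.abs b v = 0 := by
  have h1 : CFC.abs b (CFC.abs b v) = star b (b v) := DFunLike.congr_fun (CFC.abs_mul_abs b) v
  rw [h, map_zero] at h1
  have h2 : inner ℂ (CFC.abs b v) (CFC.abs b v) = inner ℂ v (CFC.abs b (CFC.abs b v)) :=
    (isSelfAdjoint_abs b).isSymmetric v _
  rw [h1, inner_zero_right] at h2
  exact inner_self_eq_zero.1 h2

section

variable (hB : IsBoundedTransform B b)
include hB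

theorem absOp_neg_notMem {ε : ℝ} (h0 : 0 < ε) : ((-ε : ℝ) : ℂ) ∉ opSpectrum (absOp B) := by
  rw [hB.absOp.mem_opSpectrum_iff (isSelfAdjoint_abs b)]
  intro h
  have := spectrum_abs_nonneg h
  rw [toDisc_neg] at this
  linarith [toDisc_pos h0]

/-- The number 0 may be in the spectrum of |B|, but no negative number is. Moving the lower end
point below 0 makes the lemmas on windows applicable without changing the projection. -/
theorem absOp_specProj_neg {c : ℝ} (hc : 0 ≤ c) (a : ℝ) :
    specProj (absOp B) (-c) a = specProj (absOp B) 0 a := by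
  rw [hB.absOp.specProj_eq, hB.absOp.specProj_eq]
  refine cfc_congr fun s hs => ?_
  have h0 := spectrum_abs_nonneg hs
  have h1 : toDisc (-c) ≤ s :=
    le_trans (by simpa using toDisc_strictMono.monotone (neg_nonpos.2 hc)) h0
  simp only [indicator_apply, mem_Icc, h1, toDisc_zero, h0]

theorem absOp_specProj_add {a c : ℝ} (ha0 : 0 < a) (hac : a ≤ c)
    (ha : (a : ℂ) ∉ opSpectrum (absOp B)) (hc : (c : ℂ) ∉ opSpectrum (absOp B)) :
    specProj (absOp B) 0 a + specProj (absOp B) a c = specProj (absOp B) 0 c := by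
  rw [← absOp_specProj_neg hB zero_le_one, ← absOp_specProj_neg hB zero_le_one]
  exact specProj_add hB.absOp (isSelfAdjoint_abs b) (by linarith) hac
    (absOp_neg_notMem hB one_pos) ha hc

theorem isStarProjection_absOp {a : ℝ} (ha : (a : ℂ) ∉ opSpectrum (absOp B)) :
    IsStarProjection (specProj (absOp B) 0 a) := by
  rw [← absOp_specProj_neg hB zero_le_one]
  exact isStarProjection_specProj hB.absOp (isSelfAdjoint_abs b) (absOp_neg_notMem hB one_pos) ha

/-- For normal b the absolute values of b and b* coincide, so both subspaces of an index object are
equal. -/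
theorem absOp_adjoint (hn : IsStarNormal b) : absOp B† = absOp B := by
  refine LinearPMap.eq_of_eq_graph ?_
  rw [hB.absOp.2, (hB.adjoint hn).absOp.2, CFC.abs_star b]

theorem finite_spectrum_lowPart {ε : ℝ} (h0 : 0 < ε) (hε : (ε : ℂ) ∉ opSpectrum (absOp B))
    (hfin : FiniteDimensional ℂ (specIm (absOp B) 0 ε)) :
    (spectrum ℝ (lowPart (absOp B) ε)).Finite := by
  have : FiniteDimensional ℂ (LinearMap.range (lowPart (absOp B) ε : K →ₗ[ℂ] K)) := by
    rw [← specProj_mul_lowPart hB.absOp (isSelfAdjoint_abs b) hε (absOp_neg_notMem hB h0),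
      absOp_specProj_neg hB h0.le]
    have : FiniteDimensional ℂ (LinearMap.range (specProj (absOp B) 0 ε : K →ₗ[ℂ] K)) := hfin
    exact Submodule.finiteDimensional_of_le (range_mul_le _ _)
  exact finite_spectrum_of_finiteDimensional_range _

/-- Below ε the nonzero spectrum of |B| is that of a finite rank operator, hence finite, and does
not accumulate at 0. -/
theorem exists_spectral_gap {ε : ℝ} (h0 : 0 < ε) (hε : (ε : ℂ) ∉ opSpectrum (absOp B))
    (hfin : FiniteDimensional ℂ (specIm (absOp B) 0 ε)) :
    ∃ δ, 0 < δ ∧ ∀ s ∈ spectrum ℝ (CFC.abs b), s ≠ 0 → δ < s := by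
  obtain ⟨δ, hδ0, hδε, hδ⟩ := exists_gap (finite_spectrum_lowPart hB h0 hε hfin) h0
  refine ⟨toDisc δ, toDisc_pos hδ0, fun s hs hs0 => ?_⟩
  by_contra! h
  have hs1 : 0 < s := lt_of_le_of_ne (spectrum_abs_nonneg hs) hs0.symm
  have hmem : s ∈ Ioo (-1 : ℝ) 1 := ⟨by linarith, h.trans_lt (toDisc_lt_one δ)⟩
  have h1 : toDisc (ofDisc s) = s := toDisc_ofDisc hmem
  have h2 : ofDisc s ≤ δ := (le_toDisc_iff hmem).1 h
  have h3 : 0 < ofDisc s := div_pos hs1 (Real.sqrt_pos.2 (one_sub_sq_pos hmem))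
  have h4 := (mem_spectrum_lowPart_iff hB.absOp (isSelfAdjoint_abs b) hε (absOp_neg_notMem hB h0)
    h3.ne' (by linarith) (by linarith : ofDisc s ≤ ε)).2
    ((hB.absOp.mem_opSpectrum_iff (isSelfAdjoint_abs b) _).2 (by rwa [h1]))
  have h5 := hδ _ h4 h3.ne'
  rw [abs_of_pos h3] at h5
  linarith

end

/-- The upper end point 2 is only a number above the norm bound 1; the lower one lies in the
spectral gap. -/
theorem continuousOn_indicator_inv {δ : ℝ} (hδ : 0 < δ)
    (h : ∀ s ∈ spectrum ℝ (CFC.abs b), s ≠ 0 → δ < s) (hb : ‖b‖ ≤ 1) :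
    ContinuousOn (indicator (Icc δ 2) fun s : ℝ => s⁻¹) (spectrum ℝ (CFC.abs b)) := by
  refine continuousOn_indicator_Icc (ContinuousOn.inv₀ continuousOn_id fun s hs => ?_)
    (fun hs => (h δ hs hδ.ne').false) fun hs => ?_
  · exact (hδ.trans_le hs.1).ne'
  · have := (spectrum_subset_Icc (CFC.norm_abs.trans_le hb) hs).2
    norm_num at this

/-- A pseudoinverse of the absolute value. -/
theorem exists_abs_mul_mul_abs {δ : ℝ} (hδ : 0 < δ)
    (h : ∀ s ∈ spectrum ℝ (CFC.abs b), s ≠ 0 → δ < s) (hb : ‖b‖ ≤ 1) :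
    ∃ k : K →L[ℂ] K, IsSelfAdjoint k ∧ Commute (CFC.abs b) k ∧
      CFC.abs b * k * CFC.abs b = CFC.abs b := by
  have hc := continuousOn_indicator_inv hδ h hb
  have hsub := spectrum_subset_Icc (CFC.norm_abs.trans_le hb)
  have hsk : ∀ s ∈ spectrum ℝ (CFC.abs b), s * (indicator (Icc δ 2) fun s : ℝ => s⁻¹) s * s = s := by
    intro s hs
    rcases eq_or_ne s 0 with rfl | h0
    · simp
    · have hsm : s ∈ Icc δ 2 := ⟨(h s hs h0).le, by linarith [(hsub hs).2]⟩
      rw [indicator_of_mem hsm, mul_inv_cancel₀ h0, one_mul]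
  refine ⟨cfc (indicator (Icc δ 2) fun s : ℝ => s⁻¹) (CFC.abs b), cfc_predicate _ _,
    ((Commute.refl (CFC.abs b)).cfc_real _).symm, ?_⟩
  have h1 : cfc (fun s : ℝ => s * (indicator (Icc δ 2) fun s : ℝ => s⁻¹) s * s) (CFC.abs b) =
      CFC.abs b * cfc (indicator (Icc δ 2) fun s : ℝ => s⁻¹) (CFC.abs b) * CFC.abs b := by
    rw [cfc_mul .., cfc_mul .., cfc_id' ..]
  rw [← h1, cfc_congr (g := fun s => s) hsk, cfc_id' ..]

theorem commute_defect (hb : ‖b‖ ≤ 1) (hn : IsStarNormal b) : Commute b (defect b) := by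
  have h2 := (CFC.commute_abs_self b hn).cfc_real (fun s : ℝ => √(1 - s ^ 2))
  rw [← defect_eq_cfc (CFC.norm_abs.trans_le hb) (isSelfAdjoint_abs b), defect_abs] at h2
  exact h2.symm

/-- Existence of the polar decomposition of a normal operator such that zero is not an accumulation
point of the spectrum of its absolute value. -/
theorem exists_isPolarPart (hB : IsBoundedTransform B b) (hn : IsStarNormal b) {δ : ℝ}
    (hδ : 0 < δ) (h : ∀ s ∈ spectrum ℝ (CFC.abs b), s ≠ 0 → δ < s) : ∃ U, IsPolarPart B U := by
  -- The partial isometry is bk, where k is inverse to |b| off the kernel and zero on it. Its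
  -- initial projection is |b|k, and bk|b| = b.
  obtain ⟨k, hksa, hkc, habs⟩ := exists_abs_mul_mul_abs hδ h hB.1
  have hbb : CFC.abs b * CFC.abs b = star b * b := CFC.abs_mul_abs b
  have hU : star (b * k) * (b * k) = CFC.abs b * k := by
    rw [star_mul, hksa.star_eq, mul_assoc, ← mul_assoc (star b), ← hbb, mul_assoc, hkc.eq,
      ← mul_assoc (CFC.abs b) k, habs]
  have hbk : b * k * CFC.abs b = b := by
    have h1 : star (b * k * CFC.abs b - b) * (b * k * CFC.abs b - b) = 0 := by
      have h2 : star (b * k * CFC.abs b - b) =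
          (CFC.abs b * k - 1) * star b := by
        rw [star_sub, star_mul, star_mul, hksa.star_eq, (isSelfAdjoint_abs b).star_eq, sub_mul,
          one_mul, mul_assoc]
      have h3 : b * k * CFC.abs b - b = b * (k * CFC.abs b - 1) := by
        rw [mul_sub, mul_one, mul_assoc]
      rw [h2, h3, mul_assoc, ← mul_assoc (star b), ← hbb, mul_sub, mul_one, mul_assoc (CFC.abs b)
        (CFC.abs b), ← mul_assoc (CFC.abs b) k, habs, sub_self, mul_zero]
    exact sub_eq_zero.1 ((CStarRing.star_mul_self_eq_zero_iff _).1 h1)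
  have hcb := commute_defect hB.1 hn
  refine ⟨b * k, ?_, ?_, ?_⟩
  · rw [mul_assoc, hU, ← mul_assoc, hbk]
  · refine LinearPMap.eq_of_eq_graph ?_
    ext ⟨x, y⟩
    rw [hB.2, mem_transformGraph]
    have h1 : ∀ w, (b * k) (CFC.abs b w) = b w := fun w => DFunLike.congr_fun hbk w
    constructor
    · rintro ⟨w, rfl, rfl⟩
      have h2 : (defect b w, CFC.abs b w) ∈ (absOp B).graph := by
        rw [← defect_abs]
        exact hB.absOp.mem_graph w
      rw [LinearPMap.mem_graph_iff] at h2 ⊢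
      obtain ⟨z, hz, hz'⟩ := h2
      exact ⟨z, hz, (congrArg (b * k) hz').trans (h1 w)⟩
    · intro hxy
      rw [LinearPMap.mem_graph_iff] at hxy
      obtain ⟨z, hz, hz'⟩ := hxy
      have h2 := (absOp B).mem_graph z
      rw [hB.absOp.2, mem_transformGraph] at h2
      obtain ⟨w, hw, hw'⟩ := h2
      refine ⟨w, ?_, ?_⟩
      · rw [← defect_abs]
        exact hw.trans hz
      · rw [← h1, hw']
        exact hz'
  · have hker : ∀ v, (b * k) v = 0 ↔ b v = 0 := by
      intro v
      constructor
      · intro hv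
        have h1 := DFunLike.congr_fun hU v
        have h2 : CFC.abs b (k v) = 0 := by
          have h3 : star (b * k) ((b * k) v) = CFC.abs b (k v) := h1
          rw [← h3, hv, map_zero]
        have h4 : CFC.abs b v = 0 := by
          have h5 : CFC.abs b (k (CFC.abs b v)) = CFC.abs b v := DFunLike.congr_fun habs v
          have h6 : CFC.abs b (k v) = k (CFC.abs b v) := DFunLike.congr_fun hkc.eq v
          rw [← h5, ← h6, h2, map_zero]
        have h7 : (b * k) (CFC.abs b v) = b v := DFunLike.congr_fun hbk v
        rw [← h7, h4, map_zero]
      · intro hv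
        have h6 : CFC.abs b (k v) = k (CFC.abs b v) := DFunLike.congr_fun hkc.eq v
        rw [abs_apply_eq_zero hv, map_zero] at h6
        have h8 : (b * k) v = (b * k) (CFC.abs b (k v)) := by
          have h9 : b * k = b * k * CFC.abs b * k := by rw [hbk]
          exact DFunLike.congr_fun h9 v
        rw [h8, h6, map_zero]
    ext v
    rw [LinearMap.mem_ker]
    refine (hker v).trans ?_
    simp only [Submodule.mem_map, LinearMap.mem_ker, Submodule.subtype_apply]
    have hbd : ∀ w, b (defect b w) = defect b (b w) := fun w => DFunLike.congr_fun hcb.eq w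
    constructor
    · intro hv
      have h1 := hB.mem_graph (defect b v)
      rw [defect_defect hB.1, hbd, hv, map_zero, map_zero, sub_zero] at h1
      obtain ⟨z, hz, hz'⟩ := (LinearPMap.mem_graph_iff _).1 h1
      exact ⟨z, hz', hz⟩
    · rintro ⟨z, hz, rfl⟩
      have h1 := B.mem_graph z
      rw [hB.2, mem_transformGraph] at h1
      obtain ⟨w, hw, hw'⟩ := h1
      simp only at hw hw'
      have h2 : b w = 0 := hw'.trans hz
      rw [← hw, hbd, h2, map_zero]

/-- B and |B| have the same defect operator, so B = U|B| can be compared at a common parameter w.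
This is the only property of the chosen polar part used in computing index morphisms. -/
theorem IsPolarPart.mul_abs {U : K →L[ℂ] K} (hU : IsPolarPart B U) (hB : IsBoundedTransform B b) :
    U * CFC.abs b = b := by
  ext w
  have h1 : (defect b w, CFC.abs b w) ∈ (absOp B).graph := by
    rw [← defect_abs]
    exact hB.absOp.mem_graph w
  obtain ⟨z, hz, hz'⟩ := (LinearPMap.mem_graph_iff _).1 h1
  have h2 : (defect b w, U (CFC.abs b w)) ∈ B.graph := by
    rw [hU.2.1, LinearPMap.mem_graph_iff]
    exact ⟨z, hz, congrArg U hz'⟩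
  have h3 := B.graph.sub_mem h2 (hB.mem_graph w)
  exact sub_eq_zero.1 (B.graph_fst_eq_zero_snd h3 (sub_self _))

end Operators

/-! ### Enhanced operators with normal bounded transform -/

section Operators

set_option linter.unusedSectionVars false

variable {K : Type*} [NormedAddCommGroup K] [InnerProductSpace ℂ K] [CompleteSpace K]

/-- `(B, ε)` satisfies the conditions on enhanced operators except for the Fredholm property, and
`B` has the normal bounded transform `b`. -/
structure IsNormalEnhanced (B : K →ₗ.[ℂ] K) (b : K →L[ℂ] K) (ε : ℝ) : Prop where
  transform : IsBoundedTransform B b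
  normal : IsStarNormal b
  pos : 0 < ε
  notMem : (ε : ℂ) ∉ opSpectrum (absOp B)
  finite : FiniteDimensional ℂ (specIm (absOp B) 0 ε)

/-- The operator `B P_[0, ε](|B|)`. -/
def lowPolar (B : K →ₗ.[ℂ] K) (ε : ℝ) : K →L[ℂ] K := polarPart B * lowPart (absOp B) ε

variable {B : K →ₗ.[ℂ] K} {b : K →L[ℂ] K} {ε : ℝ}

theorem self_mul_star_eq (hn : IsStarNormal b) : b * star b = CFC.abs b * CFC.abs b := by
  rw [CFC.abs_mul_abs, hn.star_comm_self.eq]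

namespace IsNormalEnhanced

variable (h : IsNormalEnhanced B b ε)
include h

theorem neg_notMem : ((-ε : ℝ) : ℂ) ∉ opSpectrum (absOp B) := absOp_neg_notMem h.transform h.pos

theorem polarPart_mul_abs : polarPart B * CFC.abs b = b := by
  obtain ⟨δ, hδ0, hδ⟩ := exists_spectral_gap h.transform h.pos h.notMem h.finite
  exact IsPolarPart.mul_abs
    (Classical.epsilon_spec (exists_isPolarPart h.transform h.normal hδ0 hδ)) h.transform

/-- The complementary projection factors through the absolute value. -/
theorem exists_one_sub_specProj : ∃ g : ℝ → ℝ,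
    1 - specProj (absOp B) 0 ε = CFC.abs b * cfc g (CFC.abs b) ∧
    1 - specProj (absOp B) 0 ε = CFC.abs b * CFC.abs b *
      (cfc g (CFC.abs b) * cfc g (CFC.abs b)) := by
  have hsub := spectrum_subset_Icc (CFC.norm_abs.trans_le h.transform.1)
  have hε := h.notMem
  rw [h.transform.absOp.mem_opSpectrum_iff (isSelfAdjoint_abs b)] at hε
  have h2 : (2 : ℝ) ∉ spectrum ℝ (CFC.abs b) := fun hs => by
    have := (hsub hs).2
    norm_num at this
  have hc : ContinuousOn (indicator (Icc (toDisc ε) 2) fun s : ℝ => s⁻¹)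
      (spectrum ℝ (CFC.abs b)) :=
    continuousOn_indicator_Icc (ContinuousOn.inv₀ continuousOn_id fun s hs =>
      ((toDisc_pos h.pos).trans_le hs.1).ne') hε h2
  have hc1 : ContinuousOn (indicator (Icc (toDisc (-ε)) (toDisc ε)) (1 : ℝ → ℝ))
      (spectrum ℝ (CFC.abs b)) :=
    continuousOn_window h.transform.absOp (isSelfAdjoint_abs b) h.neg_notMem h.notMem
      continuousOn_const
  have key : ∀ s ∈ spectrum ℝ (CFC.abs b),
      (1 - (indicator (Icc (toDisc (-ε)) (toDisc ε)) (1 : ℝ → ℝ)) s =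
        s * (indicator (Icc (toDisc ε) 2) fun s : ℝ => s⁻¹) s) ∧
      (1 - (indicator (Icc (toDisc (-ε)) (toDisc ε)) (1 : ℝ → ℝ)) s =
        s * s * ((indicator (Icc (toDisc ε) 2) fun s : ℝ => s⁻¹) s *
          (indicator (Icc (toDisc ε) 2) fun s : ℝ => s⁻¹) s)) := by
    intro s hs
    have hs0 := spectrum_abs_nonneg hs
    have hne : s ≠ toDisc ε := fun hs' => hε (hs' ▸ hs)
    have hp := toDisc_pos h.pos
    rcases lt_or_gt_of_ne hne with hlt | hlt
    · have h3 : s ∈ Icc (toDisc (-ε)) (toDisc ε) := ⟨by rw [toDisc_neg]; linarith, hlt.le⟩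
      have h4 : s ∉ Icc (toDisc ε) 2 := fun h5 => absurd h5.1 (not_le.2 hlt)
      simp [h3, h4]
    · have h3 : s ∉ Icc (toDisc (-ε)) (toDisc ε) := fun h5 => absurd h5.2 (not_le.2 hlt)
      have h4 : s ∈ Icc (toDisc ε) 2 := ⟨hlt.le, by linarith [(hsub hs).2]⟩
      have h5 : s ≠ 0 := (hp.trans hlt).ne'
      simp only [indicator_of_notMem h3, indicator_of_mem h4]
      constructor <;> field_simp <;> simp
  have h1 : 1 - specProj (absOp B) 0 ε = cfc (fun s =>
      1 - (indicator (Icc (toDisc (-ε)) (toDisc ε)) (1 : ℝ → ℝ)) s) (CFC.abs b) := by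
    rw [cfc_sub .., cfc_const .., map_one, ← absOp_specProj_neg h.transform h.pos.le,
      h.transform.absOp.specProj_eq]
  refine ⟨indicator (Icc (toDisc ε) 2) fun s : ℝ => s⁻¹, ?_, ?_⟩
  · rw [h1, cfc_congr fun s hs => (key s hs).1, cfc_mul .., cfc_id' ..]
  · rw [h1, cfc_congr fun s hs => (key s hs).2, cfc_mul .., cfc_mul .., cfc_mul .., cfc_id' ..]

/-- Let P = P_[0,ε](|B|), of finite rank. The kernel of B lies in the range of P, and 1 - P = b b*
g(|b|)² shows that the range of B contains ker P. This closed subspace of finite codimension makes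
the range closed and the cokernel finite dimensional. -/
theorem isFredholmOp : IsFredholmOp B := by
  obtain ⟨g, h1, h2⟩ := h.exists_one_sub_specProj
  have hfin : FiniteDimensional ℂ (LinearMap.range (specProj (absOp B) 0 ε : K →ₗ[ℂ] K)) :=
    h.finite
  have hP := isStarProjection_absOp h.transform h.notMem
  set P := specProj (absOp B) 0 ε with hPdef
  have hPS : Commute P (defect b) := by
    rw [← defect_abs, defect_eq_cfc (CFC.norm_abs.trans_le h.transform.1) (isSelfAdjoint_abs b),
      hPdef, h.transform.absOp.specProj_eq]
    exact cfc_commute_cfc _ _ _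
  have hgc : Commute (CFC.abs b) (cfc g (CFC.abs b)) :=
    ((Commute.refl (CFC.abs b)).cfc_real _).symm
  have hker : ∀ v : LinearMap.ker B.toFun, ((v : B.domain) : K) ∈
      LinearMap.range (P : K →ₗ[ℂ] K) := by
    rintro ⟨v, hv⟩
    have h3 := B.mem_graph v
    rw [h.transform.2, mem_transformGraph] at h3
    obtain ⟨w, hw, hw'⟩ := h3
    simp only at hw hw'
    have h4 : CFC.abs b w = 0 := abs_apply_eq_zero (hw'.trans hv)
    have h5 : w - P w = 0 := by
      have h6 : (1 - P) w = cfc g (CFC.abs b) (CFC.abs b w) := by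
        rw [h1, hgc.eq]
        rfl
      rw [h4, map_zero] at h6
      exact h6
    refine ⟨defect b w, ?_⟩
    have h7 : P (defect b w) = defect b (P w) := DFunLike.congr_fun hPS.eq w
    exact h7.trans (by rw [← sub_eq_zero.1 h5, hw])
  have hle : LinearMap.ker (P : K →ₗ[ℂ] K) ≤ LinearMap.range B.toFun := by
    intro v hv
    have h3 : P v = 0 := hv
    have h4 : (1 - P) v = v := by
      show v - P v = v
      rw [h3, sub_zero]
    have h5 : (1 - P) v = b (star b ((cfc g (CFC.abs b) * cfc g (CFC.abs b)) v)) := by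
      rw [h2, ← self_mul_star_eq h.normal]
      rfl
    have h6 := h.transform.mem_graph (star b ((cfc g (CFC.abs b) * cfc g (CFC.abs b)) v))
    rw [← h5, h4] at h6
    obtain ⟨z, -, hz⟩ := (LinearPMap.mem_graph_iff _).1 h6
    exact ⟨z, hz⟩
  have hq : FiniteDimensional ℂ (K ⧸ LinearMap.ker (P : K →ₗ[ℂ] K)) :=
    (LinearMap.quotKerEquivRange (P : K →ₗ[ℂ] K)).symm.finiteDimensional
  refine ⟨?_, ?_, ?_⟩
  · exact FiniteDimensional.of_injective
      (((B.domain.subtype).comp (LinearMap.ker B.toFun).subtype).codRestrict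
        (LinearMap.range (P : K →ₗ[ℂ] K)) hker) fun v w hvw =>
          Subtype.ext (Subtype.ext (by have h3 := congrArg Subtype.val hvw; exact h3))
  · exact Submodule.isClosed_mono_of_finiteDimensional_quotient
      (ContinuousLinearMap.isClosed_ker P) hle
  · exact Module.Finite.of_surjective (Submodule.factor hle) (Submodule.factor_surjective hle)

theorem isEnhanced : IsEnhanced B ε := ⟨h.pos, h.isFredholmOp, h.notMem, h.finite⟩

theorem lowPolar_mem_graph (v : K) : (specProj (absOp B) 0 ε v, lowPolar B ε v) ∈ B.graph := by
  obtain ⟨g, -, h1, h2⟩ := exists_defect_mul_eq h.transform.absOp (isSelfAdjoint_abs b) h.notMem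
    h.neg_notMem
  rw [← absOp_specProj_neg h.transform h.pos.le, ← h1, lowPolar, ← h2, ← mul_assoc,
    h.polarPart_mul_abs, defect_abs]
  exact h.transform.mem_graph _

theorem eq_lowPolar {N : K →L[ℂ] K} (hN : ∀ v, (specProj (absOp B) 0 ε v, N v) ∈ B.graph) :
    N = lowPolar B ε :=
  eq_of_mem_graph hN h.lowPolar_mem_graph

/-- The polar part on the image of a spectral projection not containing zero. -/
theorem exists_polarPart_mul {a c : ℝ} (ha0 : 0 < a)
    (ha : (a : ℂ) ∉ opSpectrum (absOp B)) (hc : (c : ℂ) ∉ opSpectrum (absOp B)) :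
    ∃ g : ℝ → ℝ, polarPart B * specProj (absOp B) a c = b * cfc g (CFC.abs b) ∧
      specProj (absOp B) a c = CFC.abs b * cfc g (CFC.abs b) := by
  have hT := h.transform.absOp
  rw [hT.mem_opSpectrum_iff (isSelfAdjoint_abs b)] at ha hc
  have hcont : ContinuousOn (indicator (Icc (toDisc a) (toDisc c)) fun s : ℝ => s⁻¹)
      (spectrum ℝ (CFC.abs b)) :=
    continuousOn_indicator_Icc (ContinuousOn.inv₀ continuousOn_id fun s hs =>
      ((toDisc_pos ha0).trans_le hs.1).ne') ha hc
  have h1 : specProj (absOp B) a c = CFC.abs b *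
      cfc (indicator (Icc (toDisc a) (toDisc c)) fun s : ℝ => s⁻¹) (CFC.abs b) := by
    nth_rw 1 [← cfc_id' ℝ (CFC.abs b)]
    rw [hT.specProj_eq, ← cfc_mul ..]
    congr 1
    funext s
    by_cases hs : s ∈ Icc (toDisc a) (toDisc c)
    · rw [indicator_of_mem hs, indicator_of_mem hs, Pi.one_apply,
        mul_inv_cancel₀ ((toDisc_pos ha0).trans_le hs.1).ne']
    · rw [indicator_of_notMem hs, indicator_of_notMem hs, mul_zero]
  refine ⟨_, ?_, h1⟩
  rw [h1, ← mul_assoc, h.polarPart_mul_abs]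

/-- On a window away from zero the polar part is b g(|b|) with g(s) = 1/s, and b commutes with
g(|b|) and with b*. Hence initial and final projections coincide. -/
theorem star_polarPart_mul {a c : ℝ} (ha0 : 0 < a)
    (ha : (a : ℂ) ∉ opSpectrum (absOp B)) (hc : (c : ℂ) ∉ opSpectrum (absOp B)) :
    star (polarPart B * specProj (absOp B) a c) * (polarPart B * specProj (absOp B) a c) =
      specProj (absOp B) a c ∧
    (polarPart B * specProj (absOp B) a c) * star (polarPart B * specProj (absOp B) a c) =
      specProj (absOp B) a c := by
  obtain ⟨g, h1, h2⟩ := h.exists_polarPart_mul ha0 ha hc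
  have hP := isStarProjection_specProj h.transform.absOp (isSelfAdjoint_abs b) ha hc
  have hgs : star (cfc g (CFC.abs b)) = cfc g (CFC.abs b) := IsSelfAdjoint.star_eq (cfc_predicate _ _)
  have hgc : Commute (CFC.abs b) (cfc g (CFC.abs b)) :=
    ((Commute.refl (CFC.abs b)).cfc_real _).symm
  have hgb : Commute (cfc g (CFC.abs b)) b := (CFC.commute_abs_self b h.normal).cfc_real _
  have hgb' : Commute (cfc g (CFC.abs b)) (star b) := by
    have := hgb.star_star
    rwa [hgs] at this
  have key : CFC.abs b * CFC.abs b * (cfc g (CFC.abs b) * cfc g (CFC.abs b)) =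
      specProj (absOp B) a c := by
    rw [← hP.1.eq]
    nth_rw 1 [h2]
    nth_rw 1 [h2]
    exact hgc.symm.mul_mul_mul_comm _ _ |>.symm
  rw [h1, star_mul, hgs]
  constructor
  · rw [mul_assoc, ← mul_assoc (star b), ← CFC.abs_mul_abs, ← key, ← mul_assoc, ← mul_assoc,
      ← mul_assoc, ← hgc.eq, mul_assoc (CFC.abs b), ← hgc.eq]
    simp only [mul_assoc]
  · rw [mul_assoc, ← mul_assoc (cfc g (CFC.abs b)), ← key, ← self_mul_star_eq h.normal,
      (hgb'.mul_left hgb').eq, mul_assoc]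

/-- Passing to N*N removes the polar part, so the spectrum of |B| in the window can be read from N,
which varies continuously. -/
theorem star_lowPolar_mul_self :
    star (lowPolar B ε) * lowPolar B ε = lowPart (absOp B) ε * lowPart (absOp B) ε := by
  obtain ⟨g, -, -, h2⟩ := exists_defect_mul_eq h.transform.absOp (isSelfAdjoint_abs b) h.notMem
    h.neg_notMem
  have h3 : lowPolar B ε = b * cfc g (CFC.abs b) := by
    rw [lowPolar, ← h2, ← mul_assoc, h.polarPart_mul_abs]
  have hgs : star (cfc g (CFC.abs b)) = cfc g (CFC.abs b) := IsSelfAdjoint.star_eq (cfc_predicate _ _)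
  have hgc : Commute (CFC.abs b) (cfc g (CFC.abs b)) :=
    ((Commute.refl (CFC.abs b)).cfc_real _).symm
  rw [h3, ← h2, star_mul, hgs, mul_assoc, ← mul_assoc (star b), ← CFC.abs_mul_abs, ← mul_assoc,
    ← mul_assoc, ← hgc.eq, mul_assoc]

theorem lowPart_spectrum_nonneg {s : ℝ} (hs : s ∈ spectrum ℝ (lowPart (absOp B) ε)) : 0 ≤ s := by
  have hT := h.transform.absOp
  have h1 := continuousOn_window hT (isSelfAdjoint_abs b) h.neg_notMem h.notMem continuousOn_ofDisc
  rw [lowPart, hT.boundedTransform_eq, cfc_map_spectrum ..] at hs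
  obtain ⟨t, ht, rfl⟩ := hs
  exact indicator_nonneg (fun s _ => div_nonneg (spectrum_abs_nonneg ht) (Real.sqrt_nonneg _)) t

/-- The spectrum of `N* N` where `N = B P_[0, ε](|B|)`. -/
theorem sq_notMem_spectrum {a : ℝ} (ha0 : 0 < a) (hle : a ≤ ε)
    (ha : (a : ℂ) ∉ opSpectrum (absOp B)) :
    a ^ 2 ∉ spectrum ℝ (star (lowPolar B ε) * lowPolar B ε) := by
  have hsa : IsSelfAdjoint (lowPart (absOp B) ε) := cfc_predicate _ _
  rw [h.star_lowPolar_mul_self, ← sq, ← cfc_pow_id (R := ℝ) _ 2, cfc_map_spectrum ..]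
  rintro ⟨s, hs, hs'⟩
  have h1 : s = a := by
    have h2 := h.lowPart_spectrum_nonneg hs
    exact (pow_left_inj₀ h2 ha0.le two_ne_zero).1 hs'
  subst h1
  exact ha ((mem_spectrum_lowPart_iff h.transform.absOp (isSelfAdjoint_abs b) h.notMem h.neg_notMem
    ha0.ne' (by linarith) hle).1 hs)

/-- The morphisms in the image of the index functor in terms of the operator
`N = B P_[0, ε](|B|)`. -/
theorem polarPart_mul_specProj {a c : ℝ} (ha0 : 0 < a) (hac : a ≤ c) (hcε : c ≤ ε)
    (ha : (a : ℂ) ∉ opSpectrum (absOp B)) (hc : (c : ℂ) ∉ opSpectrum (absOp B)) :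
    polarPart B * specProj (absOp B) a c = lowPolar B ε *
      cfc (indicator (Icc (a ^ 2) (c ^ 2)) fun s => (√s)⁻¹)
        (star (lowPolar B ε) * lowPolar B ε) := by
  have hT := h.transform.absOp
  have hTs := isSelfAdjoint_abs b
  have hsa : IsSelfAdjoint (lowPart (absOp B) ε) := cfc_predicate _ _
  have hc0 := ha0.trans_le hac
  have hca := h.sq_notMem_spectrum ha0 (hac.trans hcε) ha
  have hcc := h.sq_notMem_spectrum hc0 hcε hc
  have hNa : a ∉ spectrum ℝ (lowPart (absOp B) ε) := fun hs =>
    ha ((mem_spectrum_lowPart_iff hT hTs h.notMem h.neg_notMem ha0.ne' (by linarith)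
      (hac.trans hcε)).1 hs)
  have hNc : c ∉ spectrum ℝ (lowPart (absOp B) ε) := fun hs =>
    hc ((mem_spectrum_lowPart_iff hT hTs h.notMem h.neg_notMem hc0.ne' (by linarith) hcε).1 hs)
  -- With L = |B|P one has N = UL and N*N = L². So (N*N)^(-1/2) on [a², c²] is L⁻¹ on [a, c], and
  -- multiplication of N by it leaves U times the projection.
  have hN2 : star (lowPolar B ε) * lowPolar B ε =
      cfc (fun s : ℝ => s ^ 2) (lowPart (absOp B) ε) := by
    rw [h.star_lowPolar_mul_self, cfc_pow_id .., sq]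
  rw [hN2, cfc_map_spectrum ..] at hca hcc
  have hcont1 : ContinuousOn (indicator (Icc (a ^ 2) (c ^ 2)) fun s : ℝ => (√s)⁻¹)
      ((fun s : ℝ => s ^ 2) '' spectrum ℝ (lowPart (absOp B) ε)) :=
    continuousOn_indicator_Icc (ContinuousOn.inv₀ (by fun_prop) fun s hs =>
      (Real.sqrt_pos.2 ((pow_pos ha0 2).trans_le hs.1)).ne') hca hcc
  have hcont2 : ContinuousOn (indicator (Icc a c) fun s : ℝ => s⁻¹)
      (spectrum ℝ (lowPart (absOp B) ε)) :=
    continuousOn_indicator_Icc (ContinuousOn.inv₀ continuousOn_id fun s hs =>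
      (ha0.trans_le hs.1).ne') hNa hNc
  have h1 : cfc (indicator (Icc a c) (1 : ℝ → ℝ)) (lowPart (absOp B) ε) = lowPart (absOp B) ε *
      cfc (indicator (Icc a c) fun s : ℝ => s⁻¹) (lowPart (absOp B) ε) := by
    nth_rw 2 [← cfc_id' ℝ (lowPart (absOp B) ε)]
    rw [← cfc_mul ..]
    congr 1
    funext s
    by_cases hs : s ∈ Icc a c
    · rw [indicator_of_mem hs, indicator_of_mem hs, Pi.one_apply,
        mul_inv_cancel₀ (ha0.trans_le hs.1).ne']
    · rw [indicator_of_notMem hs, indicator_of_notMem hs, mul_zero]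
  have h2 : cfc (indicator (Icc (a ^ 2) (c ^ 2)) fun s => (√s)⁻¹)
        (star (lowPolar B ε) * lowPolar B ε) =
      cfc (indicator (Icc a c) fun s : ℝ => s⁻¹) (lowPart (absOp B) ε) := by
    rw [hN2, ← cfc_comp ..]
    refine cfc_congr fun s hs => ?_
    have hs0 := h.lowPart_spectrum_nonneg hs
    have hiff : s ^ 2 ∈ Icc (a ^ 2) (c ^ 2) ↔ s ∈ Icc a c := by
      rw [mem_Icc, mem_Icc, pow_le_pow_iff_left₀ ha0.le hs0 two_ne_zero,
        pow_le_pow_iff_left₀ hs0 hc0.le two_ne_zero]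
    simp only [Function.comp_apply, indicator_apply, hiff, Real.sqrt_sq hs0]
  rw [h2, specProj_eq_lowPart hT hTs h.notMem h.neg_notMem ha hc ha0.ne' hc0.ne' (by linarith) hcε,
    h1, ← mul_assoc (specProj (absOp B) (-ε) ε), specProj_mul_lowPart hT hTs h.notMem h.neg_notMem,
    lowPolar, mul_assoc]

end IsNormalEnhanced

end Operators

/-! ### Continuous fields of operators -/

section Fields

set_option linter.unusedSectionVars false

variable {X : Type u} [TopologicalSpace X] {H : Type v} [NormedAddCommGroup H]
  [InnerProductSpace ℂ H] [CompleteSpace H] (E : HilbertBundle.{u, v, w} X H)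

/-- The isomorphism of C*-algebras defined by a local trivialization. -/
def HilbertBundle.conjEquiv (i : E.Index) (x : E.dom i) :
    (E.Fiber x →L[ℂ] E.Fiber x) ≃⋆ₐ[ℂ] (H →L[ℂ] H) :=
  (E.triv i x).conjStarAlgEquiv

/-- `HilbertBundle.conjEquiv` as a homomorphism. -/
def HilbertBundle.conjHom (i : E.Index) (x : E.dom i) :
    (E.Fiber x →L[ℂ] E.Fiber x) →⋆ₐ[ℂ] (H →L[ℂ] H) where
  toFun := E.conj i x
  map_one' := map_one (E.conjEquiv i x)
  map_mul' := map_mul (E.conjEquiv i x)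
  map_zero' := map_zero (E.conjEquiv i x)
  map_add' := map_add (E.conjEquiv i x)
  commutes' c := by
    rw [Algebra.algebraMap_eq_smul_one, Algebra.algebraMap_eq_smul_one]
    exact (map_smul (E.conjEquiv i x) c 1).trans (congrArg (c • ·) (map_one (E.conjEquiv i x)))
  map_star' T := (E.conjEquiv i x).map_star' T

theorem HilbertBundle.continuous_conjHom (i : E.Index) (x : E.dom i) :
    Continuous (E.conjHom i x) := by
  have : (⇑(E.conjHom i x)) = fun T => E.conj i x T := rfl
  rw [this]
  unfold HilbertBundle.conj
  fun_prop

theorem HilbertBundle.spectrum_conj (i : E.Index) (x : E.dom i)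
    (T : E.Fiber x →L[ℂ] E.Fiber x) : spectrum ℝ (E.conj i x T) = spectrum ℝ T :=
  AlgEquiv.spectrum_eq ((E.conjEquiv i x).toAlgEquiv.restrictScalars ℝ) T

theorem HilbertBundle.isSelfAdjoint_conj (i : E.Index) (x : E.dom i)
    {T : E.Fiber x →L[ℂ] E.Fiber x} (hT : IsSelfAdjoint T) : IsSelfAdjoint (E.conj i x T) :=
  hT.map (E.conjHom i x)

theorem HilbertBundle.conj_cfc (i : E.Index) (x : E.dom i) {T : E.Fiber x →L[ℂ] E.Fiber x}
    (hT : IsSelfAdjoint T) {f : ℝ → ℝ} (hf : ContinuousOn f (spectrum ℝ T)) :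
    E.conj i x (cfc f T) = cfc f (E.conj i x T) :=
  StarAlgHom.map_cfc (E.conjHom i x) f T hf (E.continuous_conjHom i x) hT
    (hT.map (E.conjHom i x))

namespace HilbertBundle.ContinuousField

variable {E} {U V : Set X} {S T : ∀ x, E.Fiber x →L[ℂ] E.Fiber x}

theorem mono (h : E.ContinuousField U T) (hVU : V ⊆ U) : E.ContinuousField V T := by
  intro i
  have h1 : Continuous (fun x : {x // x ∈ V ∧ x ∈ E.dom i} =>
      (⟨x, hVU x.2.1, x.2.2⟩ : {x // x ∈ U ∧ x ∈ E.dom i})) :=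
    continuous_subtype_val.subtype_mk _
  exact (h i).comp h1

theorem congr (h : E.ContinuousField U T) (hST : ∀ x ∈ U, S x = T x) : E.ContinuousField U S := by
  intro i
  convert h i using 2 with x
  rw [hST x x.2.1]

theorem mul (hS : E.ContinuousField U S) (hT : E.ContinuousField U T) :
    E.ContinuousField U fun x => S x * T x := by
  intro i
  convert (hS i).mul (hT i) using 2 with x
  exact map_mul (E.conjHom i ⟨x, x.2.2⟩) _ _

theorem add (hS : E.ContinuousField U S) (hT : E.ContinuousField U T) :
    E.ContinuousField U fun x => S x + T x := by
  intro i
  convert (hS i).add (hT i) using 2 with x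
  exact map_add (E.conjHom i ⟨x, x.2.2⟩) _ _

theorem smul {c : X → ℂ} (hc : ContinuousOn c U) (hT : E.ContinuousField U T) :
    E.ContinuousField U fun x => c x • T x := by
  intro i
  have hc' : Continuous fun x : {x // x ∈ U ∧ x ∈ E.dom i} => c x :=
    hc.comp_continuous continuous_subtype_val fun x => x.2.1
  convert hc'.smul (hT i) using 2 with x
  exact map_smul (E.conjHom i ⟨x, x.2.2⟩) _ _

theorem star (hT : E.ContinuousField U T) : E.ContinuousField U fun x => star (T x) := by
  intro i
  convert (hT i).star using 2 with x
  exact map_star (E.conjHom i ⟨x, x.2.2⟩) _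

theorem zero : E.ContinuousField U fun _ => 0 := by
  intro i
  convert continuous_const (y := (0 : H →L[ℂ] H)) using 2 with x
  exact map_zero (E.conjHom i ⟨x, x.2.2⟩)

/-- Functional calculus is norm continuous on operators with spectrum in an open set where f is
continuous. The open set is usually the complement of the end points of a window. -/
theorem cfc (hT : E.ContinuousField U T) (hsa : ∀ x ∈ U, IsSelfAdjoint (T x)) {f : ℝ → ℝ}
    {O : Set ℝ} (hO : IsOpen O) (hf : ContinuousOn f O) (hTO : ∀ x ∈ U, spectrum ℝ (T x) ⊆ O) :
    E.ContinuousField U fun x => _root_.cfc f (T x) := by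
  intro i
  have h1 : Continuous fun x : {x // x ∈ U ∧ x ∈ E.dom i} =>
      _root_.cfc f (E.conj i ⟨x, x.2.2⟩ (T x)) := by
    refine Continuous.cfc_of_mem_nhdsSet (s := O) f ?_ (hT i) (fun x =>
      E.isSelfAdjoint_conj i ⟨x, x.2.2⟩ (hsa x x.2.1)) hf
    rw [hO.mem_nhdsSet]
    refine iUnion_subset fun x => ?_
    rw [E.spectrum_conj]
    exact hTO x x.2.1
  refine h1.congr fun x => ?_
  exact (E.conj_cfc i ⟨x, x.2.2⟩ (hsa x x.2.1) (hf.mono (hTO x x.2.1))).symm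

/-- The spectrum of a continuous field is upper hemicontinuous. -/
theorem eventually_spectrum_subset (hT : E.ContinuousField U T) {x₀ : X} (hx : U ∈ 𝓝 x₀)
    {O : Set ℝ} (hO : IsOpen O) (hTO : spectrum ℝ (T x₀) ⊆ O) :
    ∀ᶠ x in 𝓝 x₀, spectrum ℝ (T x) ⊆ O := by
  obtain ⟨i, hi⟩ := E.exists_mem_dom x₀
  have hx₀ : x₀ ∈ U ∧ x₀ ∈ E.dom i := ⟨mem_of_mem_nhds hx, hi⟩
  have h1 : ∀ᶠ a in 𝓝 (E.conj i ⟨x₀, hi⟩ (T x₀)), spectrum ℝ a ⊆ O := by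
    have h2 := (upperHemicontinuous_spectrum ℝ (H →L[ℂ] H)).upperHemicontinuousAt
      (E.conj i ⟨x₀, hi⟩ (T x₀)) O
    have h5 : O ∈ 𝓝ˢ (spectrum ℝ (E.conj i ⟨x₀, hi⟩ (T x₀))) := by
      rw [E.spectrum_conj, hO.mem_nhdsSet]
      exact hTO
    filter_upwards [h2 h5] with a ha
    exact (hO.mem_nhdsSet).1 ha
  have h3 := (hT i).continuousAt (x := ⟨x₀, hx₀⟩) |>.eventually h1
  have h4 : {x | x ∈ U ∧ x ∈ E.dom i} ∈ 𝓝 x₀ := inter_mem hx ((E.isOpen_dom i).mem_nhds hi)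
  rw [← map_nhds_subtype_coe_eq_nhds (p := fun x => x ∈ U ∧ x ∈ E.dom i) hx₀ h4, eventually_map]
  filter_upwards [h3] with x hx
  rwa [E.spectrum_conj i ⟨x, x.2.2⟩] at hx

theorem pullback {Y : Type u} [TopologicalSpace Y] (g : C(Y, X)) (hT : E.ContinuousField U T) :
    (E.pullback g).ContinuousField (g ⁻¹' U) fun y => T (g y) := by
  intro i
  have h1 : Continuous (fun y : {y // y ∈ g ⁻¹' U ∧ y ∈ (E.pullback g).dom i} =>
      (⟨g y, y.2.1, y.2.2⟩ : {x // x ∈ U ∧ x ∈ E.dom i})) :=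
    (g.continuous.comp continuous_subtype_val).subtype_mk _
  exact (hT i).comp h1

end HilbertBundle.ContinuousField

/-- A criterion of continuity of maps to a space with the glued topology. -/
theorem HilbertBundle.continuous_glueTopology {S : X → Type*}
    (c : ∀ x, S x → Fin 3 → (E.Fiber x →L[ℂ] E.Fiber x)) {Y : Type*} [TopologicalSpace Y]
    (m : Y → Σ x, S x) (hm : Continuous fun y => (m y).1)
    (h : ∀ y₀, ∃ W ∈ 𝓝 y₀, ∃ (V : Set X) (C : Fin 3 → ∀ x, E.Fiber x →L[ℂ] E.Fiber x),
      (∀ k, E.ContinuousField V (C k)) ∧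
        ∀ y ∈ W, (m y).1 ∈ V ∧ ∀ k, c _ (m y).2 k = C k (m y).1) :
    @Continuous _ _ _ (E.glueTopology c) m := by
  let := E.glueTopology c
  refine continuous_iff_continuousAt.2 fun y₀ => ?_
  obtain ⟨W, hW, V, C, hC, hWV⟩ := h y₀
  obtain ⟨i, hi⟩ := E.exists_mem_dom (m y₀).1
  have hW' : W ∩ {y | (m y).1 ∈ E.dom i} ∈ 𝓝 y₀ :=
    inter_mem hW (((E.isOpen_dom i).preimage hm).mem_nhds hi)
  refine ContinuousOn.continuousAt ?_ hW'
  rw [continuousOn_iff_continuous_domRestrict]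
  let t : TopologicalSpace {a : Σ x, S x // a.1 ∈ E.dom i} := TopologicalSpace.induced
      (fun a => ((a.1.1, fun k => E.conj i ⟨a.1.1, a.2⟩ (c a.1.1 a.1.2 k)) :
        X × (Fin 3 → (H →L[ℂ] H)))) inferInstance
  -- The glued topology is the supremum of the topologies coinduced from the charts, so the
  -- inclusion of a chart is continuous and coordinates in one chart suffice.
  have hval : Continuous (Subtype.val : {a : Σ x, S x // a.1 ∈ E.dom i} → Σ x, S x) := by
    rw [continuous_iff_coinduced_le]
    exact le_iSup (fun i : E.Index => TopologicalSpace.coinduced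
      (Subtype.val : {a : Σ x, S x // a.1 ∈ E.dom i} → Σ x, S x)
      (TopologicalSpace.induced
        (fun a => ((a.1.1, fun k => E.conj i ⟨a.1.1, a.2⟩ (c a.1.1 a.1.2 k)) :
          X × (Fin 3 → (H →L[ℂ] H)))) inferInstance)) i
  refine hval.comp (f := fun y : (W ∩ {y | (m y).1 ∈ E.dom i} : Set Y) =>
    (⟨m y, y.2.2⟩ : {a : Σ x, S x // a.1 ∈ E.dom i})) ?_
  rw [continuous_induced_rng]
  refine Continuous.prodMk (hm.comp continuous_subtype_val) (continuous_pi fun k => ?_)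
  have h1 := (hC k i).comp (f := fun y : (W ∩ {y | (m y).1 ∈ E.dom i} : Set Y) =>
    ⟨(m y).1, (hWV y y.2.1).1, y.2.2⟩) ((hm.comp continuous_subtype_val).subtype_mk _)
  refine h1.congr fun y => ?_
  simp only [Function.comp_apply]
  rw [(hWV y y.2.1).2 k]

end Fields

/-! ### The index functor of a family of self-adjoint operators -/

section Operators

variable {K : Type*} [NormedAddCommGroup K] [InnerProductSpace ℂ K] [CompleteSpace K]

theorem range_sup_range {P Q : K →L[ℂ] K} (hP : IsStarProjection P) (hQ : IsStarProjection Q)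
    (h : P * Q = 0) : LinearMap.range (P : K →ₗ[ℂ] K) ⊔ LinearMap.range (Q : K →ₗ[ℂ] K) =
      LinearMap.range ((P + Q : K →L[ℂ] K) : K →ₗ[ℂ] K) := by
  have h' : Q * P = 0 := by
    have h1 := congrArg star h
    rwa [star_mul, star_zero, hP.2.star_eq, hQ.2.star_eq] at h1
  apply le_antisymm
  · have e1 : P = (P + Q) * P := by rw [add_mul, h', add_zero, hP.1.eq]
    have e2 : Q = (P + Q) * Q := by rw [add_mul, h, zero_add, hQ.1.eq]
    refine sup_le ?_ ?_
    · conv_lhs => rw [e1]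
      exact range_mul_le _ _
    · conv_lhs => rw [e2]
      exact range_mul_le _ _
  · rintro _ ⟨v, rfl⟩
    exact Submodule.add_mem_sup ⟨v, rfl⟩ ⟨v, rfl⟩

theorem subspaceCoord_mk {V V' : SubspaceObj K} (g : V ⟶ V') {P Q R : K →L[ℂ] K}
    (hP : IsStarProjection P) (hQ : IsStarProjection Q) (hR : IsStarProjection R)
    (h₁ : SubspaceHom.neg g = LinearMap.range (P : K →ₗ[ℂ] K))
    (h₂ : V.space = LinearMap.range (Q : K →ₗ[ℂ] K))
    (h₃ : SubspaceHom.pos g = LinearMap.range (R : K →ₗ[ℂ] K)) :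
    subspaceCoord (Arrow.mk g) = ![P, Q, R] := by
  have : FiniteDimensional ℂ (SubspaceHom.neg g) :=
    Submodule.finiteDimensional_of_le (S₂ := V'.space)
      (g.sup_eq ▸ le_trans le_sup_left le_sup_left)
  have : FiniteDimensional ℂ (SubspaceHom.pos g) :=
    Submodule.finiteDimensional_of_le (S₂ := V'.space) (g.sup_eq ▸ le_sup_right)
  rw [← starProjection_range_eq hP _ h₁, ← starProjection_range_eq hQ _ h₂,
    ← starProjection_range_eq hR _ h₃]
  rfl

variable {A : K →ₗ.[ℂ] K} {T : K →L[ℂ] K} (hT : IsBoundedTransform A T) (hsa : IsSelfAdjoint T)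
include hT hsa

theorem specIm_sup {a b c : ℝ} (hab : a ≤ b) (hbc : b ≤ c) (ha : (a : ℂ) ∉ opSpectrum A)
    (hb : (b : ℂ) ∉ opSpectrum A) (hc : (c : ℂ) ∉ opSpectrum A) :
    specIm A a b ⊔ specIm A b c = specIm A a c := by
  rw [specIm, specIm, specIm, range_sup_range (isStarProjection_specProj hT hsa ha hb)
    (isStarProjection_specProj hT hsa hb hc) (specProj_mul_eq_zero hT hsa le_rfl ha hb hb hc),
    specProj_add hT hsa hab hbc ha hb hc]

theorem specIm_isOrtho {a b c d : ℝ} (hbc : b ≤ c) (ha : (a : ℂ) ∉ opSpectrum A)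
    (hb : (b : ℂ) ∉ opSpectrum A) (hc : (c : ℂ) ∉ opSpectrum A) (hd : (d : ℂ) ∉ opSpectrum A) :
    specIm A a b ⟂ specIm A c d :=
  isOrtho_range (isStarProjection_specProj hT hsa ha hb).2
    (specProj_mul_eq_zero hT hsa hbc ha hb hc hd)

theorem specIm_self {a : ℝ} (ha : (a : ℂ) ∉ opSpectrum A) : specIm A a a = ⊥ := by
  rw [specIm, specProj_self hT hsa ha]
  exact LinearMap.range_zero

end Operators

section Covering

variable {X : Type u} {ι : Type w} {U : ι → Set X} {ε : ι → ℝ}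

theorem CoverFiber.exists_min_eq {x : X} (σ : CoverFiber U x) :
    ∃ a ∈ σ.carrier, σ.min ε = ε a ∧ x ∈ U a := by
  obtain ⟨a, ha, h⟩ := Finset.exists_mem_eq_inf' σ.nonempty ε
  exact ⟨a, ha, h, σ.mem a ha⟩

theorem CoverFiber.min_congr {x y : X} {σ : CoverFiber U x} {τ : CoverFiber U y}
    (h : σ.carrier = τ.carrier) : σ.min ε = τ.min ε := by
  obtain ⟨s, hs, hs'⟩ := σ
  obtain ⟨t, ht, ht'⟩ := τ
  obtain rfl : s = t := h
  rfl

theorem CoverFiber.min_le_min {x : X} {σ τ : CoverFiber U x} (h : σ ≤ τ) : σ.min ε ≤ τ.min ε :=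
  Finset.inf'_mono ε h τ.nonempty

theorem mem_nhds_coverArrow [TopologicalSpace X] (f₀ : Arrow (CoverCat U)) :
    {f : Arrow (CoverCat U) | f.left.2.carrier = f₀.left.2.carrier ∧
      f.right.2.carrier = f₀.right.2.carrier} ∈ 𝓝 f₀ := by
  let _ : TopologicalSpace (Finset ι) := ⊥
  have : DiscreteTopology (Finset ι) := ⟨rfl⟩
  have h : Continuous fun f : Arrow (CoverCat U) =>
      (f.left.1, f.left.2.carrier, f.right.2.carrier) := continuous_induced_dom
  have h1 : IsOpen {p : X × Finset ι × Finset ι | p.2 = (f₀.left.2.carrier, f₀.right.2.carrier)} :=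
    (isOpen_discrete {(f₀.left.2.carrier, f₀.right.2.carrier)}).preimage continuous_snd
  refine mem_of_superset ((h1.preimage h).mem_nhds rfl) fun f hf => ?_
  exact ⟨congrArg Prod.fst hf, congrArg Prod.snd hf⟩

theorem continuous_coverArrow_proj [TopologicalSpace X] :
    Continuous fun f : Arrow (CoverCat U) => f.left.1 := by
  let _ : TopologicalSpace (Finset ι) := ⊥
  exact continuous_fst.comp (continuous_induced_dom (f := fun f : Arrow (CoverCat U) =>
      (f.left.1, f.left.2.carrier, f.right.2.carrier)))

end Covering

section SelfAdjointFamily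

variable {X : Type u} [TopologicalSpace X] {H : Type v} [NormedAddCommGroup H]
  [InnerProductSpace ℂ H] [CompleteSpace H] {E : HilbertBundle.{u, v, w} X H}
  {A : ∀ x, E.Fiber x →ₗ.[ℂ] E.Fiber x} {ι : Type u} {U : ι → Set X} {ε : ι → ℝ}

theorem isEnhancedSA_min (hU : ∀ a, IsAdaptedSA E A (U a) (ε a)) {x : X} (σ : CoverFiber U x) :
    IsEnhancedSA (A x) (σ.min ε) := by
  obtain ⟨a, -, h, hx⟩ := σ.exists_min_eq (ε := ε)
  rw [h]
  exact (hU a).enhanced x hx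

theorem exists_isIndexFunctorSA (hA : ∀ x, IsSelfAdjoint (A x))
    (hU : ∀ a, IsAdaptedSA E A (U a) (ε a)) :
    ∃ F : ∀ x, CoverFiber U x ⥤ SubspaceObj (E.Fiber x), IsIndexFunctorSA E A U ε F := by
  choose T hTs hT using fun x => exists_isBoundedTransform (hA x)
  have he := fun {x : X} (σ : CoverFiber U x) => isEnhancedSA_min hU σ
  refine ⟨fun x =>
    { obj := fun τ => ⟨specIm (A x) (-τ.min ε) (τ.min ε), (he τ).finite⟩
      map := fun {τ σ} f =>
        { neg := specIm (A x) (-σ.min ε) (-τ.min ε)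
          pos := specIm (A x) (τ.min ε) (σ.min ε)
          neg_orth := specIm_isOrtho (hT x) (hTs x) le_rfl (he σ).neg_notMem (he τ).neg_notMem
            (he τ).neg_notMem (he τ).notMem
          pos_orth := (specIm_isOrtho (hT x) (hTs x) le_rfl (he τ).neg_notMem (he τ).notMem
            (he τ).notMem (he σ).notMem).symm
          neg_pos := specIm_isOrtho (hT x) (hTs x) (by linarith [(he τ).pos]) (he σ).neg_notMem
            (he τ).neg_notMem (he τ).notMem (he σ).notMem
          sup_eq := by
            have h1 : τ.min ε ≤ σ.min ε := CoverFiber.min_le_min f.le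
            have h2 := (he τ).pos
            rw [specIm_sup (hT x) (hTs x) (neg_le_neg h1) (by linarith) (he σ).neg_notMem
              (he τ).neg_notMem (he τ).notMem, specIm_sup (hT x) (hTs x) (by linarith) h1
              (he σ).neg_notMem (he τ).notMem (he σ).notMem] }
      map_id := fun τ => SubspaceHom.ext
        (specIm_self (hT x) (hTs x) (he τ).neg_notMem) (specIm_self (hT x) (hTs x) (he τ).notMem)
      map_comp := fun {ρ σ τ} f g => by
        have h1 : ρ.min ε ≤ σ.min ε := CoverFiber.min_le_min f.le
        have h2 : σ.min ε ≤ τ.min ε := CoverFiber.min_le_min g.le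
        refine SubspaceHom.ext ?_ ?_
        · exact (specIm_sup (hT x) (hTs x) (neg_le_neg h2) (neg_le_neg h1) (he τ).neg_notMem
            (he σ).neg_notMem (he ρ).neg_notMem).symm.trans (sup_comm _ _)
        · exact (specIm_sup (hT x) (hTs x) h1 h2 (he ρ).notMem (he σ).notMem
            (he τ).notMem).symm }, ?_⟩
  exact ⟨fun _ _ => rfl, fun _ _ _ _ => rfl, fun _ _ _ _ => rfl⟩

theorem IsAdaptedSA.continuous_lowPart (hA : ∀ x, IsSelfAdjoint (A x)) {V : Set X} {δ : ℝ}
    (h : IsAdaptedSA E A V δ) : E.ContinuousField V fun x => lowPart (A x) δ := by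
  obtain ⟨N, hN, hN'⟩ := h.continuous_induced
  refine hN'.congr fun x hx => ?_
  obtain ⟨T, hTs, hT⟩ := exists_isBoundedTransform (hA x)
  exact eq_of_mem_graph (lowPart_mem_graph hT hTs (h.enhanced x hx).notMem
    (h.enhanced x hx).neg_notMem) (hN x hx)

/-- Continuity of a field of spectral projections. -/
theorem IsAdaptedSA.continuous_specProj (hA : ∀ x, IsSelfAdjoint (A x)) {V : Set X} {δ a b : ℝ}
    (h : IsAdaptedSA E A V δ) (ha : ∀ x ∈ V, (a : ℂ) ∉ opSpectrum (A x))
    (hb : ∀ x ∈ V, (b : ℂ) ∉ opSpectrum (A x)) (ha0 : a ≠ 0) (hb0 : b ≠ 0) (hδa : -δ ≤ a)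
    (haδ : a ≤ δ) (hδb : -δ ≤ b) (hbδ : b ≤ δ) :
    E.ContinuousField V fun x => specProj (A x) a b := by
  have h1 : E.ContinuousField V fun x => cfc (indicator (Icc a b) 1) (lowPart (A x) δ) := by
    refine (h.continuous_lowPart hA).cfc (O := {a, b}ᶜ) (fun x _ => cfc_predicate _ _)
      (toFinite {a, b}).isClosed.isOpen_compl
      (continuousOn_indicator_Icc (f := 1) continuousOn_const (by simp) (by simp)) ?_
    intro x hx s hs hs'
    obtain ⟨T, hTs, hT⟩ := exists_isBoundedTransform (hA x)
    have h2 := mem_spectrum_lowPart_iff hT hTs (h.enhanced x hx).notMem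
      (h.enhanced x hx).neg_notMem (z := s)
    rcases hs' with rfl | rfl
    · exact ha x hx ((h2 ha0 hδa haδ).1 hs)
    · exact hb x hx ((h2 hb0 hδb hbδ).1 hs)
  refine (h.continuous_proj.mul h1).congr fun x hx => ?_
  obtain ⟨T, hTs, hT⟩ := exists_isBoundedTransform (hA x)
  exact specProj_eq_lowPart hT hTs (h.enhanced x hx).notMem (h.enhanced x hx).neg_notMem
    (ha x hx) (hb x hx) ha0 hb0 hδa hbδ

/-- Near a given morphism of X_U both index sets are constant, hence so are the two numbers e ≤ e'.
The morphism is then described by spectral projections with fixed end points. -/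
theorem IsIndexFunctorSA.continuous (hA : ∀ x, IsSelfAdjoint (A x))
    (hU : ∀ a, IsAdaptedSA E A (U a) (ε a)) {F : ∀ x, CoverFiber U x ⥤ SubspaceObj (E.Fiber x)}
    (hF : IsIndexFunctorSA E A U ε F) : Continuous (sigmaFunctor F).mapArrow.obj := by
  refine continuous_induced_rng.2 (E.continuous_glueTopology (fun _ => subspaceCoord) _ ?_ ?_)
  · have h1 : (fun f : Arrow (CoverCat U) =>
        ((arrowFiber ∘ (sigmaFunctor F).mapArrow.obj) f).1) = fun f => f.left.1 := by
      funext f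
      obtain ⟨_, _, ⟨f⟩⟩ := f
      rfl
    rw [h1]
    exact continuous_coverArrow_proj
  · intro f₀
    have key : ∃ σ : CoverFiber U f₀.left.1, f₀.left.2 ≤ σ ∧ σ.carrier = f₀.right.2.carrier := by
      obtain ⟨_, _, ⟨f⟩⟩ := f₀
      exact ⟨_, f.le, rfl⟩
    obtain ⟨σ, hσ, hσ'⟩ := key
    let e := f₀.left.2.min ε
    let e' := σ.min ε
    have hee' : e ≤ e' := CoverFiber.min_le_min hσ
    have he0 : 0 < e := (isEnhancedSA_min hU f₀.left.2).pos
    let V : Set X := {x | ∀ a ∈ f₀.left.2.carrier, x ∈ U a}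
    obtain ⟨a, ha, hae, -⟩ := f₀.left.2.exists_min_eq (ε := ε)
    obtain ⟨a', ha', hae', -⟩ := σ.exists_min_eq (ε := ε)
    have had : IsAdaptedSA E A (U a) e := by
      rw [show e = ε a from hae]
      exact hU a
    have had' : IsAdaptedSA E A (U a') e' := by
      rw [show e' = ε a' from hae']
      exact hU a'
    have hV : V ⊆ U a := fun x hx => hx a ha
    have hV' : V ⊆ U a' := fun x hx => hx a' (hσ ha')
    -- All three projections are supported in the larger window, so adaptedness for e' alone yields
    -- their continuity.
    have had2 : IsAdaptedSA E A V e' :=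
      ⟨fun x hx => had'.enhanced x (hV' hx), had'.continuous_proj.mono hV',
        had'.continuous_induced.imp fun T hT => ⟨fun x hx => hT.1 x (hV' hx), hT.2.mono hV'⟩⟩
    have n1 : ∀ x ∈ V, (e : ℂ) ∉ opSpectrum (A x) := fun x hx => (had.enhanced x (hV hx)).notMem
    have n2 : ∀ x ∈ V, ((-e : ℝ) : ℂ) ∉ opSpectrum (A x) := fun x hx =>
      (had.enhanced x (hV hx)).neg_notMem
    have n3 : ∀ x ∈ V, (e' : ℂ) ∉ opSpectrum (A x) := fun x hx => (had2.enhanced x hx).notMem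
    have n4 : ∀ x ∈ V, ((-e' : ℝ) : ℂ) ∉ opSpectrum (A x) := fun x hx =>
      (had2.enhanced x hx).neg_notMem
    refine ⟨_, mem_nhds_coverArrow f₀, V, ![fun x => specProj (A x) (-e') (-e),
      fun x => specProj (A x) (-e) e, fun x => specProj (A x) e e'], ?_, ?_⟩
    · intro k
      fin_cases k
      · exact had2.continuous_specProj hA n4 n2 (by linarith) (by linarith) (by linarith)
          (by linarith) (by linarith) (by linarith)
      · exact had2.continuous_specProj hA n2 n1 (by linarith) (by linarith) (by linarith)
          (by linarith) (by linarith) (by linarith)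
      · exact had2.continuous_specProj hA n1 n3 (by linarith) (by linarith) (by linarith)
          (by linarith) (by linarith) (by linarith)
    · rintro ⟨⟨x, τ⟩, ⟨_, _⟩, ⟨f⟩⟩ ⟨h1, h2⟩
      rename_i ρ
      have hx : x ∈ V := fun a ha => τ.mem a (by rw [h1]; exact ha)
      refine ⟨hx, fun k => ?_⟩
      have h3 : τ.min ε = e := CoverFiber.min_congr h1
      have h4 : ρ.min ε = e' := CoverFiber.min_congr (h2.trans hσ'.symm)
      obtain ⟨T, hTs, hT⟩ := exists_isBoundedTransform (hA x)
      have h5 := subspaceCoord_mk ((F x).map f)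
        (isStarProjection_specProj hT hTs (n4 x hx) (n2 x hx))
        (isStarProjection_specProj hT hTs (n2 x hx) (n1 x hx))
        (isStarProjection_specProj hT hTs (n1 x hx) (n3 x hx))
        (by rw [← h3, ← h4]; exact hF.neg_eq x τ ρ f) (by rw [← h3]; exact hF.obj_eq x τ)
        (by rw [← h3, ← h4]; exact hF.pos_eq x τ ρ f)
      refine (congrFun h5 k).trans ?_
      fin_cases k <;> rfl

end SelfAdjointFamily

/-! ### The index functor of a family of operators with normal bounded transforms -/

section NormalFamily

variable {X : Type u} [TopologicalSpace X] {H : Type v} [NormedAddCommGroup H]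
  [InnerProductSpace ℂ H] [CompleteSpace H] {E : HilbertBundle.{u, v, w} X H}
  {B : ∀ x, E.Fiber x →ₗ.[ℂ] E.Fiber x} {ι : Type u} {U : ι → Set X} {ε : ι → ℝ}
  {b : ∀ x, E.Fiber x →L[ℂ] E.Fiber x}

theorem IsAdapted.isNormalEnhanced (hn : ∀ x, IsStarNormal (b x))
    (hb : ∀ x, IsBoundedTransform (B x) (b x)) {V : Set X} {δ : ℝ} (h : IsAdapted E B V δ) {x : X}
    (hx : x ∈ V) : IsNormalEnhanced (B x) (b x) δ :=
  ⟨hb x, hn x, (h.enhanced x hx).pos, (h.enhanced x hx).notMem, (h.enhanced x hx).finite⟩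

theorem isNormalEnhanced_min (hn : ∀ x, IsStarNormal (b x))
    (hb : ∀ x, IsBoundedTransform (B x) (b x))
    (hU : ∀ a, IsAdapted E B (U a) (ε a)) {x : X} (σ : CoverFiber U x) :
    IsNormalEnhanced (B x) (b x) (σ.min ε) := by
  obtain ⟨a, -, h, hx⟩ := σ.exists_min_eq (ε := ε)
  rw [h]
  exact (hU a).isNormalEnhanced hn hb hx

theorem IsNormalEnhanced.starProjection_specIm {K : Type*} [NormedAddCommGroup K]
    [InnerProductSpace ℂ K] [CompleteSpace K] {B : K →ₗ.[ℂ] K} {b : K →L[ℂ] K} {δ : ℝ}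
    (h : IsNormalEnhanced B b δ) (V : Submodule ℂ K) [V.HasOrthogonalProjection]
    (hV : V = specIm (absOp B) 0 δ) : V.starProjection = specProj (absOp B) 0 δ :=
  starProjection_range_eq (isStarProjection_absOp h.transform h.notMem) _ hV

theorem exists_isIndexFunctor (hn : ∀ x, IsStarNormal (b x))
    (hb : ∀ x, IsBoundedTransform (B x) (b x)) (hU : ∀ a, IsAdapted E B (U a) (ε a)) :
    ∃ F : ∀ x, CoverFiber U x ⥤ PairObj (E.Fiber x), IsIndexFunctor E B U ε F := by
  have he := fun {x : X} (σ : CoverFiber U x) => isNormalEnhanced_min hn hb hU σ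
  refine ⟨fun x =>
    { obj := fun τ =>
        { fst := specIm (absOp (B x)) 0 (τ.min ε)
          snd := specIm (absOp (B x)) 0 (τ.min ε)
          finite_fst := (he τ).finite
          finite_snd := (he τ).finite }
      map := fun {τ σ} f =>
        { iso := polarPart (B x) * specProj (absOp (B x)) (τ.min ε) (σ.min ε)
          initial_eq := by
            have := (he τ).finite
            have := (he σ).finite
            rw [((he τ).star_polarPart_mul (he τ).pos (he τ).notMem (he σ).notMem).1,
              (he τ).starProjection_specIm _ rfl, (he σ).starProjection_specIm _ rfl,
              eq_sub_iff_add_eq, add_comm]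
            exact absOp_specProj_add (hb x) (he τ).pos (CoverFiber.min_le_min f.le) (he τ).notMem
              (he σ).notMem
          final_eq := by
            have := (he τ).finite
            have := (he σ).finite
            rw [((he τ).star_polarPart_mul (he τ).pos (he τ).notMem (he σ).notMem).2,
              (he τ).starProjection_specIm _ rfl, (he σ).starProjection_specIm _ rfl,
              eq_sub_iff_add_eq, add_comm]
            exact absOp_specProj_add (hb x) (he τ).pos (CoverFiber.min_le_min f.le) (he τ).notMem
              (he σ).notMem }
      map_id := fun τ => PairHom.ext ((congrArg (polarPart (B x) * ·)
        (specProj_self (hb x).absOp (isSelfAdjoint_abs (b x)) (he τ).notMem)).trans (mul_zero _))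
      map_comp := fun {ρ σ τ} f g => PairHom.ext ((congrArg (polarPart (B x) * ·)
        (specProj_add (hb x).absOp (isSelfAdjoint_abs (b x)) (CoverFiber.min_le_min f.le)
          (CoverFiber.min_le_min g.le) (he ρ).notMem (he σ).notMem (he τ).notMem).symm).trans
        (mul_add _ _ _)) }, ?_⟩
  refine ⟨fun _ _ => rfl, fun x τ => ?_, fun _ _ _ _ => rfl⟩
  rw [absOp_adjoint (hb x) (hn x)]

theorem IsAdapted.continuous_lowPolar (hn : ∀ x, IsStarNormal (b x))
    (hb : ∀ x, IsBoundedTransform (B x) (b x)) {V : Set X} {δ : ℝ}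
    (h : IsAdapted E B V δ) : E.ContinuousField V fun x => lowPolar (B x) δ := by
  obtain ⟨N, hN, hN'⟩ := h.continuous_induced
  exact hN'.congr fun x hx => ((h.isNormalEnhanced hn hb hx).eq_lowPolar (hN x hx)).symm

/-- The polar part itself need not vary continuously, but on a window away from zero it is a
function of N = B P_[0,δ](|B|), which does; a², δ² stay off the spectrum of N*N. -/
theorem IsAdapted.continuous_polarPart_mul (hn : ∀ x, IsStarNormal (b x))
    (hb : ∀ x, IsBoundedTransform (B x) (b x)) {V : Set X} {δ a : ℝ} (h : IsAdapted E B V δ)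
    (ha : ∀ x ∈ V, (a : ℂ) ∉ opSpectrum (absOp (B x))) (ha0 : 0 < a) (haδ : a ≤ δ) :
    E.ContinuousField V fun x => polarPart (B x) * specProj (absOp (B x)) a δ := by
  have h1 := h.continuous_lowPolar hn hb
  have h2 : E.ContinuousField V fun x =>
      cfc (indicator (Icc (a ^ 2) (δ ^ 2)) fun s => (√s)⁻¹)
        (star (lowPolar (B x) δ) * lowPolar (B x) δ) := by
    refine (h1.star.mul h1).cfc (O := {a ^ 2, δ ^ 2}ᶜ) (fun x _ => IsSelfAdjoint.star_mul_self _)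
      (toFinite {a ^ 2, δ ^ 2}).isClosed.isOpen_compl
      (continuousOn_indicator_Icc (ContinuousOn.inv₀ (by fun_prop) fun s hs =>
        (Real.sqrt_pos.2 ((pow_pos ha0 2).trans_le hs.1)).ne') (by simp) (by simp)) ?_
    intro x hx s hs hs'
    have h3 := h.isNormalEnhanced hn hb hx
    rcases hs' with rfl | rfl
    · exact h3.sq_notMem_spectrum ha0 haδ (ha x hx) hs
    · exact h3.sq_notMem_spectrum h3.pos le_rfl h3.notMem hs
  refine (h1.mul h2).congr fun x hx => ?_
  have h3 := h.isNormalEnhanced hn hb hx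
  exact h3.polarPart_mul_specProj ha0 haδ le_rfl (ha x hx) h3.notMem

theorem IsIndexFunctor.continuous (hn : ∀ x, IsStarNormal (b x))
    (hb : ∀ x, IsBoundedTransform (B x) (b x)) (hU : ∀ a, IsAdapted E B (U a) (ε a))
    {F : ∀ x, CoverFiber U x ⥤ PairObj (E.Fiber x)} (hF : IsIndexFunctor E B U ε F) :
    Continuous (sigmaFunctor F).mapArrow.obj := by
  refine continuous_induced_rng.2 (E.continuous_glueTopology (fun _ => pairCoord) _ ?_ ?_)
  · have h1 : (fun f : Arrow (CoverCat U) =>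
        ((arrowFiber ∘ (sigmaFunctor F).mapArrow.obj) f).1) = fun f => f.left.1 := by
      funext f
      obtain ⟨_, _, ⟨f⟩⟩ := f
      rfl
    rw [h1]
    exact continuous_coverArrow_proj
  · intro f₀
    have key : ∃ σ : CoverFiber U f₀.left.1, f₀.left.2 ≤ σ ∧ σ.carrier = f₀.right.2.carrier := by
      obtain ⟨_, _, ⟨f⟩⟩ := f₀
      exact ⟨_, f.le, rfl⟩
    obtain ⟨σ, hσ, hσ'⟩ := key
    let e := f₀.left.2.min ε
    let e' := σ.min ε
    have hee' : e ≤ e' := CoverFiber.min_le_min hσ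
    have he0 : 0 < e := (isNormalEnhanced_min hn hb hU f₀.left.2).pos
    let V : Set X := {x | ∀ a ∈ f₀.left.2.carrier, x ∈ U a}
    obtain ⟨a, ha, hae, -⟩ := f₀.left.2.exists_min_eq (ε := ε)
    obtain ⟨a', ha', hae', -⟩ := σ.exists_min_eq (ε := ε)
    have had : IsAdapted E B (U a) e := by
      rw [show e = ε a from hae]
      exact hU a
    have had' : IsAdapted E B (U a') e' := by
      rw [show e' = ε a' from hae']
      exact hU a'
    have hV : V ⊆ U a := fun x hx => hx a ha
    have hV' : V ⊆ U a' := fun x hx => hx a' (hσ ha')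
    have had2 : IsAdapted E B V e' :=
      ⟨fun x hx => had'.enhanced x (hV' hx), fun x hx => had'.finite_snd x (hV' hx),
        had'.continuous_fst.mono hV', had'.continuous_snd.mono hV',
        had'.continuous_induced.imp fun T hT => ⟨fun x hx => hT.1 x (hV' hx), hT.2.mono hV'⟩⟩
    refine ⟨_, mem_nhds_coverArrow f₀, V, ![fun x => specProj (absOp (B x)) 0 e,
      fun x => specProj (absOp (B x)) 0 e,
      fun x => polarPart (B x) * specProj (absOp (B x)) e e'], ?_, ?_⟩
    · intro k
      fin_cases k
      · exact had.continuous_fst.mono hV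
      · exact had.continuous_fst.mono hV
      · exact had2.continuous_polarPart_mul hn hb
          (fun x hx => (had.enhanced x (hV hx)).notMem) he0 hee'
    · rintro ⟨⟨x, τ⟩, ⟨_, _⟩, ⟨f⟩⟩ ⟨h1, h2⟩
      rename_i ρ
      have hx : x ∈ V := fun a ha => τ.mem a (by rw [h1]; exact ha)
      refine ⟨hx, fun k => ?_⟩
      have h3 : τ.min ε = e := CoverFiber.min_congr h1
      have h4 : ρ.min ε = e' := CoverFiber.min_congr (h2.trans hσ'.symm)
      have h5 := had.isNormalEnhanced hn hb (hV hx)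
      have h6 := h5.starProjection_specIm ((F x).obj τ).fst (by rw [← h3]; exact hF.fst_eq x τ)
      have h7 := h5.starProjection_specIm ((F x).obj τ).snd
        (by rw [← h3, ← absOp_adjoint (hb x) (hn x)]; exact hF.snd_eq x τ)
      have h8 := hF.iso_eq x τ ρ f
      rw [h3, h4] at h8
      fin_cases k
      · exact h6
      · exact h7
      · exact h8

end NormalFamily

/-! ### The operators `cos t + i A sin t` -/

section Operators

set_option linter.unusedSectionVars false

variable {K : Type*} [NormedAddCommGroup K] [InnerProductSpace ℂ K] [CompleteSpace K]

theorem sq_le_sq_mul_iff {a s : ℝ} (ha : 0 ≤ a) :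
    s ^ 2 ≤ a ^ 2 * (1 - s ^ 2) ↔ |s| ≤ toDisc a := by
  have h1 : 0 ≤ toDisc a := div_nonneg ha (Real.sqrt_nonneg _)
  rw [← sq_le_sq₀ (abs_nonneg s) h1, sq_abs, toDisc, div_pow, Real.sq_sqrt (by positivity),
    le_div_iff₀ (by positivity)]
  constructor <;> intro h <;> linarith

theorem sq_lt_sq_mul_iff {a s : ℝ} (ha : 0 ≤ a) :
    s ^ 2 < a ^ 2 * (1 - s ^ 2) ↔ |s| < toDisc a := by
  have h1 : 0 ≤ toDisc a := div_nonneg ha (Real.sqrt_nonneg _)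
  rw [← sq_lt_sq₀ (abs_nonneg s) h1, sq_abs, toDisc, div_pow, Real.sq_sqrt (by positivity),
    lt_div_iff₀ (by positivity)]
  constructor <;> intro h <;> linarith

/-- The bounded transform of a bounded self-adjoint operator. -/
theorem isBoundedTransform_toPMap {S : K →L[ℂ] K} (hS : IsSelfAdjoint S) :
    IsBoundedTransform ((S : K →ₗ[ℂ] K).toPMap ⊤) (cfc toDisc S) := by
  have hc := continuous_toDisc
  have hg : Continuous fun s : ℝ => (√(1 + s ^ 2))⁻¹ :=
    Continuous.inv₀ (by fun_prop) fun s => by positivity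
  have h1 : cfc toDisc S = S * cfc (fun s : ℝ => (√(1 + s ^ 2))⁻¹) S := by
    nth_rw 2 [← cfc_id' ℝ S]
    rw [← cfc_mul (fun s => s) _ S continuousOn_id hg.continuousOn]
    rfl
  have hsq : ∀ s : ℝ, 1 - toDisc s * toDisc s = (√(1 + s ^ 2))⁻¹ * (√(1 + s ^ 2))⁻¹ := by
    intro s
    have h2 : (0 : ℝ) < 1 + s ^ 2 := by positivity
    rw [toDisc, ← mul_inv, div_mul_div_comm, Real.mul_self_sqrt h2.le]
    field_simp
    ring
  have hd : defect (cfc toDisc S) = cfc (fun s : ℝ => (√(1 + s ^ 2))⁻¹) S := by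
    refine CFC.sqrt_unique ?_ (cfc_nonneg fun s _ => by positivity)
    rw [IsSelfAdjoint.star_eq (cfc_predicate _ _),
      ← cfc_mul _ _ S hg.continuousOn hg.continuousOn, ← cfc_mul .., ← cfc_one ℝ S, ← cfc_sub ..]
    exact cfc_congr fun s _ => (hsq s).symm
  have hu : Function.Surjective ⇑(cfc (fun s : ℝ => (√(1 + s ^ 2))⁻¹) S) := by
    refine (ContinuousLinearMap.isUnit_iff_bijective.1
      ((isUnit_cfc_iff _ S hg.continuousOn hS).2 fun s _ => ?_)).2
    positivity
  refine ⟨norm_cfc_le zero_le_one fun s _ => ?_, ?_⟩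
  · rw [Real.norm_eq_abs, abs_le]
    exact ⟨(neg_one_lt_toDisc s).le, (toDisc_lt_one s).le⟩
  · ext ⟨v, y⟩
    rw [mem_transformGraph, LinearPMap.mem_graph_iff, hd]
    constructor
    · rintro ⟨z, rfl, rfl⟩
      obtain ⟨w, hw⟩ := hu z
      refine ⟨w, hw, ?_⟩
      rw [h1]
      exact congrArg S hw
    · rintro ⟨w, rfl, rfl⟩
      refine ⟨⟨_, trivial⟩, rfl, ?_⟩
      rw [h1]
      rfl

theorem isSelfAdjoint_of_isBoundedTransform {A : K →ₗ.[ℂ] K} {T : K →L[ℂ] K}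
    (hT : IsBoundedTransform A T) (hsa : IsSelfAdjoint T) : IsSelfAdjoint A := by
  have h : A†.graph = A.graph := by
    rw [(hT.adjoint hsa.isStarNormal).2, hT.2, hsa.star_eq]
  exact LinearPMap.eq_of_eq_graph h

theorem mem_rotated_graph {A : K →ₗ.[ℂ] K} {t : ℝ} (ht : Real.sin t ≠ 0) {v y : K} :
    (v, y) ∈ (rotated A t).graph ↔ ∃ u, (v, u) ∈ A.graph ∧
      y = (Real.cos t : ℂ) • v + (Complex.I * (Real.sin t : ℂ)) • u := by
  rw [rotated, if_neg ht, LinearPMap.mem_graph_iff]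
  constructor
  · rintro ⟨⟨z, hz⟩, rfl, rfl⟩
    exact ⟨_, A.mem_graph ⟨z, hz.2⟩, rfl⟩
  · rintro ⟨u, hu, rfl⟩
    obtain ⟨z, rfl, rfl⟩ := (LinearPMap.mem_graph_iff _).1 hu
    exact ⟨⟨z, trivial, z.2⟩, rfl, rfl⟩

/-- The function of `s = a / √(1 + a²)` equal to `(c² + d² a²) / (1 + a²)`. -/
def rotSq (c d s : ℝ) : ℝ := c ^ 2 * (1 - s ^ 2) + d ^ 2 * s ^ 2

theorem continuous_rotSq (c d : ℝ) : Continuous (rotSq c d) := by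
  unfold rotSq
  fun_prop

theorem rotSq_nonneg (c d : ℝ) {s : ℝ} (hs : 0 ≤ 1 - s ^ 2) : 0 ≤ rotSq c d s :=
  add_nonneg (mul_nonneg (sq_nonneg c) hs) (by positivity)

theorem one_sub_sq_add_rotSq_pos (c : ℝ) {d s : ℝ} (hd : d ≠ 0) (hs : 0 ≤ 1 - s ^ 2) :
    0 < 1 - s ^ 2 + rotSq c d s := by
  have h3 : 0 ≤ c ^ 2 * (1 - s ^ 2) := mul_nonneg (sq_nonneg c) hs
  unfold rotSq
  rcases eq_or_ne s 0 with rfl | h0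
  · nlinarith
  · have : 0 < d ^ 2 * s ^ 2 := by positivity
    linarith

/-- The bounded transform of `cos t + i A sin t`. -/
theorem exists_isBoundedTransform_rotated {A : K →ₗ.[ℂ] K} {T : K →L[ℂ] K}
    (hT : IsBoundedTransform A T) (hsa : IsSelfAdjoint T) {t : ℝ} (ht : Real.sin t ≠ 0) :
    ∃ b, IsStarNormal b ∧ IsBoundedTransform (rotated A t) b ∧
      CFC.abs b = cfc (fun s => √(rotSq (Real.cos t) (Real.sin t) s /
        (1 - s ^ 2 + rotSq (Real.cos t) (Real.sin t) s))) T := by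
  set c := Real.cos t with hc
  set d := Real.sin t with hd
  have hsub := spectrum_subset_Icc hT.1
  have hone : ∀ s ∈ spectrum ℝ T, 0 ≤ 1 - s ^ 2 := fun s hs => by
    nlinarith [(hsub hs).1, (hsub hs).2]
  obtain ⟨e, hee, hec, he0, hD⟩ : ∃ e, e = rotSq c d ∧ Continuous e ∧
      (∀ s ∈ spectrum ℝ T, 0 ≤ e s) ∧ (∀ s ∈ spectrum ℝ T, 0 < 1 - s ^ 2 + e s) :=
    ⟨_, rfl, continuous_rotSq c d, fun s hs => rotSq_nonneg c d (hone s hs), fun s hs =>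
      one_sub_sq_add_rotSq_pos c ht (hone s hs)⟩
  -- The graph of cos t + iA sin t consists of the pairs (Sw, pw) with p = cS + idT. This
  -- parameterization is not isometric: S² + p*p = 1 - s² + e(s) at the point s. The invertible
  -- operator g(T) rescales it, giving b = pG with defect SG.
  obtain ⟨g, hgdef⟩ : ∃ g : ℝ → ℝ, g = fun s => (√(1 - s ^ 2 + e s))⁻¹ := ⟨_, rfl⟩
  have hgc : ContinuousOn g (spectrum ℝ T) := by
    rw [hgdef]
    exact ContinuousOn.inv₀ (by fun_prop) fun s hs => (Real.sqrt_pos.2 (hD s hs)).ne'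
  have hgg : ∀ s ∈ spectrum ℝ T, g s * g s = (1 - s ^ 2 + e s)⁻¹ := fun s hs => by
    rw [hgdef, ← mul_inv, Real.mul_self_sqrt (hD s hs).le]
  have hg0 : ∀ s ∈ spectrum ℝ T, 0 < g s := fun s hs => by
    rw [hgdef]
    exact inv_pos.2 (Real.sqrt_pos.2 (hD s hs))
  have hgu : Function.Surjective ⇑(cfc g T) :=
    (ContinuousLinearMap.isUnit_iff_bijective.1
      ((isUnit_cfc_iff g T hgc hsa).2 fun s hs => (hg0 s hs).ne')).2
  set S := defect T with hSdef
  have hS : S = cfc (fun s => √(1 - s ^ 2)) T := defect_eq_cfc hT.1 hsa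
  set G := cfc g T with hG
  have hGs : star G = G := IsSelfAdjoint.star_eq (cfc_predicate _ _)
  have hSs : star S = S := (isSelfAdjoint_defect T).star_eq
  have hTS : T * S = S * T := by
    rw [hS]
    exact ((Commute.refl T).cfc_real _).symm.eq
  have hTG : Commute T G := ((Commute.refl T).cfc_real _).symm
  have hSG : Commute S G := by
    rw [hS]
    exact cfc_commute_cfc _ _ _
  let p := (c : ℂ) • S + (Complex.I * (d : ℂ)) • T
  let p' := (c : ℂ) • S - (Complex.I * (d : ℂ)) • T
  have hpG : Commute p G := (hSG.smul_left _).add_left (hTG.smul_left _)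
  have hpG' : Commute p' G := (hSG.smul_left _).sub_left (hTG.smul_left _)
  have hps : star p = p' := by
    simp only [p, p', star_add, star_smul, hSs, hsa.star_eq, RCLike.star_def, map_mul,
      Complex.conj_I, Complex.conj_ofReal, neg_mul, neg_smul, sub_eq_add_neg]
  have hE : cfc e T = ((c : ℂ) ^ 2) • (S * S) + ((d : ℂ) ^ 2) • (T * T) := by
    have h1 : S * S = cfc (fun s : ℝ => 1 - s ^ 2) T := by
      rw [hS, ← cfc_mul ..]
      exact cfc_congr fun s hs => Real.mul_self_sqrt (hone s hs)
    have h2 : T * T = cfc (fun s : ℝ => s ^ 2) T := by rw [cfc_pow_id .., sq]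
    rw [h1, h2, ← Complex.ofReal_pow, ← Complex.ofReal_pow, Complex.coe_smul, Complex.coe_smul,
      ← cfc_const_mul .., ← cfc_const_mul .., ← cfc_add .., hee]
    rfl
  have hI : (Complex.I * (d : ℂ)) * (Complex.I * (d : ℂ)) = -(d : ℂ) ^ 2 := by
    linear_combination (d : ℂ) ^ 2 * Complex.I_mul_I
  have hpp : p' * p = cfc e T ∧ p * p' = cfc e T := by
    rw [hE]
    simp only [p, p', add_mul, mul_add, sub_mul, mul_sub, smul_mul_smul_comm, hTS, hI]
    constructor <;> module
  have hbs : star (p * G) = p' * G := by rw [star_mul, hGs, hps, hpG'.eq]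
  have hbb : star (p * G) * (p * G) = cfc (fun s => e s / (1 - s ^ 2 + e s)) T := by
    rw [hbs, mul_assoc, ← mul_assoc G, ← hpG.eq, mul_assoc p, ← mul_assoc p', hpp.1, hG,
      ← cfc_mul g g T hgc hgc, ← cfc_mul e (fun x => g x * g x) T hec.continuousOn (hgc.mul hgc)]
    refine cfc_congr fun s hs => ?_
    simp only [hgg s hs, div_eq_mul_inv]
  have hqc : ContinuousOn (fun s => e s / (1 - s ^ 2 + e s)) (spectrum ℝ T) :=
    hec.continuousOn.div (by fun_prop) fun s hs => (hD s hs).ne'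
  have hq0 : ∀ s ∈ spectrum ℝ T, 0 ≤ e s / (1 - s ^ 2 + e s) := fun s hs =>
    div_nonneg (he0 s hs) (hD s hs).le
  have hdef : defect (p * G) = S * G := by
    have hSGc : S * G = cfc (fun s => √(1 - s ^ 2) * g s) T := by
      rw [hS, hG, ← cfc_mul _ _ T (by fun_prop) hgc]
    refine CFC.sqrt_unique ?_ ?_
    · have h0 : ContinuousOn (fun s => √(1 - s ^ 2) * g s) (spectrum ℝ T) :=
        ContinuousOn.mul (by fun_prop) hgc
      rw [hbb, hSGc, ← cfc_mul _ _ T h0 h0, ← cfc_one ℝ T, ← cfc_sub 1 _ T continuousOn_const hqc]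
      refine cfc_congr fun s hs => ?_
      have h1 := Real.mul_self_sqrt (hone s hs)
      have h2 := hgg s hs
      have h3 := (hD s hs).ne'
      calc √(1 - s ^ 2) * g s * (√(1 - s ^ 2) * g s)
          = (√(1 - s ^ 2) * √(1 - s ^ 2)) * (g s * g s) := by ring
        _ = _ := by
          rw [h1, h2]
          simp only [Pi.one_apply]
          field_simp
          ring
    · rw [hSGc]
      exact cfc_nonneg fun s hs => mul_nonneg (Real.sqrt_nonneg _) (hg0 s hs).le
  refine ⟨p * G, ⟨?_⟩, ⟨?_, ?_⟩, ?_⟩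
  · show star (p * G) * (p * G) = (p * G) * star (p * G)
    rw [hbs, mul_assoc, ← mul_assoc G, ← hpG.eq, mul_assoc p, ← mul_assoc p', hpp.1, mul_assoc p,
      ← mul_assoc G, ← hpG'.eq, mul_assoc p', ← mul_assoc p, hpp.2]
  · have h1 : ‖star (p * G) * (p * G)‖ ≤ 1 := by
      rw [hbb]
      refine norm_cfc_le zero_le_one fun s hs => ?_
      rw [Real.norm_of_nonneg (hq0 s hs)]
      exact div_le_one_of_le₀ (by linarith [hone s hs]) (hD s hs).le
    rw [CStarRing.norm_star_mul_self] at h1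
    nlinarith [norm_nonneg (p * G)]
  · ext ⟨v, y⟩
    rw [mem_rotated_graph ht, mem_transformGraph, hdef]
    constructor
    · rintro ⟨u, hu, rfl⟩
      rw [hT.2] at hu
      obtain ⟨w, hw, hw'⟩ := mem_transformGraph.1 hu
      obtain ⟨w', rfl⟩ := hgu w
      simp only at hw hw'
      exact ⟨w', hw, by rw [← hw, ← hw']; rfl⟩
    · rintro ⟨w, rfl, rfl⟩
      exact ⟨T (G w), hT.mem_graph (G w), rfl⟩
  · rw [← hee]
    refine CFC.sqrt_unique ?_ (cfc_nonneg fun s _ => Real.sqrt_nonneg _)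
    have h0 : ContinuousOn (fun s => √(e s / (1 - s ^ 2 + e s))) (spectrum ℝ T) := hqc.sqrt
    rw [hbb]
    refine (cfc_mul _ _ T h0 h0).symm.trans ?_
    exact cfc_congr fun s hs => Real.mul_self_sqrt (hq0 s hs)

end Operators

/-! ### Spectral projections of |cos t + i A sin t| -/

section Operators

set_option linter.unusedSectionVars false

variable {K : Type*} [NormedAddCommGroup K] [InnerProductSpace ℂ K] [CompleteSpace K]

/-- Here cos t = ±1 and the operator is ±1 on all of K; `toDisc` is odd, so the sign disappears in
the absolute value. -/
theorem isBoundedTransform_rotated_of_sin_eq_zero (A : K →ₗ.[ℂ] K) {t : ℝ} (ht : Real.sin t = 0) :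
    ∃ b, IsStarNormal b ∧ IsBoundedTransform (rotated A t) b ∧
      CFC.abs b = algebraMap ℝ (K →L[ℂ] K) (toDisc 1) := by
  have h1 : IsBoundedTransform (rotated A t)
      (cfc toDisc (algebraMap ℝ (K →L[ℂ] K) (Real.cos t))) := by
    have h2 := isBoundedTransform_toPMap (K := K)
      (IsSelfAdjoint.algebraMap (K →L[ℂ] K) (IsSelfAdjoint.all (Real.cos t)))
    rw [rotated, if_pos ht]
    convert h2 using 2
    ext v
    simp [Algebra.algebraMap_eq_smul_one, -Complex.ofReal_cos]
  rw [cfc_algebraMap _ _] at h1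
  have h3 : IsSelfAdjoint (algebraMap ℝ (K →L[ℂ] K) (toDisc (Real.cos t))) :=
    IsSelfAdjoint.algebraMap _ (IsSelfAdjoint.all _)
  refine ⟨_, h3.isStarNormal, h1, ?_⟩
  refine CFC.sqrt_unique ?_ ?_
  · rw [h3.star_eq, ← map_mul, ← map_mul]
    congr 1
    have h4 : Real.cos t = 1 ∨ Real.cos t = -1 := by
      have := Real.sin_sq_add_cos_sq t
      rw [ht] at this
      exact sq_eq_one_iff.1 (by linarith)
    rcases h4 with h4 | h4
    · rw [h4]
    · rw [h4, toDisc_neg, neg_mul_neg]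
  · exact algebraMap_nonneg _ (toDisc_pos one_pos).le

theorem exists_isBoundedTransform_rotated' {A : K →ₗ.[ℂ] K} (hA : IsSelfAdjoint A) (t : ℝ) :
    ∃ b, IsStarNormal b ∧ IsBoundedTransform (rotated A t) b := by
  by_cases ht : Real.sin t = 0
  · obtain ⟨b, h1, h2, -⟩ := isBoundedTransform_rotated_of_sin_eq_zero A ht
    exact ⟨b, h1, h2⟩
  · obtain ⟨T, hTs, hT⟩ := exists_isBoundedTransform hA
    obtain ⟨b, h1, h2, -⟩ := exists_isBoundedTransform_rotated hT hTs ht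
    exact ⟨b, h1, h2⟩

theorem sqrt_div_lt_toDisc_iff {y q a : ℝ} (ha : 0 ≤ a) (hy : 0 ≤ y) (hq : 0 < q + y) :
    √(y / (q + y)) < toDisc a ↔ y < a ^ 2 * q := by
  have h1 : 0 ≤ toDisc a := div_nonneg ha (Real.sqrt_nonneg _)
  rw [← sq_lt_sq₀ (Real.sqrt_nonneg _) h1, Real.sq_sqrt (div_nonneg hy hq.le), toDisc, div_pow,
    Real.sq_sqrt (by positivity), div_lt_div_iff₀ hq (by positivity)]
  constructor <;> intro h <;> nlinarith

theorem toDisc_lt_sqrt_div_iff {y q a : ℝ} (ha : 0 ≤ a) (hy : 0 ≤ y) (hq : 0 < q + y) :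
    toDisc a < √(y / (q + y)) ↔ a ^ 2 * q < y := by
  have h1 : 0 ≤ toDisc a := div_nonneg ha (Real.sqrt_nonneg _)
  rw [← sq_lt_sq₀ h1 (Real.sqrt_nonneg _), Real.sq_sqrt (div_nonneg hy hq.le), toDisc, div_pow,
    Real.sq_sqrt (by positivity), div_lt_div_iff₀ (by positivity) hq]
  constructor <;> intro h <;> nlinarith

theorem continuousOn_rotSq_div {c d : ℝ} (hd : d ≠ 0) {Z : Set ℝ} (hZ : ∀ s ∈ Z, 0 ≤ 1 - s ^ 2) :
    ContinuousOn (fun s => √(rotSq c d s / (1 - s ^ 2 + rotSq c d s))) Z := by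
  have h := continuous_rotSq c d
  have h1 : Continuous fun s => 1 - s ^ 2 + rotSq c d s := by fun_prop
  exact (h.continuousOn.div h1.continuousOn
    fun s hs => (one_sub_sq_add_rotSq_pos c hd (hZ s hs)).ne').sqrt

theorem absOp_specProj_eq_zero {B : K →ₗ.[ℂ] K} {b : K →L[ℂ] K} (hB : IsBoundedTransform B b)
    {δ : ℝ} (h : ∀ s ∈ spectrum ℝ (CFC.abs b), toDisc δ < s) :
    (δ : ℂ) ∉ opSpectrum (absOp B) ∧ specProj (absOp B) 0 δ = 0 := by
  rw [hB.absOp.mem_opSpectrum_iff (isSelfAdjoint_abs b)]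
  refine ⟨fun hδ => (h _ hδ).false, ?_⟩
  rw [hB.absOp.specProj_eq, ← cfc_zero ℝ (CFC.abs b)]
  exact cfc_congr fun s hs => indicator_of_notMem (fun h' => absurd h'.2 (not_le.2 (h s hs))) _

theorem lt_of_mem_spectrum_algebraMap {r s δ : ℝ}
    (hs : s ∈ spectrum ℝ (algebraMap ℝ (K →L[ℂ] K) r)) (hδ : δ < r) : δ < s := by
  rcases subsingleton_or_nontrivial (K →L[ℂ] K) with h | h
  · rw [spectrum.of_subsingleton] at hs
    exact absurd hs (notMem_empty _)
  · rw [spectrum.scalar_eq, mem_singleton_iff] at hs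
    rwa [hs]

/-- The spectrum of the absolute value of `cos t + i A sin t` is bounded below by `|cos t|`. -/
theorem rotated_specProj_eq_zero {A : K →ₗ.[ℂ] K} (hA : IsSelfAdjoint A) {t δ : ℝ} (hδ : 0 < δ)
    (hδt : δ < |Real.cos t|) :
    ((δ : ℂ) ∉ opSpectrum (absOp (rotated A t))) ∧ specProj (absOp (rotated A t)) 0 δ = 0 := by
  by_cases ht : Real.sin t = 0
  · obtain ⟨b, -, h2, h3⟩ := isBoundedTransform_rotated_of_sin_eq_zero A ht
    refine absOp_specProj_eq_zero h2 fun s hs => ?_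
    rw [h3] at hs
    exact lt_of_mem_spectrum_algebraMap hs
      (toDisc_strictMono (hδt.trans_le (Real.abs_cos_le_one t)))
  · obtain ⟨T, hTs, hT⟩ := exists_isBoundedTransform hA
    obtain ⟨b, -, h2, h3⟩ := exists_isBoundedTransform_rotated hT hTs ht
    refine absOp_specProj_eq_zero h2 fun s hs => ?_
    have hone : ∀ s ∈ spectrum ℝ T, 0 ≤ 1 - s ^ 2 := fun s hs => by
      have := spectrum_subset_Icc hT.1 hs
      nlinarith [this.1, this.2]
    rw [h3, cfc_map_spectrum _ T (hf := continuousOn_rotSq_div ht hone)] at hs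
    obtain ⟨s, hs, rfl⟩ := hs
    refine (toDisc_lt_sqrt_div_iff hδ.le (rotSq_nonneg _ _ (hone s hs))
      (one_sub_sq_add_rotSq_pos _ ht (hone s hs))).2 ?_
    have h4 : δ ^ 2 < Real.cos t ^ 2 := by
      rw [← sq_abs (Real.cos t)]
      exact pow_lt_pow_left₀ hδt hδ.le two_ne_zero
    have h5 : 0 < Real.sin t ^ 2 := by positivity
    have h6 := hone s hs
    unfold rotSq
    -- The points s = ±1 correspond to infinite values of A, where the strict inequality comes from
    -- sin² t > 0 instead of δ < |cos t|.
    rcases eq_or_lt_of_le h6 with h7 | h7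
    · have h8 : s ^ 2 = 1 := by linarith
      rw [h8]
      linarith
    · have := mul_lt_mul_of_pos_right h4 h7
      have := mul_nonneg h5.le (sq_nonneg s)
      linarith

/-- The spectral projections of the absolute value of `cos t + i A sin t` for small `cos t`. -/
theorem rotated_specProj_eq {A : K →ₗ.[ℂ] K} (hA : IsSelfAdjoint A) {t δ₁ δ₂ : ℝ} (h0 : 0 < δ₁)
    (h12 : δ₁ < δ₂) (h2 : δ₂ < 1) (ht : Real.cos t ^ 2 < δ₂ ^ 2 - δ₁ ^ 2)
    (hgap : ∀ z : ℝ, δ₁ ≤ |z| → |z| ≤ δ₂ → (z : ℂ) ∉ opSpectrum A) :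
    ((δ₂ : ℂ) ∉ opSpectrum (absOp (rotated A t))) ∧
      specProj (absOp (rotated A t)) 0 δ₂ = specProj A (-δ₂) δ₂ := by
  have hδ2 : 0 < δ₂ := h0.trans h12
  have hcs := Real.sin_sq_add_cos_sq t
  have hsin : Real.sin t ≠ 0 := by
    intro h
    rw [h] at hcs
    nlinarith
  obtain ⟨T, hTs, hT⟩ := exists_isBoundedTransform hA
  obtain ⟨b, -, hb, h3⟩ := exists_isBoundedTransform_rotated hT hTs hsin
  have hone : ∀ s ∈ spectrum ℝ T, 0 ≤ 1 - s ^ 2 := fun s hs => by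
    have := spectrum_subset_Icc hT.1 hs
    nlinarith [this.1, this.2]
  have hcont : ContinuousOn (fun s => √(rotSq (Real.cos t) (Real.sin t) s /
      (1 - s ^ 2 + rotSq (Real.cos t) (Real.sin t) s))) (spectrum ℝ T) :=
    continuousOn_rotSq_div hsin hone
  -- the spectrum of `A` is separated into two parts
  have key : ∀ s ∈ spectrum ℝ T,
      (|s| < toDisc δ₂ ∧ √(rotSq (Real.cos t) (Real.sin t) s /
        (1 - s ^ 2 + rotSq (Real.cos t) (Real.sin t) s)) < toDisc δ₂) ∨
      (toDisc δ₂ < |s| ∧ toDisc δ₂ < √(rotSq (Real.cos t) (Real.sin t) s /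
        (1 - s ^ 2 + rotSq (Real.cos t) (Real.sin t) s))) := by
    intro s hs
    have h4 := hone s hs
    rw [sqrt_div_lt_toDisc_iff hδ2.le (rotSq_nonneg _ _ h4) (one_sub_sq_add_rotSq_pos _ hsin h4),
      toDisc_lt_sqrt_div_iff hδ2.le (rotSq_nonneg _ _ h4) (one_sub_sq_add_rotSq_pos _ hsin h4)]
    have h5 : |s| < toDisc δ₁ ∨ toDisc δ₂ < |s| := by
      by_contra! h
      have hs1 : |s| ∈ Ioo (-1 : ℝ) 1 := ⟨by linarith [abs_nonneg s], h.2.trans_lt (toDisc_lt_one _)⟩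
      have hs2 : s ∈ Ioo (-1 : ℝ) 1 := abs_lt.1 hs1.2
      have h6 : |ofDisc s| = ofDisc |s| := by
        rw [ofDisc, ofDisc, abs_div, abs_of_nonneg (Real.sqrt_nonneg _), sq_abs]
      refine hgap (ofDisc s) ?_ ?_ ?_
      · rw [h6]
        exact (toDisc_le_iff hs1).1 h.1
      · rw [h6]
        exact (le_toDisc_iff hs1).1 h.2
      · rw [hT.mem_opSpectrum_iff hTs, toDisc_ofDisc hs2]
        exact hs
    -- With a = `ofDisc s` and all inequalities multiplied by 1 - s²: if |a| < δ₁, then cos² t + a²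
    -- sin² t ≤ cos² t + δ₁² < δ₂²; if |a| > δ₂, then cos² t + a² sin² t > cos² t + δ₂² sin² t ≥
    -- δ₂², because δ₂ < 1. The form without denominators covers s = ±1 also.
    unfold rotSq
    rcases h5 with h5 | h5
    · refine Or.inl ⟨h5.trans (toDisc_strictMono h12), ?_⟩
      have h6 := (sq_lt_sq_mul_iff h0.le).2 h5
      have h7 : Real.sin t ^ 2 * s ^ 2 ≤ s ^ 2 := by nlinarith [sq_nonneg s, sq_nonneg (Real.cos t)]
      have h8 : δ₁ ^ 2 * (1 - s ^ 2) ≤ (δ₂ ^ 2 - Real.cos t ^ 2) * (1 - s ^ 2) :=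
        mul_le_mul_of_nonneg_right (by linarith) h4
      linarith
    · refine Or.inr ⟨h5, ?_⟩
      have h6 : δ₂ ^ 2 * (1 - s ^ 2) < s ^ 2 := by
        by_contra! h
        exact absurd ((sq_le_sq_mul_iff hδ2.le).1 h) (not_le.2 h5)
      have h7 : 0 < Real.sin t ^ 2 := by positivity
      have h8 := mul_lt_mul_of_pos_left h6 h7
      have h9 : δ₂ ^ 2 * Real.cos t ^ 2 ≤ Real.cos t ^ 2 :=
        mul_le_of_le_one_left (sq_nonneg _) (by nlinarith)
      have h10 : δ₂ ^ 2 * (1 - s ^ 2) ≤ Real.sin t ^ 2 * (δ₂ ^ 2 * (1 - s ^ 2)) +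
          Real.cos t ^ 2 * (1 - s ^ 2) := by
        have h11 := mul_le_mul_of_nonneg_right h9 h4
        have h12 : δ₂ ^ 2 * (1 - s ^ 2) = Real.sin t ^ 2 * (δ₂ ^ 2 * (1 - s ^ 2)) +
          δ₂ ^ 2 * Real.cos t ^ 2 * (1 - s ^ 2) := by
          linear_combination (-(δ₂ ^ 2 * (1 - s ^ 2))) * hcs
        linarith
      linarith
  have hnot : (δ₂ : ℂ) ∉ opSpectrum (absOp (rotated A t)) := by
    rw [hb.absOp.mem_opSpectrum_iff (isSelfAdjoint_abs b), h3, cfc_map_spectrum _ T (hf := hcont)]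
    rintro ⟨s, hs, hs'⟩
    rcases key s hs with h | h
    · exact h.2.ne hs'
    · exact h.2.ne' hs'
  refine ⟨hnot, ?_⟩
  have hnot' := hnot
  rw [hb.absOp.mem_opSpectrum_iff (isSelfAdjoint_abs b)] at hnot'
  have hwin := continuousOn_window hb.absOp (isSelfAdjoint_abs b) (absOp_neg_notMem hb hδ2) hnot
    (f := 1) continuousOn_const
  rw [← absOp_specProj_neg hb hδ2.le, hb.absOp.specProj_eq, hT.specProj_eq]
  rw [h3, cfc_map_spectrum _ T (hf := hcont)] at hwin
  rw [h3, ← cfc_comp _ _ T (hg := hwin) (hf := hcont)]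
  refine cfc_congr fun s hs => ?_
  simp only [Function.comp_apply, indicator_apply, mem_Icc, toDisc_neg, ← abs_le,
    abs_of_nonneg (Real.sqrt_nonneg _)]
  rcases key s hs with h | h
  · rw [if_pos h.1.le, if_pos h.2.le]
    rfl
  · rw [if_neg (not_le.2 h.1), if_neg (not_le.2 h.2)]

/-- At the ends |B| = 1, so P_[0,ε](|B|) is 0 for ε < 1 and the identity for ε ≥ 1; the latter has
infinite rank and is excluded. -/
theorem specIm_rotated_eq_bot (hK : ¬ FiniteDimensional ℂ K) {A : K →ₗ.[ℂ] K}
    (hA : IsSelfAdjoint A) {t ε : ℝ} (ht : Real.sin t = 0) (h : IsEnhanced (rotated A t) ε) :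
    specIm (absOp (rotated A t)) 0 ε = ⊥ := by
  have hcos : |Real.cos t| = 1 := by
    have := Real.sin_sq_add_cos_sq t
    rw [ht] at this
    rw [← sq_eq_sq₀ (abs_nonneg _) zero_le_one, sq_abs]
    linarith
  rcases lt_or_ge ε 1 with h1 | h1
  · rw [specIm, (rotated_specProj_eq_zero hA h.pos (h1.trans_eq hcos.symm)).2]
    exact LinearMap.range_zero
  · exfalso
    obtain ⟨b, -, h2, h3⟩ := isBoundedTransform_rotated_of_sin_eq_zero A ht
    have h4 : specProj (absOp (rotated A t)) 0 ε = 1 := by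
      rw [h2.absOp.specProj_eq, h3, cfc_algebraMap, indicator_of_mem, Pi.one_apply, map_one]
      exact ⟨by rw [toDisc_zero]; exact (toDisc_pos one_pos).le, toDisc_strictMono.monotone h1⟩
    have h5 := h.finite
    rw [specIm, h4] at h5
    have h6 : LinearMap.range ((1 : K →L[ℂ] K) : K →ₗ[ℂ] K) = ⊤ := LinearMap.range_id
    rw [h6] at h5
    exact hK (Submodule.topEquiv.finiteDimensional)

end Operators

/-! ### Finite-polarized replacements -/

section Chi

variable {r : ℝ}

theorem chi_neg (hr : 0 < r) (u : ℝ) : chi r (-u) = -chi r u := by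
  rcases lt_trichotomy u 0 with h | rfl | h
  · simp only [chi]
    rw [if_pos (by linarith), if_neg (not_le.2 h), neg_neg]
  · have : chi r 0 = 0 := by
      simp only [chi]
      rw [if_pos le_rfl, if_pos (by linarith)]
    rw [neg_zero, this, neg_zero]
  · simp only [chi]
    rw [if_neg (by linarith), if_pos h.le, neg_neg]

theorem chi_of_le {u : ℝ} (hu : 0 ≤ u) (h : u ≤ r / 2) : chi r u = u := by
  simp only [chi]
  rw [if_pos hu, if_pos h]

theorem chi_of_ge {u : ℝ} (hr : 0 < r) (h : r ≤ u) : chi r u = 1 := by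
  simp only [chi]
  rw [if_pos (by linarith), if_neg (by linarith)]
  split_ifs with h'
  · have : u = r := le_antisymm h' h
    subst this
    field_simp
    ring
  · rfl

theorem chi_of_abs_le {u : ℝ} (hr : 0 < r) (h : |u| ≤ r / 2) : chi r u = u := by
  rcases le_total 0 u with hu | hu
  · exact chi_of_le hu ((le_abs_self u).trans h)
  · have h1 := chi_of_le (r := r) (neg_nonneg.2 hu) ((neg_le_abs u).trans h)
    rw [chi_neg hr] at h1
    linarith

/-- From r/2 the function increases with slope 2/r - 1 > 0, and from r on it equals 1 > r/2. So
nothing from outside [-r/2, r/2] enters this interval. -/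
theorem lt_chi {u : ℝ} (hr : 0 < r) (hr1 : r < 1) (h : r / 2 < u) : r / 2 < chi r u := by
  simp only [chi]
  rw [if_pos (by linarith), if_neg (not_le.2 h)]
  split_ifs with h'
  · have h1 : 1 < 2 / r := by
      rw [lt_div_iff₀ hr]
      linarith
    have h2 : (2 / r - 1) * (r / 2) = 1 - r / 2 := by
      field_simp
    have h3 : (2 / r - 1) * (r / 2) < (2 / r - 1) * u :=
      mul_lt_mul_of_pos_left h (by linarith)
    linarith
  · linarith

theorem lt_abs_chi {u : ℝ} (hr : 0 < r) (hr1 : r < 1) (h : r / 2 < |u|) : r / 2 < |chi r u| := by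
  rcases lt_abs.1 h with h | h
  · exact (lt_chi hr hr1 h).trans_le (le_abs_self _)
  · have h1 := lt_chi hr hr1 h
    rw [chi_neg hr] at h1
    exact h1.trans_le (neg_le_abs _)

theorem continuous_chi (hr : 0 < r) : Continuous (chi r) := by
  have hg : Continuous fun v : ℝ =>
      if v ≤ r / 2 then v else if v ≤ r then (2 / r - 1) * v + r - 1 else 1 := by
    refine Continuous.if_le continuous_id (Continuous.if_le (by fun_prop) continuous_const
      continuous_id continuous_const ?_) continuous_id continuous_const ?_
    · rintro v rfl
      field_simp
      ring
    · rintro v rfl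
      rw [if_pos (by linarith)]
      field_simp
      ring
  refine Continuous.if_le hg (hg.comp continuous_neg).neg continuous_const continuous_id ?_
  rintro v rfl
  have : (0 : ℝ) ≤ r / 2 := by linarith
  simp [this]

theorem tendsto_chi_atTop (hr : 0 < r) : Tendsto (chi r) atTop (𝓝 1) :=
  tendsto_const_nhds.congr' (by
    filter_upwards [eventually_ge_atTop r] with x hx
    rw [chi_of_ge hr hx])

theorem tendsto_chi_atBot (hr : 0 < r) : Tendsto (chi r) atBot (𝓝 (-1)) :=
  tendsto_const_nhds.congr' (by
    filter_upwards [eventually_le_atBot (-r)] with x hx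
    have := chi_of_ge hr (by linarith : r ≤ -x)
    rw [chi_neg hr] at this
    linarith)

theorem compress_chi_of_mem {s : ℝ} (hs : s ∈ Ioo (-1) 1) :
    compress (chi r) s = chi r (ofDisc s) := by
  rw [compress, if_neg (not_le.2 hs.2), if_neg (not_le.2 hs.1)]
  rfl

theorem compress_chi_of_gt (hr : 0 < r) {s : ℝ} (hs : toDisc r < s) : compress (chi r) s = 1 := by
  by_cases h : 1 ≤ s
  · rw [compress, if_pos h, (tendsto_chi_atTop hr).limUnder_eq]
  · have h1 : s ∈ Ioo (-1 : ℝ) 1 := ⟨(neg_one_lt_toDisc r).trans hs, not_le.1 h⟩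
    rw [compress_chi_of_mem h1, chi_of_ge hr ((toDisc_le_iff h1).1 hs.le)]

theorem compress_chi_of_lt (hr : 0 < r) {s : ℝ} (hs : s < -toDisc r) :
    compress (chi r) s = -1 := by
  have h0 := toDisc_pos hr
  by_cases h : s ≤ -1
  · rw [compress, if_neg (by linarith), if_pos h, (tendsto_chi_atBot hr).limUnder_eq]
  · have h1 : s ∈ Ioo (-1 : ℝ) 1 := ⟨not_le.1 h, by linarith⟩
    have h2 : -s ∈ Ioo (-1 : ℝ) 1 := ⟨by linarith [h1.2], by linarith [h1.1]⟩
    have h3 := chi_of_ge hr ((toDisc_le_iff h2).1 (by linarith))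
    rw [ofDisc_neg, chi_neg hr] at h3
    rw [compress_chi_of_mem h1]
    linarith

/-- Near and beyond ±1 the function is constant, equal to ±1, since `chi r` is constant for |u| ≥ r.
-/
theorem continuous_compress_chi (hr : 0 < r) : Continuous (compress (chi r)) := by
  rw [continuous_iff_continuousAt]
  intro s
  by_cases hs : s ∈ Ioo (-1 : ℝ) 1
  · refine ContinuousAt.congr (f := fun s => chi r (ofDisc s)) ?_ ?_
    · exact (continuous_chi hr).continuousAt.comp (continuousOn_ofDisc.continuousAt
        (isOpen_Ioo.mem_nhds hs))
    · filter_upwards [isOpen_Ioo.mem_nhds hs] with x hx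
      rw [compress_chi_of_mem hx]
  · have h1 : toDisc r < s ∨ s < -toDisc r := by
      by_contra! h
      exact hs ⟨by linarith [toDisc_lt_one r], by linarith [toDisc_lt_one r]⟩
    rcases h1 with h1 | h1
    · refine ContinuousAt.congr (f := fun _ => (1 : ℝ)) continuousAt_const ?_
      filter_upwards [isOpen_Ioi.mem_nhds h1] with x hx
      rw [compress_chi_of_gt hr hx]
    · refine ContinuousAt.congr (f := fun _ => (-1 : ℝ)) continuousAt_const ?_
      filter_upwards [isOpen_Iio.mem_nhds h1] with x hx
      rw [compress_chi_of_lt hr hx]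

theorem abs_toDisc (u : ℝ) : |toDisc u| = toDisc |u| := by
  rw [toDisc, toDisc, abs_div, abs_of_nonneg (Real.sqrt_nonneg _), sq_abs]

theorem abs_ofDisc (s : ℝ) : |ofDisc s| = ofDisc |s| := by
  rw [ofDisc, ofDisc, abs_div, abs_of_nonneg (Real.sqrt_nonneg _), sq_abs]

/-- The function corresponding to the function `χ_r` under the bounded transform is the identity
near zero. -/
theorem toDisc_compress_chi_of_le (hr : 0 < r) {s : ℝ} (hs : |s| ≤ toDisc (r / 2)) :
    toDisc (compress (chi r) s) = s := by
  have h1 : |s| ∈ Ioo (-1 : ℝ) 1 := ⟨by linarith [abs_nonneg s], hs.trans_lt (toDisc_lt_one _)⟩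
  have h2 : s ∈ Ioo (-1 : ℝ) 1 := abs_lt.1 h1.2
  rw [compress_chi_of_mem h2, chi_of_abs_le hr, toDisc_ofDisc h2]
  rw [abs_ofDisc]
  exact (le_toDisc_iff h1).1 hs

theorem lt_abs_toDisc_compress_chi (hr : 0 < r) (hr1 : r < 1) {s : ℝ} (hs : toDisc (r / 2) < |s|) :
    toDisc (r / 2) < |toDisc (compress (chi r) s)| := by
  rw [abs_toDisc]
  refine toDisc_strictMono ?_
  by_cases h : s ∈ Ioo (-1 : ℝ) 1
  · rw [compress_chi_of_mem h]
    refine lt_abs_chi hr hr1 ?_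
    have h1 : |s| ∈ Ioo (-1 : ℝ) 1 := ⟨by linarith [abs_nonneg s], abs_lt.2 h⟩
    rw [abs_ofDisc]
    by_contra! h2
    exact absurd ((le_toDisc_iff h1).2 h2) (not_le.2 hs)
  · have h1 : toDisc r < s ∨ s < -toDisc r := by
      by_contra! h'
      exact h ⟨by linarith [toDisc_lt_one r], by linarith [toDisc_lt_one r]⟩
    rcases h1 with h1 | h1
    · rw [compress_chi_of_gt hr h1, abs_one]
      linarith
    · rw [compress_chi_of_lt hr h1, abs_neg, abs_one]
      linarith

end Chi

/-! ### Spectrum and windows of χ_r(A) -/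

section Operators

variable {K : Type*} [NormedAddCommGroup K] [InnerProductSpace ℂ K] [CompleteSpace K]
  {A : K →ₗ.[ℂ] K} {r : ℝ}

/-- The operator `χ_r(A)` as a partially defined operator. -/
def polarized (r : ℝ) (A : K →ₗ.[ℂ] K) : K →ₗ.[ℂ] K :=
  (funCalc (chi r) A : K →ₗ[ℂ] K).toPMap ⊤

theorem isBoundedTransform_polarized {T : K →L[ℂ] K} (hT : IsBoundedTransform A T)
    (hsa : IsSelfAdjoint T) (hr : 0 < r) :
    IsBoundedTransform (polarized r A) (cfc (fun s => toDisc (compress (chi r) s)) T) := by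
  have hc := continuous_compress_chi hr
  have hc' := continuous_toDisc
  have h1 := isBoundedTransform_toPMap (S := funCalc (chi r) A) (cfc_predicate _ _)
  have h2 : cfc toDisc (funCalc (chi r) A) = cfc (fun s => toDisc (compress (chi r) s)) T := by
    rw [funCalc, hT.boundedTransform_eq]
    exact (cfc_comp _ _ T (hg := hc'.continuousOn) (hf := hc.continuousOn)).symm
  rwa [h2] at h1

theorem isSelfAdjoint_polarized (hA : IsSelfAdjoint A) (hr : 0 < r) :
    IsSelfAdjoint (polarized r A) := by
  obtain ⟨T, hTs, hT⟩ := exists_isBoundedTransform hA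
  exact isSelfAdjoint_of_isBoundedTransform (isBoundedTransform_polarized hT hTs hr)
    (cfc_predicate _ _)

/-- The bounded transform of χ_r(A) is φ(T), where φ is the identity for |s| ≤ `toDisc (r / 2)` and
preserves the complement of this interval. So the spectrum there is unchanged. -/
theorem polarized_mem_opSpectrum_iff (hA : IsSelfAdjoint A) (hr : 0 < r) (hr1 : r < 1) {z : ℝ}
    (hz : |z| ≤ r / 2) : (z : ℂ) ∈ opSpectrum (polarized r A) ↔ (z : ℂ) ∈ opSpectrum A := by
  obtain ⟨T, hTs, hT⟩ := exists_isBoundedTransform hA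
  have hc := continuous_compress_chi hr
  have hc' := continuous_toDisc
  have hz' : |toDisc z| ≤ toDisc (r / 2) := by
    rw [abs_toDisc]
    exact toDisc_strictMono.monotone hz
  rw [(isBoundedTransform_polarized hT hTs hr).mem_opSpectrum_iff (cfc_predicate _ _),
    hT.mem_opSpectrum_iff hTs, cfc_map_spectrum (fun s => toDisc (compress (chi r) s)) T
      (hf := (hc'.comp hc).continuousOn)]
  constructor
  · rintro ⟨s, hs, hs'⟩
    change toDisc (compress (chi r) s) = _ at hs'
    by_cases h : |s| ≤ toDisc (r / 2)
    · rw [toDisc_compress_chi_of_le hr h] at hs'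
      rwa [← hs']
    · have h1 := lt_abs_toDisc_compress_chi hr hr1 (not_le.1 h)
      rw [hs'] at h1
      exact absurd h1 (not_lt.2 hz')
  · intro h
    exact ⟨_, h, toDisc_compress_chi_of_le hr hz'⟩

theorem polarized_cfc_window (hA : IsSelfAdjoint A) (hr : 0 < r) (hr1 : r < 1) {δ : ℝ}
    (hδr : δ ≤ r / 2) (hδ : (δ : ℂ) ∉ opSpectrum (polarized r A))
    (hδ' : ((-δ : ℝ) : ℂ) ∉ opSpectrum (polarized r A)) {f : ℝ → ℝ}
    (hf : ContinuousOn f (Ioo (-1) 1)) :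
    cfc (indicator (Icc (toDisc (-δ)) (toDisc δ)) f) (boundedTransform (polarized r A)) =
      cfc (indicator (Icc (toDisc (-δ)) (toDisc δ)) f) (boundedTransform A) := by
  obtain ⟨T, hTs, hT⟩ := exists_isBoundedTransform hA
  have hc := continuous_compress_chi hr
  have hc' := continuous_toDisc
  have hT' := isBoundedTransform_polarized hT hTs hr
  have h1 := continuousOn_window hT' (cfc_predicate _ _) hδ' hδ hf
  rw [hT'.boundedTransform_eq, hT.boundedTransform_eq]
  rw [cfc_map_spectrum (fun s => toDisc (compress (chi r) s)) T
      (hf := (hc'.comp hc).continuousOn)] at h1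
  rw [← cfc_comp _ (fun s => toDisc (compress (chi r) s)) T (hg := h1)
    (hf := (hc'.comp hc).continuousOn)]
  congr 1
  funext s
  by_cases h : |s| ≤ toDisc (r / 2)
  · rw [Function.comp_apply, toDisc_compress_chi_of_le hr h]
  · have h2 := lt_abs_toDisc_compress_chi hr hr1 (not_le.1 h)
    have h3 := toDisc_strictMono.monotone hδr
    have h4 : ∀ x, toDisc (r / 2) < |x| → x ∉ Icc (toDisc (-δ)) (toDisc δ) := by
      intro x hx hx'
      rw [toDisc_neg, mem_Icc, ← abs_le] at hx'
      linarith
    rw [Function.comp_apply, indicator_of_notMem (h4 _ h2), indicator_of_notMem (h4 _ (not_le.1 h))]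

theorem polarized_specProj (hA : IsSelfAdjoint A) (hr : 0 < r) (hr1 : r < 1) {δ : ℝ}
    (hδr : δ ≤ r / 2) (hδ : (δ : ℂ) ∉ opSpectrum (polarized r A))
    (hδ' : ((-δ : ℝ) : ℂ) ∉ opSpectrum (polarized r A)) :
    specProj (polarized r A) (-δ) δ = specProj A (-δ) δ := by
  have := polarized_cfc_window hA hr hr1 hδr hδ hδ' (f := 1) continuousOn_const
  rw [specProj, specProj, funCalc, funCalc, compress_indicator]
  exact this

theorem polarized_lowPart (hA : IsSelfAdjoint A) (hr : 0 < r) (hr1 : r < 1) {δ : ℝ}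
    (hδr : δ ≤ r / 2) (hδ : (δ : ℂ) ∉ opSpectrum (polarized r A))
    (hδ' : ((-δ : ℝ) : ℂ) ∉ opSpectrum (polarized r A)) :
    lowPart (polarized r A) δ = lowPart A δ :=
  polarized_cfc_window hA hr hr1 hδr hδ hδ' continuousOn_ofDisc

end Operators

/-! ### Spectral windows and adapted pairs -/

section Windows

variable {X : Type u} [TopologicalSpace X] {H : Type v} [NormedAddCommGroup H]
  [InnerProductSpace ℂ H] [CompleteSpace H] {E : HilbertBundle.{u, v, w} X H}
  {A : ∀ x, E.Fiber x →ₗ.[ℂ] E.Fiber x}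

theorem IsAdaptedSA.mono {U V : Set X} {ε : ℝ} (h : IsAdaptedSA E A U ε) (hVU : V ⊆ U) :
    IsAdaptedSA E A V ε :=
  ⟨fun x hx => h.enhanced x (hVU hx), h.continuous_proj.mono hVU,
    h.continuous_induced.imp fun _ hN => ⟨fun x hx => hN.1 x (hVU hx), hN.2.mono hVU⟩⟩

/-- The projection and the low part for δ are functions of the low part for ε; the functions are
continuous off ±δ, which are not in its spectrum. -/
theorem IsAdaptedSA.shrink (hA : ∀ x, IsSelfAdjoint (A x)) {U V : Set X} {ε δ : ℝ}
    (h : IsAdaptedSA E A U ε) (hVU : V ⊆ U) (hδ0 : 0 < δ) (hδε : δ ≤ ε)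
    (hδ : ∀ x ∈ V, (δ : ℂ) ∉ opSpectrum (A x))
    (hδ' : ∀ x ∈ V, ((-δ : ℝ) : ℂ) ∉ opSpectrum (A x)) : IsAdaptedSA E A V δ := by
  choose T hTs hT using fun x => exists_isBoundedTransform (hA x)
  have hV := h.mono hVU
  have hε := fun x hx => (hV.enhanced x hx).notMem
  have hε' := fun x hx => (hV.enhanced x hx).neg_notMem
  refine ⟨fun x hx => ⟨hδ0, hδ x hx, hδ' x hx, ?_⟩,
    hV.continuous_specProj hA hδ' hδ (neg_ne_zero.2 hδ0.ne') hδ0.ne' (by linarith) (by linarith)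
      (by linarith) hδε, fun x => lowPart (A x) δ,
    fun x hx v => lowPart_mem_graph (hT x) (hTs x) (hδ x hx) (hδ' x hx) v, ?_⟩
  · have := (hV.enhanced x hx).finite
    refine Submodule.finiteDimensional_of_le (S₂ := specIm (A x) (-ε) ε) ?_
    rw [specIm, specProj_eq_lowPart (hT x) (hTs x) (hε x hx) (hε' x hx) (hδ' x hx) (hδ x hx)
      (neg_ne_zero.2 hδ0.ne') hδ0.ne' (neg_le_neg hδε) hδε]
    exact range_mul_le _ _
  · have h1 : E.ContinuousField V fun x => cfc (indicator (Icc (-δ) δ) id) (lowPart (A x) ε) := by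
      refine (hV.continuous_lowPart hA).cfc (O := {-δ, δ}ᶜ) (fun x _ => cfc_predicate _ _)
        (toFinite {-δ, δ}).isClosed.isOpen_compl
        (continuousOn_indicator_Icc (f := id) continuousOn_id (by simp) (by simp)) ?_
      rintro x hx s hs (rfl | rfl)
      · exact hδ' x hx ((mem_spectrum_lowPart_iff (hT x) (hTs x) (hε x hx) (hε' x hx)
          (neg_ne_zero.2 hδ0.ne') (by linarith) (by linarith)).1 hs)
      · exact hδ x hx ((mem_spectrum_lowPart_iff (hT x) (hTs x) (hε x hx) (hε' x hx)
          hδ0.ne' (by linarith) (by linarith)).1 hs)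
    exact (hV.continuous_proj.mul h1).congr fun x hx => lowPart_eq_lowPart (hT x) (hTs x) (hε x hx)
      (hε' x hx) (hδ x hx) (hδ' x hx) hδ0 hδε

/-- The pair `(V, δ₂)` is adapted to the family `A`, and the spectra of the operators `A x`, `x ∈ V`,
are disjoint from `[-δ₂, -δ₁] ∪ [δ₁, δ₂]`. -/
structure IsWindow (E : HilbertBundle.{u, v, w} X H) (A : ∀ x, E.Fiber x →ₗ.[ℂ] E.Fiber x)
    (V : Set X) (δ₁ δ₂ : ℝ) : Prop where
  pos : 0 < δ₁
  lt : δ₁ < δ₂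
  gap : ∀ x ∈ V, ∀ z : ℝ, δ₁ ≤ |z| → |z| ≤ δ₂ → (z : ℂ) ∉ opSpectrum (A x)
  adapted : IsAdaptedSA E A V δ₂

theorem IsWindow.mono {V W : Set X} {δ₁ δ₂ : ℝ} (h : IsWindow E A V δ₁ δ₂) (hWV : W ⊆ V) :
    IsWindow E A W δ₁ δ₂ :=
  ⟨h.pos, h.lt, fun x hx => h.gap x (hWV hx), h.adapted.mono hWV⟩

theorem exists_isWindow (hA : ∀ x, IsSelfAdjoint (A x)) {U : Set X} {ε η : ℝ}
    (h : IsAdaptedSA E A U ε) {x : X} (hx : U ∈ 𝓝 x) (hη : 0 < η) :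
    ∃ (δ₁ δ₂ : ℝ) (V : Set X), IsOpen V ∧ x ∈ V ∧ δ₂ < η ∧ IsWindow E A V δ₁ δ₂ := by
  choose T hTs hT using fun x => exists_isBoundedTransform (hA x)
  have hxU := mem_of_mem_nhds hx
  have hxe := h.enhanced x hxU
  have hfin : (spectrum ℝ (lowPart (A x) ε)).Finite := by
    have h1 : FiniteDimensional ℂ
        (LinearMap.range (lowPart (A x) ε : E.Fiber x →ₗ[ℂ] E.Fiber x)) := by
      have := hxe.finite
      refine Submodule.finiteDimensional_of_le (S₂ := specIm (A x) (-ε) ε) ?_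
      rw [← specProj_mul_lowPart (hT x) (hTs x) hxe.notMem hxe.neg_notMem]
      exact range_mul_le _ _
    exact finite_spectrum_of_finiteDimensional_range _
  -- At x the nonzero spectrum of the low part lies beyond δ, so the closed band δ/2 ≤ |z| ≤ δ is
  -- free; any fixed fraction would serve as its lower edge. Upper semicontinuity of the spectrum
  -- keeps the band free nearby.
  obtain ⟨δ, hδ0, hδ, hgap⟩ := exists_gap hfin (lt_min hη hxe.pos)
  have hO : IsOpen {z : ℝ | ¬ (δ / 2 ≤ |z| ∧ |z| ≤ δ)} := by
    have h1 : IsClosed {z : ℝ | δ / 2 ≤ |z| ∧ |z| ≤ δ} :=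
      (isClosed_le continuous_const continuous_abs).inter
        (isClosed_le continuous_abs continuous_const)
    exact h1.isOpen_compl
  have hx₀ : spectrum ℝ (lowPart (A x) ε) ⊆ {z : ℝ | ¬ (δ / 2 ≤ |z| ∧ |z| ≤ δ)} := by
    rintro z hz ⟨h1, h2⟩
    have hz0 : z ≠ 0 := by
      rintro rfl
      rw [abs_zero] at h1
      linarith
    exact absurd h2 (not_le.2 (hgap z hz hz0))
  have hev := (h.continuous_lowPart hA).eventually_spectrum_subset hx hO hx₀
  obtain ⟨V, hV, hVo, hxV⟩ := eventually_nhds_iff.1 (hev.and hx)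
  have hδε : δ ≤ ε := (hδ.trans_le (min_le_right _ _)).le
  have key : ∀ y ∈ V, ∀ z : ℝ, δ / 2 ≤ |z| → |z| ≤ δ → (z : ℂ) ∉ opSpectrum (A y) := by
    intro y hy z h1 h2 h3
    have hye := h.enhanced y (hV y hy).2
    have hz0 : z ≠ 0 := by
      rintro rfl
      rw [abs_zero] at h1
      linarith
    have h4 := abs_le.1 (h2.trans hδε)
    exact (hV y hy).1 ((mem_spectrum_lowPart_iff (hT y) (hTs y) hye.notMem hye.neg_notMem hz0
      h4.1 h4.2).2 h3) ⟨h1, h2⟩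
  refine ⟨δ / 2, δ, V, hVo, hxV, hδ.trans_le (min_le_left _ _), by linarith, by linarith, key, ?_⟩
  refine h.shrink hA (fun y hy => (hV y hy).2) hδ0 hδε (fun y hy => key y hy δ ?_ ?_)
    fun y hy => key y hy (-δ) ?_ ?_
  all_goals simp only [abs_neg, abs_of_pos hδ0]; linarith

/-! ### Adapted pairs of replacements -/

/-- The condition δ₂ ≤ r/2 puts the window where χ_r is the identity, so adaptedness of the
replacement is inherited through equality of projections and low parts. -/
theorem replacement_isWindow (hA : ∀ x, IsSelfAdjoint (A x)) {r : X → ℝ} {V : Set X} {δ₁ δ₂ : ℝ}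
    (h : IsWindow E A V δ₁ δ₂) (hr : ∀ x, 0 < r x) (hr1 : ∀ x, r x < 1)
    (hδr : ∀ x ∈ V, δ₂ ≤ r x / 2) :
    IsWindow E (replacement E A r) V δ₁ δ₂ ∧ ∀ x ∈ V,
      specProj (replacement E A r x) (-δ₂) δ₂ = specProj (A x) (-δ₂) δ₂ ∧
      lowPart (replacement E A r x) δ₂ = lowPart (A x) δ₂ := by
  have h0 : 0 < δ₂ := h.pos.trans h.lt
  have key : ∀ x ∈ V, ∀ z : ℝ, δ₁ ≤ |z| → |z| ≤ δ₂ → (z : ℂ) ∉ opSpectrum (polarized (r x) (A x)) :=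
    fun x hx z h1 h2 => (polarized_mem_opSpectrum_iff (hA x) (hr x) (hr1 x)
      (h2.trans (hδr x hx))).not.2 (h.gap x hx z h1 h2)
  have hδ : ∀ x ∈ V, (δ₂ : ℂ) ∉ opSpectrum (polarized (r x) (A x)) := fun x hx =>
    key x hx δ₂ (by rw [abs_of_pos h0]; exact h.lt.le) (by rw [abs_of_pos h0])
  have hδ' : ∀ x ∈ V, ((-δ₂ : ℝ) : ℂ) ∉ opSpectrum (polarized (r x) (A x)) := fun x hx =>
    key x hx (-δ₂) (by rw [abs_neg, abs_of_pos h0]; exact h.lt.le) (by rw [abs_neg, abs_of_pos h0])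
  have e1 : ∀ x ∈ V, specProj (replacement E A r x) (-δ₂) δ₂ = specProj (A x) (-δ₂) δ₂ :=
    fun x hx => polarized_specProj (hA x) (hr x) (hr1 x) (hδr x hx) (hδ x hx) (hδ' x hx)
  have e2 : ∀ x ∈ V, lowPart (replacement E A r x) δ₂ = lowPart (A x) δ₂ :=
    fun x hx => polarized_lowPart (hA x) (hr x) (hr1 x) (hδr x hx) (hδ x hx) (hδ' x hx)
  refine ⟨⟨h.pos, h.lt, key, fun x hx => ⟨h0, hδ x hx, hδ' x hx, ?_⟩,
    h.adapted.continuous_proj.congr e1, fun x => lowPart (A x) δ₂, fun x hx v => ?_,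
    h.adapted.continuous_lowPart hA⟩, fun x hx => ⟨e1 x hx, e2 x hx⟩⟩
  · rw [specIm, e1 x hx]
    exact (h.adapted.enhanced x hx).finite
  · obtain ⟨T, hTs, hT⟩ := exists_isBoundedTransform (isSelfAdjoint_polarized (hA x) (hr x))
    have h2 := lowPart_mem_graph hT hTs (hδ x hx) (hδ' x hx) v
    beta_reduce
    rw [← e2 x hx]
    exact h2

/-! ### Adapted pairs on the cylinder -/

/-- Over this set |B| is bounded below by |cos t| > δ, so all subspaces and induced operators are
zero and the continuity conditions hold trivially. -/
theorem cylinderFamily_isAdapted_of_cos_ne_zero (hA : ∀ x, IsSelfAdjoint (A x)) {δ : ℝ}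
    (hδ : 0 < δ) :
    IsAdapted E.cylinder (cylinderFamily E A) {p | δ < |Real.cos p.2|} δ ∧
      ∀ p : Cylinder X, δ < |Real.cos p.2| →
        specProj (absOp (cylinderFamily E A p)) 0 δ = 0 ∧ lowPolar (cylinderFamily E A p) δ = 0 := by
  have h1 := fun (p : Cylinder X) (hp : δ < |Real.cos p.2|) =>
    rotated_specProj_eq_zero (hA p.1) hδ hp
  choose b hn hb using fun p : Cylinder X => exists_isBoundedTransform_rotated' (hA p.1) p.2
  have hzero : ∀ p : Cylinder X, δ < |Real.cos p.2| → ∀ v,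
      (specProj (absOp (rotated (A p.1) p.2)) 0 δ v, (0 : E.Fiber p.1 →L[ℂ] E.Fiber p.1) v) ∈
        (rotated (A p.1) p.2).graph := by
    intro p hp v
    rw [(h1 p hp).2]
    exact Submodule.zero_mem _
  have he : ∀ p : Cylinder X, δ < |Real.cos p.2| →
      IsNormalEnhanced (rotated (A p.1) p.2) (b p) δ := by
    refine fun p hp => ⟨hb p, hn p, hδ, (h1 p hp).1, ?_⟩
    have h3 : specIm (absOp (rotated (A p.1) p.2)) 0 δ = ⊥ := by
      rw [specIm, (h1 p hp).2]
      exact LinearMap.range_zero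
    rw [h3]
    infer_instance
  have hz : E.cylinder.ContinuousField {p | δ < |Real.cos p.2|} fun p =>
      specProj (absOp (cylinderFamily E A p)) 0 δ :=
    (HilbertBundle.ContinuousField.zero (E := E.cylinder)).congr fun p hp => (h1 p hp).2
  have hadj : ∀ p : Cylinder X, absOp (cylinderFamily E A p)† = absOp (cylinderFamily E A p) :=
    fun p => absOp_adjoint (hb p) (hn p)
  refine ⟨⟨fun p hp => (he p hp).isEnhanced, fun p hp => ?_, hz, ?_, fun _ => 0, hzero,
    HilbertBundle.ContinuousField.zero⟩, fun p hp => ⟨(h1 p hp).2, ?_⟩⟩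
  · rw [hadj]
    exact (he p hp).finite
  · simp only [hadj]
    exact hz
  · exact ((he p hp).eq_lowPolar (hzero p hp)).symm

/-- The projection for |B| is the projection P for A, and B P = cos t P + i sin t AP; both terms are
pulled back from X up to continuous scalar factors. -/
theorem cylinderFamily_isAdapted (hA : ∀ x, IsSelfAdjoint (A x)) {V : Set X} {δ₁ δ₂ : ℝ}
    (h : IsWindow E A V δ₁ δ₂) (h2 : δ₂ < 1) :
    IsAdapted E.cylinder (cylinderFamily E A) {p | p.1 ∈ V ∧ Real.cos p.2 ^ 2 < δ₂ ^ 2 - δ₁ ^ 2} δ₂ ∧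
      ∀ p : Cylinder X, p.1 ∈ V → Real.cos p.2 ^ 2 < δ₂ ^ 2 - δ₁ ^ 2 →
        specProj (absOp (cylinderFamily E A p)) 0 δ₂ = specProj (A p.1) (-δ₂) δ₂ ∧
        lowPolar (cylinderFamily E A p) δ₂ = (Real.cos p.2 : ℂ) • specProj (A p.1) (-δ₂) δ₂ +
          (Complex.I * (Real.sin p.2 : ℂ)) • lowPart (A p.1) δ₂ := by
  have h0 : 0 < δ₂ := h.pos.trans h.lt
  set W : Set (Cylinder X) := {p | p.1 ∈ V ∧ Real.cos p.2 ^ 2 < δ₂ ^ 2 - δ₁ ^ 2} with hW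
  have h1 := fun (p : Cylinder X) (hp : p ∈ W) =>
    rotated_specProj_eq (hA p.1) h.pos h.lt h2 hp.2 (h.gap p.1 hp.1)
  choose b hn hb using fun p : Cylinder X => exists_isBoundedTransform_rotated' (hA p.1) p.2
  choose T hTs hT using fun x => exists_isBoundedTransform (hA x)
  have hsin : ∀ p ∈ W, Real.sin p.2 ≠ 0 := by
    intro p hp h'
    have h3 := Real.sin_sq_add_cos_sq p.2
    rw [h'] at h3
    nlinarith [hp.2, sq_nonneg δ₁]
  have hgraph : ∀ p ∈ W, ∀ v, (specProj (absOp (rotated (A p.1) p.2)) 0 δ₂ v,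
      ((Real.cos p.2 : ℂ) • specProj (A p.1) (-δ₂) δ₂ +
          (Complex.I * (Real.sin p.2 : ℂ)) • lowPart (A p.1) δ₂) v) ∈
        (rotated (A p.1) p.2).graph := by
    intro p hp v
    rw [(h1 p hp).2, mem_rotated_graph (hsin p hp)]
    exact ⟨lowPart (A p.1) δ₂ v, lowPart_mem_graph (hT p.1) (hTs p.1)
      (h.adapted.enhanced p.1 hp.1).notMem (h.adapted.enhanced p.1 hp.1).neg_notMem v, rfl⟩
  have he : ∀ p ∈ W, IsNormalEnhanced (rotated (A p.1) p.2) (b p) δ₂ := by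
    refine fun p hp => ⟨hb p, hn p, h0, (h1 p hp).1, ?_⟩
    rw [specIm, (h1 p hp).2]
    exact (h.adapted.enhanced p.1 hp.1).finite
  have hP : E.cylinder.ContinuousField W fun p => specProj (A p.1) (-δ₂) δ₂ :=
    (h.adapted.continuous_proj.pullback (⟨Prod.fst, continuous_fst⟩ : C(Cylinder X, X))).mono
      fun p hp => hp.1
  have hL : E.cylinder.ContinuousField W fun p => lowPart (A p.1) δ₂ :=
    ((h.adapted.continuous_lowPart hA).pullback
      (⟨Prod.fst, continuous_fst⟩ : C(Cylinder X, X))).mono fun p hp => hp.1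
  have hz : E.cylinder.ContinuousField W fun p =>
      specProj (absOp (cylinderFamily E A p)) 0 δ₂ := hP.congr fun p hp => (h1 p hp).2
  have hadj : ∀ p : Cylinder X, absOp (cylinderFamily E A p)† = absOp (cylinderFamily E A p) :=
    fun p => absOp_adjoint (hb p) (hn p)
  refine ⟨⟨fun p hp => (he p hp).isEnhanced, fun p hp => ?_, hz, ?_, _, hgraph, ?_⟩,
    fun p hp hp' => ⟨(h1 p ⟨hp, hp'⟩).2, ?_⟩⟩
  · rw [hadj]
    exact (he p hp).finite
  · simp only [hadj]
    exact hz
  · refine HilbertBundle.ContinuousField.add (E := E.cylinder)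
      (HilbertBundle.ContinuousField.smul (E := E.cylinder) ?_ hP)
      (HilbertBundle.ContinuousField.smul (E := E.cylinder) ?_ hL)
    · exact Continuous.continuousOn (by fun_prop)
    · exact Continuous.continuousOn (by fun_prop)
  · exact ((he p ⟨hp, hp'⟩).eq_lowPolar (hgraph p ⟨hp, hp'⟩)).symm

end Windows

/-! ### The radius of a replacement -/

section Radius

variable {X : Type u} [TopologicalSpace X] {ι : Type*} (ρ : PartitionOfUnity ι X) {ε : ι → ℝ}

theorem continuous_replacementRadius : Continuous (replacementRadius ρ ε) := by
  have h := ρ.continuous_finsum_smul (g := fun a (_ : X) => ε a) fun _ _ _ => continuousAt_const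
  exact h

/-- At each point the radius is a finite convex combination of numbers from (0, 1). -/
theorem replacementRadius_mem_Ioo (h : ∀ a x, ρ a x ≠ 0 → 0 < ε a ∧ ε a < 1) (x : X) :
    replacementRadius ρ ε x ∈ Ioo (0 : ℝ) 1 := by
  have h1 := ρ.sum_eq_one (mem_univ x)
  have hfin : (Function.support fun a => ρ a x).Finite := ρ.locallyFinite.point_finite x
  rw [finsum_eq_sum_of_support_subset _ (s := hfin.toFinset) (by simp)] at h1
  rw [replacementRadius, finsum_eq_sum_of_support_subset _ (s := hfin.toFinset)
    (fun a ha => by simpa using left_ne_zero_of_mul ha)]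
  have hne : hfin.toFinset.Nonempty := by
    by_contra h2
    rw [Finset.not_nonempty_iff_eq_empty] at h2
    rw [h2, Finset.sum_empty] at h1
    exact zero_ne_one h1
  have hpos : ∀ a ∈ hfin.toFinset, 0 < ρ a x := fun a ha =>
    (ρ.nonneg a x).lt_of_ne' (by simpa using ha)
  have hε : ∀ a ∈ hfin.toFinset, 0 < ε a ∧ ε a < 1 := fun a ha => h a x (hpos a ha).ne'
  refine ⟨Finset.sum_pos (fun a ha => mul_pos (hpos a ha) (hε a ha).1) hne, ?_⟩
  rw [← h1]
  exact Finset.sum_lt_sum_of_nonempty hne fun a ha =>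
    mul_lt_of_lt_one_right (hpos a ha) (hε a ha).2

end Radius

variable {X : Type u} [TopologicalSpace X] {H : Type v} [NormedAddCommGroup H]
  [InnerProductSpace ℂ H] [CompleteSpace H] {E : HilbertBundle.{u, v, w} X H}

theorem sumElim_cover {ι ι' : Type*} {U : ι → Set X} {U' : ι' → Set X} (hU : ∀ a, IsOpen (U a))
    (hU' : ∀ a, IsOpen (U' a)) (hc : ⋃ a, U a = univ) :
    (∀ a, IsOpen (Sum.elim U U' a)) ∧ ⋃ a, Sum.elim U U' a = univ := by
  refine ⟨?_, ?_⟩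
  · rintro (a | a)
    exacts [hU a, hU' a]
  · rw [iUnion_sum]
    simp [hc]

/-! ### Index maps of self-adjoint families: independence of choices and comparison -/

section SelfAdjointFamilies

variable {A A' : ∀ x, E.Fiber x →ₗ.[ℂ] E.Fiber x}

theorem IsIndexFunctorSA.unique {ι : Type u} {U : ι → Set X} {ε : ι → ℝ}
    {F G : ∀ x, CoverFiber U x ⥤ SubspaceObj (E.Fiber x)} (hF : IsIndexFunctorSA E A U ε F)
    (hG : IsIndexFunctorSA E A U ε G) : F = G :=
  funext fun x => subspaceFunctor_ext (fun i => (hF.obj_eq x i).trans (hG.obj_eq x i).symm)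
    (fun f => (hF.neg_eq x _ _ f).trans (hG.neg_eq x _ _ f).symm)
    fun f => (hF.pos_eq x _ _ f).trans (hG.pos_eq x _ _ f).symm

theorem IsIndexFunctorSA.comp_coverIncl {ι κ : Type u} (j : ι ↪ κ) {W : κ → Set X} {ε : κ → ℝ}
    {G : ∀ x, CoverFiber W x ⥤ SubspaceObj (E.Fiber x)} (hG : IsIndexFunctorSA E A W ε G) :
    IsIndexFunctorSA E A (fun a => W (j a)) (fun a => ε (j a)) fun x => coverIncl j W x ⋙ G x := by
  refine ⟨fun x τ => ?_, fun x τ σ f => ?_, fun x τ σ f => ?_⟩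
  · rw [← coverIncl_min]
    exact hG.obj_eq x _
  · rw [← coverIncl_min, ← coverIncl_min]
    exact hG.neg_eq x _ _ _
  · rw [← coverIncl_min, ← coverIncl_min]
    exact hG.pos_eq x _ _ _

theorem IsIndexMapSA.homotopic [T2Space X] [ParacompactSpace X] [CompactlyCoherentSpace X]
    (hA : ∀ x, IsSelfAdjoint (A x)) {f f' : C(X, Realization E.SubspaceCat)}
    (hf : IsIndexMapSA E A f) (hf' : IsIndexMapSA E A f') : f.Homotopic f' := by
  obtain ⟨ι, U, ε, s, F, hU, hc, had, hs, hF, hf⟩ := hf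
  obtain ⟨ι', U', ε', s', F', hU', hc', had', hs', hF', hf'⟩ := hf'
  -- Over the disjoint union of the index sets both choices become parts of one adapted covering. By
  -- uniqueness the given index functors are the restrictions of its index functor.
  obtain ⟨hW, hWc⟩ := sumElim_cover hU hU' hc
  have hWad : ∀ a, IsAdaptedSA E A (Sum.elim U U' a) (Sum.elim ε ε' a) := by
    rintro (a | a)
    exacts [had a, had' a]
  obtain ⟨G, hG⟩ := exists_isIndexFunctorSA hA hWad
  obtain rfl := hF.unique (hG.comp_coverIncl Function.Embedding.inl)
  obtain rfl := hF'.unique (hG.comp_coverIncl Function.Embedding.inr)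
  exact (homotopicRel_of_coverIncl Function.Embedding.inl Function.Embedding.inr hW hWc G
    (hG.continuous hA hWad) ∅ (fun _ _ h => h.elim) s s' hs.1 hs'.1 f f' hf hf').homotopic

/-- Families having the same parts near zero have a common index functor. -/
theorem IsIndexFunctorSA.congr (hA : ∀ x, IsSelfAdjoint (A x)) (hA' : ∀ x, IsSelfAdjoint (A' x))
    {ι : Type u} {U : ι → Set X} {ε : ι → ℝ} (hU : ∀ a, IsAdaptedSA E A (U a) (ε a))
    (hU' : ∀ a, IsAdaptedSA E A' (U a) (ε a))
    (h : ∀ a, ∀ x ∈ U a, specProj (A' x) (-ε a) (ε a) = specProj (A x) (-ε a) (ε a) ∧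
      lowPart (A' x) (ε a) = lowPart (A x) (ε a))
    {F : ∀ x, CoverFiber U x ⥤ SubspaceObj (E.Fiber x)} (hF : IsIndexFunctorSA E A U ε F) :
    IsIndexFunctorSA E A' U ε F := by
  have he := fun {x : X} (σ : CoverFiber U x) => isEnhancedSA_min hU σ
  have he' := fun {x : X} (σ : CoverFiber U x) => isEnhancedSA_min hU' σ
  have hobj : ∀ x (σ : CoverFiber U x),
      specProj (A' x) (-σ.min ε) (σ.min ε) = specProj (A x) (-σ.min ε) (σ.min ε) ∧
      lowPart (A' x) (σ.min ε) = lowPart (A x) (σ.min ε) := by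
    intro x σ
    obtain ⟨a, -, h1, hx⟩ := σ.exists_min_eq (ε := ε)
    rw [h1]
    exact h a x hx
  have key : ∀ x (σ : CoverFiber U x) (a b : ℝ), (a : ℂ) ∉ opSpectrum (A x) →
      (b : ℂ) ∉ opSpectrum (A x) → (a : ℂ) ∉ opSpectrum (A' x) → (b : ℂ) ∉ opSpectrum (A' x) →
      a ≠ 0 → b ≠ 0 → -σ.min ε ≤ a → b ≤ σ.min ε → specIm (A x) a b = specIm (A' x) a b := by
    intro x σ a b ha hb ha' hb' ha0 hb0 hεa hbε
    obtain ⟨T, hTs, hT⟩ := exists_isBoundedTransform (hA x)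
    obtain ⟨T', hTs', hT'⟩ := exists_isBoundedTransform (hA' x)
    rw [specIm, specIm, specProj_eq_lowPart hT hTs (he σ).notMem (he σ).neg_notMem ha hb ha0 hb0
      hεa hbε, specProj_eq_lowPart hT' hTs' (he' σ).notMem (he' σ).neg_notMem ha' hb' ha0 hb0
      hεa hbε, (hobj x σ).1, (hobj x σ).2]
  refine ⟨fun x τ => ?_, fun x τ σ f => ?_, fun x τ σ f => ?_⟩
  · rw [hF.obj_eq, specIm, specIm, (hobj x τ).1]
  · rw [hF.neg_eq]
    exact key x σ _ _ (he σ).neg_notMem (he τ).neg_notMem (he' σ).neg_notMem (he' τ).neg_notMem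
      (neg_ne_zero.2 (he σ).pos.ne') (neg_ne_zero.2 (he τ).pos.ne') le_rfl
      (by linarith [(he σ).pos, (he τ).pos])
  · rw [hF.pos_eq]
    exact key x σ _ _ (he τ).notMem (he σ).notMem (he' τ).notMem (he' σ).notMem
      (he τ).pos.ne' (he σ).pos.ne' (by linarith [(he σ).pos, (he τ).pos]) le_rfl

theorem exists_isIndexMapSA_common [T2Space X] [ParacompactSpace X] [CompactlyCoherentSpace X]
    (hA : ∀ x, IsSelfAdjoint (A x)) (hA' : ∀ x, IsSelfAdjoint (A' x))
    {ι : Type u} {U : ι → Set X} {ε : ι → ℝ} (hUo : ∀ a, IsOpen (U a)) (hc : ⋃ a, U a = univ)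
    (hU : ∀ a, IsAdaptedSA E A (U a) (ε a)) (hU' : ∀ a, IsAdaptedSA E A' (U a) (ε a))
    (h : ∀ a, ∀ x ∈ U a, specProj (A' x) (-ε a) (ε a) = specProj (A x) (-ε a) (ε a) ∧
      lowPart (A' x) (ε a) = lowPart (A x) (ε a)) :
    ∃ f, IsIndexMapSA E A f ∧ IsIndexMapSA E A' f := by
  obtain ⟨s, hs⟩ := exists_isHomotopySection hUo hc
  obtain ⟨F, hF⟩ := exists_isIndexFunctorSA hA hU
  exact ⟨⟨_, (Realization.continuous_map _ (hF.continuous hA hU)).comp s.continuous⟩,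
    ⟨ι, U, ε, s, F, hUo, hc, hU, hs, hF, rfl⟩,
    ⟨ι, U, ε, s, F, hUo, hc, hU', hs, hF.congr hA hA' hU hU' h, rfl⟩⟩

end SelfAdjointFamilies

/-! ### Index maps of normal families: independence of choices and comparison -/

section NormalFamilies

variable {B B' : ∀ x, E.Fiber x →ₗ.[ℂ] E.Fiber x} {b b' : ∀ x, E.Fiber x →L[ℂ] E.Fiber x}

theorem IsIndexFunctor.unique {ι : Type u} {U : ι → Set X} {ε : ι → ℝ}
    {F G : ∀ x, CoverFiber U x ⥤ PairObj (E.Fiber x)} (hF : IsIndexFunctor E B U ε F)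
    (hG : IsIndexFunctor E B U ε G) : F = G :=
  funext fun x => pairFunctor_ext (fun i => (hF.fst_eq x i).trans (hG.fst_eq x i).symm)
    (fun i => (hF.snd_eq x i).trans (hG.snd_eq x i).symm)
    fun f => (hF.iso_eq x _ _ f).trans (hG.iso_eq x _ _ f).symm

theorem IsIndexFunctor.comp_coverIncl {ι κ : Type u} (j : ι ↪ κ) {W : κ → Set X} {ε : κ → ℝ}
    {G : ∀ x, CoverFiber W x ⥤ PairObj (E.Fiber x)} (hG : IsIndexFunctor E B W ε G) :
    IsIndexFunctor E B (fun a => W (j a)) (fun a => ε (j a)) fun x => coverIncl j W x ⋙ G x := by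
  refine ⟨fun x τ => ?_, fun x τ => ?_, fun x τ σ f => ?_⟩
  · rw [← coverIncl_min]
    exact hG.fst_eq x _
  · rw [← coverIncl_min]
    exact hG.snd_eq x _
  · rw [← coverIncl_min, ← coverIncl_min]
    exact hG.iso_eq x _ _ _

/-- Index maps of a family of normal operators are homotopic relative to the set of points over
which the operators are bounded below by all admissible numbers. -/
theorem IsIndexMap.homotopicRel [T2Space X] [ParacompactSpace X] [CompactlyCoherentSpace X]
    (hn : ∀ x, IsStarNormal (b x)) (hb : ∀ x, IsBoundedTransform (B x) (b x)) {Z : Set X}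
    (hZ : ∀ x ∈ Z, ∀ ε, IsEnhanced (B x) ε → specIm (absOp (B x)) 0 ε = ⊥)
    {f f' : C(X, Realization E.PairCat)} (hf : IsIndexMap E B f) (hf' : IsIndexMap E B f') :
    f.HomotopicRel f' Z := by
  obtain ⟨ι, U, ε, s, F, hU, hc, had, hs, hF, hf⟩ := hf
  obtain ⟨ι', U', ε', s', F', hU', hc', had', hs', hF', hf'⟩ := hf'
  obtain ⟨hW, hWc⟩ := sumElim_cover hU hU' hc
  have hWad : ∀ a, IsAdapted E B (Sum.elim U U' a) (Sum.elim ε ε' a) := by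
    rintro (a | a)
    exacts [had a, had' a]
  obtain ⟨G, hG⟩ := exists_isIndexFunctor hn hb hWad
  obtain rfl := hF.unique (hG.comp_coverIncl Function.Embedding.inl)
  obtain rfl := hF'.unique (hG.comp_coverIncl Function.Embedding.inr)
  -- Over Z every object is the zero pair, for the merged covering too, so the induced map collapses
  -- the fibers over Z and the homotopy does not move there.
  have hbot : ∀ x ∈ Z, ∀ σ : CoverFiber (Sum.elim U U') x, ((G x).obj σ).fst = ⊥ := by
    intro x hx σ
    rw [hG.fst_eq]
    exact hZ x hx _ (isNormalEnhanced_min hn hb hWad σ).isEnhanced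
  refine homotopicRel_of_coverIncl Function.Embedding.inl Function.Embedding.inr hW hWc G
    (hG.continuous hn hb hWad) Z (fun q q' hq hqq' => realization_map_eq_of_bot G (hbot _ hq)
      (fun σ => ?_) rfl hqq'.symm) s s' hs.1 hs'.1 f f' hf hf'
  rw [hG.snd_eq, absOp_adjoint (hb _) (hn _), ← hG.fst_eq]
  exact hbot _ hq σ

/-- Families having the same parts near zero have a common index functor. -/
theorem IsIndexFunctor.congr (hn : ∀ x, IsStarNormal (b x))
    (hb : ∀ x, IsBoundedTransform (B x) (b x)) (hn' : ∀ x, IsStarNormal (b' x))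
    (hb' : ∀ x, IsBoundedTransform (B' x) (b' x))
    {ι : Type u} {U : ι → Set X} {ε : ι → ℝ} (hU : ∀ a, IsAdapted E B (U a) (ε a))
    (hU' : ∀ a, IsAdapted E B' (U a) (ε a))
    (h : ∀ a, ∀ x ∈ U a, specProj (absOp (B' x)) 0 (ε a) = specProj (absOp (B x)) 0 (ε a) ∧
      lowPolar (B' x) (ε a) = lowPolar (B x) (ε a))
    {F : ∀ x, CoverFiber U x ⥤ PairObj (E.Fiber x)} (hF : IsIndexFunctor E B U ε F) :
    IsIndexFunctor E B' U ε F := by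
  have he := fun {x : X} (σ : CoverFiber U x) => isNormalEnhanced_min hn hb hU σ
  have he' := fun {x : X} (σ : CoverFiber U x) => isNormalEnhanced_min hn' hb' hU' σ
  have hobj : ∀ x (σ : CoverFiber U x),
      specProj (absOp (B' x)) 0 (σ.min ε) = specProj (absOp (B x)) 0 (σ.min ε) ∧
      lowPolar (B' x) (σ.min ε) = lowPolar (B x) (σ.min ε) := by
    intro x σ
    obtain ⟨a, -, h1, hx⟩ := σ.exists_min_eq (ε := ε)
    rw [h1]
    exact h a x hx
  have hfst : ∀ x (τ : CoverFiber U x), ((F x).obj τ).fst = specIm (absOp (B' x)) 0 (τ.min ε) := by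
    intro x τ
    rw [hF.fst_eq, specIm, specIm, (hobj x τ).1]
  refine ⟨hfst, fun x τ => ?_, fun x τ σ f => ?_⟩
  · rw [hF.snd_eq, absOp_adjoint (hb _) (hn _), absOp_adjoint (hb' _) (hn' _), ← hF.fst_eq, hfst]
  · have hle : τ.min ε ≤ σ.min ε := CoverFiber.min_le_min (leOfHom f)
    rw [hF.iso_eq]
    have h1 := (he σ).polarPart_mul_specProj (he τ).pos hle le_rfl (he τ).notMem (he σ).notMem
    have h2 := (he' σ).polarPart_mul_specProj (he' τ).pos hle le_rfl (he' τ).notMem (he' σ).notMem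
    rw [(hobj x σ).2, ← h1] at h2
    exact h2.symm

theorem exists_isIndexMap_common [T2Space X] [ParacompactSpace X] [CompactlyCoherentSpace X]
    (hn : ∀ x, IsStarNormal (b x))
    (hb : ∀ x, IsBoundedTransform (B x) (b x)) (hn' : ∀ x, IsStarNormal (b' x))
    (hb' : ∀ x, IsBoundedTransform (B' x) (b' x))
    {ι : Type u} {U : ι → Set X} {ε : ι → ℝ} (hUo : ∀ a, IsOpen (U a)) (hc : ⋃ a, U a = univ)
    (hU : ∀ a, IsAdapted E B (U a) (ε a)) (hU' : ∀ a, IsAdapted E B' (U a) (ε a))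
    (h : ∀ a, ∀ x ∈ U a, specProj (absOp (B' x)) 0 (ε a) = specProj (absOp (B x)) 0 (ε a) ∧
      lowPolar (B' x) (ε a) = lowPolar (B x) (ε a)) :
    ∃ f, IsIndexMap E B f ∧ IsIndexMap E B' f := by
  obtain ⟨s, hs⟩ := exists_isHomotopySection hUo hc
  obtain ⟨F, hF⟩ := exists_isIndexFunctor hn hb hU
  exact ⟨⟨_, (Realization.continuous_map _ (hF.continuous hn hb hU)).comp s.continuous⟩,
    ⟨ι, U, ε, s, F, hUo, hc, hU, hs, hF, rfl⟩,
    ⟨ι, U, ε, s, F, hUo, hc, hU', hs, hF.congr hn hb hn' hb' hU hU' h, rfl⟩⟩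

end NormalFamilies

/-! ### Equality of the analytic and of the classical indices -/

section Indices

variable [T2Space X] [ParacompactSpace X] [CompactlyCoherentSpace X]
  {A A' : ∀ x, E.Fiber x →ₗ.[ℂ] E.Fiber x}

theorem cylinder_isIndexMap_homotopicRel (hH : ¬ FiniteDimensional ℂ H)
    (hA : ∀ x, IsSelfAdjoint (A x)) {f f' : C(Cylinder X, Realization E.cylinder.PairCat)}
    (hf : IsIndexMap E.cylinder (cylinderFamily E A) f)
    (hf' : IsIndexMap E.cylinder (cylinderFamily E A) f') :
    f.HomotopicRel f' (Cylinder.ends X) := by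
  have : CompactlyCoherentSpace (Cylinder X) := compactlyCoherentSpace_prod
  choose b hn hb using fun p : Cylinder X => exists_isBoundedTransform_rotated' (hA p.1) p.2
  refine hf.homotopicRel hn hb (fun p hp ε he => ?_) hf'
  have hK : ¬ FiniteDimensional ℂ (E.Fiber p.1) := by
    intro h
    obtain ⟨i, hi⟩ := E.exists_mem_dom p.1
    exact hH (E.triv i ⟨p.1, hi⟩).toLinearEquiv.finiteDimensional
  have ht : Real.sin p.2 = 0 := by
    rcases hp with h | h <;> rw [h]
    exacts [Real.sin_zero, Real.sin_pi]
  exact specIm_rotated_eq_bot hK (hA p.1) ht he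

/-- If two families have common windows in which their parts near zero are equal, then they have
equal analytic indices and equal classical analytic indices. -/
theorem hasIndex_common (hH : ¬ FiniteDimensional ℂ H) (hA : ∀ x, IsSelfAdjoint (A x))
    (hA' : ∀ x, IsSelfAdjoint (A' x))
    (h : ∀ x, ∃ (δ₁ δ₂ : ℝ) (V : Set X), IsOpen V ∧ x ∈ V ∧ δ₂ < 1 ∧ IsWindow E A V δ₁ δ₂ ∧
      IsWindow E A' V δ₁ δ₂ ∧ ∀ y ∈ V, specProj (A' y) (-δ₂) δ₂ = specProj (A y) (-δ₂) δ₂ ∧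
        lowPart (A' y) δ₂ = lowPart (A y) δ₂) :
    (∃ c, HasAnalyticIndex E A c ∧ HasAnalyticIndex E A' c) ∧
      ∃ c, HasClassicalIndex E A c ∧ HasClassicalIndex E A' c := by
  -- The points of X index the covering by windows, which keeps the index type in the universe
  -- required of index maps.
  choose δ₁ δ₂ V hV hxV hδ hw hw' heq using h
  have : CompactlyCoherentSpace (Cylinder X) := compactlyCoherentSpace_prod
  constructor
  · obtain ⟨f, hf, hf'⟩ := exists_isIndexMapSA_common hA hA' hV
      (iUnion_eq_univ_iff.2 fun x => ⟨x, hxV x⟩) (fun x => (hw x).adapted)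
      (fun x => (hw' x).adapted) heq
    exact ⟨Quot.mk _ f, ⟨⟨f, hf⟩, fun g hg => Quot.sound (hg.homotopic hA hf)⟩,
      ⟨⟨f, hf'⟩, fun g hg => Quot.sound (hg.homotopic hA' hf')⟩⟩
  · choose b hn hb using fun p : Cylinder X => exists_isBoundedTransform_rotated' (hA p.1) p.2
    choose b' hn' hb' using fun p : Cylinder X => exists_isBoundedTransform_rotated' (hA' p.1) p.2
    have hpairs : ∀ p : Cylinder X, ∃ (δ : ℝ) (W : Set (Cylinder X)), IsOpen W ∧ p ∈ W ∧
        IsAdapted E.cylinder (cylinderFamily E A) W δ ∧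
        IsAdapted E.cylinder (cylinderFamily E A') W δ ∧
        ∀ q ∈ W, specProj (absOp (cylinderFamily E A' q)) 0 δ =
            specProj (absOp (cylinderFamily E A q)) 0 δ ∧
          lowPolar (cylinderFamily E A' q) δ = lowPolar (cylinderFamily E A q) δ := by
      intro p
      -- Around cos t = 0 the pairs come from windows of A and A'; elsewhere half of |cos t| leaves
      -- a margin, and the data of both families vanish.
      by_cases hp : Real.cos p.2 = 0
      · have h1 := cylinderFamily_isAdapted hA (hw p.1) (hδ p.1)
        have h2 := cylinderFamily_isAdapted hA' (hw' p.1) (hδ p.1)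
        refine ⟨δ₂ p.1, {q | q.1 ∈ V p.1 ∧ Real.cos q.2 ^ 2 < δ₂ p.1 ^ 2 - δ₁ p.1 ^ 2}, ?_, ?_,
          h1.1, h2.1, fun q hq => ⟨?_, ?_⟩⟩
        · exact ((hV p.1).preimage continuous_fst).inter
            (isOpen_lt (f := fun q : Cylinder X => Real.cos q.2 ^ 2) (by fun_prop)
              continuous_const)
        · refine ⟨hxV p.1, ?_⟩
          rw [hp]
          nlinarith [(hw p.1).pos, (hw p.1).lt]
        · rw [(h1.2 q hq.1 hq.2).1, (h2.2 q hq.1 hq.2).1, (heq p.1 q.1 hq.1).1]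
        · rw [(h1.2 q hq.1 hq.2).2, (h2.2 q hq.1 hq.2).2, (heq p.1 q.1 hq.1).1,
            (heq p.1 q.1 hq.1).2]
      · have h0 : 0 < |Real.cos p.2| / 2 := half_pos (abs_pos.2 hp)
        have h1 := cylinderFamily_isAdapted_of_cos_ne_zero hA h0
        have h2 := cylinderFamily_isAdapted_of_cos_ne_zero hA' h0
        refine ⟨|Real.cos p.2| / 2, {q | |Real.cos p.2| / 2 < |Real.cos q.2|}, ?_,
          half_lt_self (abs_pos.2 hp), h1.1, h2.1,
          fun q hq => ⟨?_, ?_⟩⟩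
        · exact isOpen_lt continuous_const (by fun_prop)
        · rw [(h1.2 q hq).1, (h2.2 q hq).1]
        · rw [(h1.2 q hq).2, (h2.2 q hq).2]
    choose δ W hW hpW hW1 hW2 hWeq using hpairs
    obtain ⟨f, hf, hf'⟩ := exists_isIndexMap_common hn hb hn' hb' hW
      (iUnion_eq_univ_iff.2 fun p => ⟨p, hpW p⟩) hW1 hW2 hWeq
    exact ⟨Quot.mk _ f,
      ⟨⟨f, hf⟩, fun g hg => Quot.sound (cylinder_isIndexMap_homotopicRel hH hA hg hf)⟩,
      ⟨⟨f, hf'⟩, fun g hg => Quot.sound (cylinder_isIndexMap_homotopicRel hH hA' hg hf')⟩⟩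

end Indices

end FredholmIndex

end

theorem mainTheorem10
    {X : Type u} [TopologicalSpace X] [T2Space X] [ParacompactSpace X] [CompactlyGeneratedSpace X]
    {H : Type v} [NormedAddCommGroup H] [InnerProductSpace ℂ H] [CompleteSpace H]
    [TopologicalSpace.SeparableSpace H] (hH : ¬ FiniteDimensional ℂ H)
    (E : FredholmIndex.HilbertBundle.{u, v, w} X H)
    (A : ∀ x, E.Fiber x →ₗ.[ℂ] E.Fiber x) (hA : FredholmIndex.IsFredholmFamilySA E A)
    {ι : Type*} (U : ι → Set X) (ε : ι → ℝ)
    (hU : ∀ a, IsOpen (U a)) (hcover : (⋃ a, U a) = Set.univ) (hfin : LocallyFinite U)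
    (hε : ∀ a, ε a < 1) (hadapted : ∀ a, FredholmIndex.IsAdaptedSA E A (U a) (ε a))
    (ρ : PartitionOfUnity ι X) (hρ : ρ.IsSubordinate U) :
    (∃ c, FredholmIndex.HasAnalyticIndex E A c ∧
      FredholmIndex.HasAnalyticIndex E
        (FredholmIndex.replacement E A (FredholmIndex.replacementRadius ρ ε)) c) ∧
    (∃ c, FredholmIndex.HasClassicalIndex E A c ∧
      FredholmIndex.HasClassicalIndex E
        (FredholmIndex.replacement E A (FredholmIndex.replacementRadius ρ ε)) c) := by
  have hA' := hA.selfAdjoint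
  have hr := FredholmIndex.replacementRadius_mem_Ioo ρ (ε := ε) fun a x hx =>
    ⟨((hadapted a).enhanced x (hρ a (subset_closure hx))).pos, hε a⟩
  have hrc := FredholmIndex.continuous_replacementRadius ρ (ε := ε)
  refine FredholmIndex.hasIndex_common hH hA' (fun x => FredholmIndex.isSelfAdjoint_polarized (hA' x) (hr x).1) fun x => ?_
  obtain ⟨ε₀, U₀, hU₀, had⟩ := hA.adapted x
  -- The bound 1 is needed for windows on the cylinder, the bound r(x)/2 for comparison with the
  -- replacement. By continuity of r the second bound persists on a smaller neighborhood, with which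
  -- V is intersected below.
  obtain ⟨δ₁, δ₂, V, hV, hxV, hδ, hw⟩ := FredholmIndex.exists_isWindow hA' had hU₀
    (lt_min one_pos (half_pos (hr x).1))
  have hδr : δ₂ < FredholmIndex.replacementRadius ρ ε x / 2 := hδ.trans_le (min_le_right _ _)
  have hw' : FredholmIndex.IsWindow E A (V ∩ {y | δ₂ < FredholmIndex.replacementRadius ρ ε y / 2}) δ₁ δ₂ :=
    hw.mono inter_subset_left
  obtain ⟨h1, h2⟩ := FredholmIndex.replacement_isWindow hA' hw' (fun y => (hr y).1) (fun y => (hr y).2)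
    fun y hy => hy.2.le
  exact ⟨δ₁, δ₂, _, hV.inter (isOpen_lt continuous_const (hrc.div_const 2)), ⟨hxV, hδr⟩,
    hδ.trans_le (min_le_left _ _), hw', h1, h2⟩
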